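/- **Setting.** Let $\Lambda\subset\mathbb R^2$ be a finite set of qubits, divided into a left boundary $L$, a bulk $B$ and a right boundary $R$, where all sites of $L$ lie to the left of those of $B$, and both to the left of those of $R$. Let $G=\mathbb Z_2^m$ act on each site $i$ by $u_i(g)\in\{I,X,Y,Z\}$, linearly ($u_i(g)u_i(g')=u_i(g+g')$) for $i\in B$ and projectively (the same up to a scalar) for $i\in L\cup R$. Put $V_L(g)=\bigotimes_{i\in L}u_i(g)$, $U_B(g)=\bigotimes_{i\in B}u_i(g)$, $V_R(g)=\bigotimes_{i\in R}u_i(g)$, $U(g)=V_L(g)\otimes U_B(g)\otimes V_R(g)$, and suppose that $V_L$ and $V_R$ have the same commutation signs: $V_\bullet(g)V_\bullet(g')=(-1)^{\kappa(g,g')}V_\bullet(g')V_\bullet(g)$. Let $H\le G$ be a maximal subgroup with $V_R(H)$ abelian, and suppose that $u_i(h),u_i(h')$ commute for all $h,h'\in H$ and $i\in L\cup R$. The logical observables are $T(g)=U(g)$ for $g\in H$ and $T(g)=I_L\otimes U_B(g)\otimes V_R(g)$ for $g\notin H$. An element $g$ is localizable to $k\in B$ if some Pauli operator $\beta$ at $k$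 satisfies $u_k(g')\beta=(-1)^{\kappa(g,g')}\beta u_k(g')$ for all $g'\in G$; $\mathcal G_k$ is the set of these $g$, and $\mathcal G=\bigcup_{k\in B}\mathcal G_k$. For $k\in B$ and $g\in\mathcal G_k$ fix such a $\beta_k(g)$, and let $R_k(g)$ be $\beta_k(g)$ times the restriction of $U(g)$ to the sites strictly to the right of $k$. For a state $\Phi$ put $\sigma_k(g)=\langle\Phi|R_k(g)|\Phi\rangle$. For $\Omega\subset\Lambda$, $\mathcal N_k(\Omega)$ is the set of sites at Euclidean distance at most $k$ from $\Omega$. $\mathcal A$ is the Lie algebra generated by $\{T(g):g\in\mathcal G\}$ under $i[\cdot,\cdot]$ and real linear combinations, and $\mathcal L=\exp(-i\mathcal A)$. **Hypotheses.** Let $\Delta\in\mathbb N$, $d>0$, and let $\Phi$ be a state of the qubits such that (a) $\Phi=W\Phi_0$ for a stabilizer state $\Phi_0$ and a unitary $W$ that commutes with all $U(g)$ and has spread at most $\Delta$ ($W^\dagger PW$ is supported in $\mathcal N_\Delta(\Omega)$ whenever $P$ is supported in $\Omega$); (b) for any two regions $P,Q\subset\Lambda$ at distance at least $2\Delta+d$,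 the stabilizer group of $\Phi_0$ has a generating set such that no generator that crosses the boundary of $\mathcal N_\Delta(P)$ overlaps with $\mathcal N_\Delta(Q)$; (c) $U(g)\Phi=(-1)^{\chi(g)}\Phi$ for all $g\in G$, with $\chi(g)\in\{0,1\}$; (d) $\sigma_k(g)\ne0$ for all $k\in B$ and $g\in\mathcal G_k$. **Implementation.** MBQC on $\Phi$ *implements* a channel $\mathcal E$ if there is an adaptive protocol of single-qubit measurements, which measures the sites of $L\cup B$ first and those of $R$ last, with the following two properties. For each $g\in G$ the statistics of $V_R(g)$ after the measurements of $L\cup B$, corrected by a sign computed from their outcomes, have the expectation value $\operatorname{Tr}[T(g)\,\mathcal E(|\Phi\rangle\langle\Phi|)]$. For each basis $b_1,\dots,b_r$ of $H$, $r=\operatorname{rank}(H)$, $r$ bits computed from all outcomes are distributed as in a joint measurement of the logical $Z$-observables $T(b_1),\dots,T(b_r)$ in the state $\mathcal E(|\Phi\rangle\langle\Phi|)$. **Theorem.** Under these hypotheses: (i) *(Initialization and readout of $\operatorname{rank}(H)$ logical qubits.)* $T(h)\Phi=(-1)^{\chi(h)}\Phi$ for $h\in H$, $\langle\Phi|T(g)|\Phi\rangle=0$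 for $g\notin H$, and MBQC on $\Phi$ implements the identity channel. If moreover $U(h)\neq I$ for all $0\ne h\in H$, then for each basis $b$ of $H$ the $2^r$ joint eigenspaces of $T(b_1),\dots,T(b_r)$ all have dimension $2^{|\Lambda|-r}$. (ii) *(Logical gates.)* For all $\varepsilon>0$ and $\sigma_0>0$ there is an $N$, depending only on $m,\varepsilon,\sigma_0$, such that the following holds whenever $|\sigma_k(g)|\ge\sigma_0$ for all $k\in B$, $g\in\mathcal G_k$, and the bulk contains $N$ groups of sites, ordered from left to right, with sites of different groups at horizontal distance at least $2\Delta+d$ and every $g\in\mathcal G$ localizable to a site of each group. For every $V\in\mathcal L$ MBQC on $\Phi$ implements a completely positive trace-preserving map whose Kraus operators lie in the algebra generated by $T(G)$ and whose diamond-norm distance from $\rho\mapsto V\rho V^\dagger$ is at most $\varepsilon$. -/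

import Mathlib

namespace MBQC

open Matrix

/-! ### Qubits, operators, Pauli operators -/

/-- Operators on the Hilbert space of qubits placed at the sites `Λ`: matrices in the computational
basis, whose elements are the maps `Λ → Fin 2`. -/
abbrev Op (Λ : Type) := Matrix (Λ → Fin 2) (Λ → Fin 2) ℂ

/-- State vectors of the qubits placed at the sites `Λ`. -/
abbrev Vec (Λ : Type) := (Λ → Fin 2) → ℂ

/-- The four labels of the single-qubit Pauli operators. -/
inductive Pauli where
  | I : Pauli
  | X : Pauli
  | Y : Pauli
  | Z : Pauli

/-- The single-qubit Pauli matrices. -/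
noncomputable def Pauli.mat : Pauli → Matrix (Fin 2) (Fin 2) ℂ
  | .I => 1
  | .X => !![0, 1; 1, 0]
  | .Y => !![0, -Complex.I; Complex.I, 0]
  | .Z => !![1, 0; 0, -1]

/-- The sign `(-1)^a`. -/
noncomputable def sgn (a : ZMod 2) : ℂ := if a = 0 then 1 else -1

/-- The tensor product of single-qubit operators. -/
noncomputable def tensor {Λ : Type} [Fintype Λ] (a : Λ → Matrix (Fin 2) (Fin 2) ℂ) : Op Λ :=
  Matrix.of fun x y => ∏ i, a i (x i) (y i)

open Classical in
/-- The tensor product of single-qubit operators over the sites in `A`, with identities on all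
other sites. -/
noncomputable def tensorOn {Λ : Type} [Fintype Λ] (A : Set Λ)
    (a : Λ → Matrix (Fin 2) (Fin 2) ℂ) : Op Λ :=
  tensor fun i => if i ∈ A then a i else 1

/-- The expectation value `⟨Φ|A|Φ⟩`. -/
noncomputable def ev {Λ : Type} [Fintype Λ] [DecidableEq Λ] (Φ : Vec Λ) (A : Op Λ) : ℂ :=
  star Φ ⬝ᵥ (A *ᵥ Φ)

/-- The rank-one operator `|Φ⟩⟨Φ|`. -/
noncomputable def ketbra {Λ : Type} (Φ : Vec Λ) : Op Λ := vecMulVec Φ (star Φ)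

/-- The support of `P` is contained in `Ω`, that is, `P = P_Ω ⊗ I` for an operator `P_Ω` on the
qubits of `Ω`. -/
def SupportedOn {Λ : Type} (P : Op Λ) (Ω : Set Λ) : Prop :=
  ∃ M : (Ω → Fin 2) → (Ω → Fin 2) → ℂ,
    (∀ x y, (∀ i, i ∉ Ω → x i = y i) → P x y = M (fun i => x i) (fun i => y i)) ∧
    (∀ x y, (∃ i, i ∉ Ω ∧ x i ≠ y i) → P x y = 0)

/-- The stabilizer group of `Φ₀`: all Pauli operators with sign `±1` that fix `Φ₀`. -/
def stab {Λ : Type} [Fintype Λ] [DecidableEq Λ] (Φ₀ : Vec Λ) : Set (Op Λ) :=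
  {s | (∃ p : Λ → Pauli, s = tensor (fun i => (p i).mat) ∨ s = -tensor (fun i => (p i).mat)) ∧
    s *ᵥ Φ₀ = Φ₀}

/-- `Φ₀` is a stabilizer state: a unit vector that is determined, up to a scalar, by its stabilizer
group. -/
def IsStabilizerState {Λ : Type} [Fintype Λ] [DecidableEq Λ] (Φ₀ : Vec Λ) : Prop :=
  star Φ₀ ⬝ᵥ Φ₀ = 1 ∧ ∀ ψ : Vec Λ, (∀ s ∈ stab Φ₀, s *ᵥ ψ = ψ) → ∃ c : ℂ, ψ = c • Φ₀

/-! ### The lattice and the symmetry representation -/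

/-- The symmetry group `ℤ₂^m`, written additively. -/
abbrev G (m : ℕ) := Fin m → ZMod 2

/-- A finite 2D lattice of qubits with left boundary `L`, bulk `B` and right boundary `R`, and a
representation of `ℤ₂^m` by tensor products of Pauli operators that is site-locally linear in the
bulk and site-locally projective at the two boundaries, where the two boundary representations
`V_L`, `V_R` have the same commutation signs `(-1)^κ`. -/
structure Setting (m : ℕ) (Λ : Type) [Fintype Λ] [DecidableEq Λ] where
  /-- position of a site in the plane; the coordinate `0` is the horizontal one -/
  pos : Λ → EuclideanSpace ℝ (Fin 2)
  pos_injective : Function.Injective pos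
  /-- left boundary -/
  L : Set Λ
  /-- bulk -/
  B : Set Λ
  /-- right boundary -/
  R : Set Λ
  cover : L ∪ B ∪ R = Set.univ
  left_lt_bulk : ∀ i ∈ L, ∀ j ∈ B, pos i 0 < pos j 0
  bulk_lt_right : ∀ i ∈ B, ∀ j ∈ R, pos i 0 < pos j 0
  left_lt_right : ∀ i ∈ L, ∀ j ∈ R, pos i 0 < pos j 0
  /-- the Pauli operator by which a group element acts on a site -/
  u : Λ → G m → Pauli
  linear_bulk : ∀ i ∈ B, ∀ g g', (u i g).mat * (u i g').mat = (u i (g + g')).mat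
  projective_boundary : ∀ i ∈ L ∪ R, ∀ g g', ∃ c : ℂ,
    (u i g).mat * (u i g').mat = c • (u i (g + g')).mat
  /-- the exponent of the commutation signs of the boundary representations -/
  κ : G m → G m → ZMod 2
  comm_left : ∀ g g',
    tensorOn L (fun i => (u i g).mat) * tensorOn L (fun i => (u i g').mat) =
      sgn (κ g g') • (tensorOn L (fun i => (u i g').mat) * tensorOn L (fun i => (u i g).mat))
  comm_right : ∀ g g',
    tensorOn R (fun i => (u i g).mat) * tensorOn R (fun i => (u i g').mat) =
      sgn (κ g g') • (tensorOn R (fun i => (u i g').mat) * tensorOn R (fun i => (u i g).mat))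

namespace Setting

variable {m : ℕ} {Λ : Type} [Fintype Λ] [DecidableEq Λ] (S : Setting m Λ)

/-- The symmetry `U(g) = V_L(g) ⊗ U_B(g) ⊗ V_R(g)`. -/
noncomputable def U (g : G m) : Op Λ := tensor fun i => (S.u i g).mat

/-- The restriction `V_R(g)` to the right boundary. -/
noncomputable def VR (g : G m) : Op Λ := tensorOn S.R fun i => (S.u i g).mat

/-- The `k`-neighborhood of a region. -/
def nbhd (k : ℝ) (Ω : Set Λ) : Set Λ := {z | ∃ w ∈ Ω, dist (S.pos z) (S.pos w) ≤ k}

/-- `W` has spread at most `Δ`: conjugation `P ↦ W† P W` enlarges supports at most to their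
`Δ`-neighborhoods. -/
def HasSpread (W : Op Λ) (Δ : ℕ) : Prop :=
  ∀ (Ω : Set Λ) (P : Op Λ), SupportedOn P Ω → SupportedOn (Wᴴ * P * W) (S.nbhd Δ Ω)

/-- The stabilizer group of `Φ₀` decouples any two regions `P`, `Q` at distance at least
`2 * Δ + d`: it has a generating set such that no generator that crosses the boundary of the
`Δ`-neighborhood of `P` overlaps with the `Δ`-neighborhood of `Q`. (The elements of the stabilizer
group are involutions, so generating it as a monoid and as a group is the same.) -/
def Decouples (Φ₀ : Vec Λ) (Δ : ℕ) (d : ℝ) : Prop :=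
  ∀ P Q : Set Λ, (∀ a ∈ P, ∀ b ∈ Q, 2 * Δ + d ≤ dist (S.pos a) (S.pos b)) →
    ∃ gens : Set (Op Λ), (Submonoid.closure gens : Set (Op Λ)) = stab Φ₀ ∧
      ∀ s ∈ gens, ¬ SupportedOn s (S.nbhd Δ P) → ¬ SupportedOn s (S.nbhd Δ P)ᶜ →
        SupportedOn s (S.nbhd Δ Q)ᶜ

/-! ### Computational order parameters -/

/-- The Pauli operator `b` at site `k` localizes `U(g)` to `k`. -/
def Localizes (k : Λ) (g : G m) (b : Pauli) : Prop :=
  ∀ g' : G m, (S.u k g').mat * b.mat = sgn (S.κ g g') • (b.mat * (S.u k g').mat)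

/-- The group elements that are localizable to site `k`. -/
def GG (k : Λ) : Set (G m) := {g | ∃ b : Pauli, S.Localizes k g b}

/-- The group elements that are localizable to some site of the bulk. -/
def 𝒢 : Set (G m) := {g | ∃ k ∈ S.B, g ∈ S.GG k}

open Classical in
/-- The operator `R_k(g)`: the Pauli operator `b` at site `k`, times the restriction of `U(g)` to
the sites strictly to the right of `k`. -/
noncomputable def Rop (k : Λ) (g : G m) (b : Pauli) : Op Λ :=
  tensor fun i => if i = k then b.mat else
    if S.pos k 0 < S.pos i 0 then (S.u i g).mat else 1

/-- The computational order parameter `σ_k(g)`, the expectation value of `R_k(g)`. -/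
noncomputable def σ (Φ : Vec Λ) (k : Λ) (g : G m) (b : Pauli) : ℂ := ev Φ (S.Rop k g b)

/-! ### Logical observables and logical gates -/

/-- `H` is a maximal subgroup of `ℤ₂^m` for which the logical observables `T(H)` commute. Their
commutation signs are those of the right boundary. -/
def IsMaximalAbelian (H : Submodule (ZMod 2) (G m)) : Prop :=
  Maximal (fun K : Submodule (ZMod 2) (G m) =>
    ∀ h ∈ K, ∀ h' ∈ K, Commute (S.VR h) (S.VR h')) H

/-- `V_L(H)` and `V_R(H)` are products of commuting single-qubit observables. -/
def SitewiseCommuting (H : Submodule (ZMod 2) (G m)) : Prop :=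
  ∀ i ∈ S.L ∪ S.R, ∀ h ∈ H, ∀ h' ∈ H, Commute (S.u i h).mat (S.u i h').mat

open Classical in
/-- The logical observable `T(g)`: it is `V_L(g) ⊗ U_B(g) ⊗ V_R(g)` for `g ∈ H` and
`I_L ⊗ U_B(g) ⊗ V_R(g)` otherwise. -/
noncomputable def T (H : Submodule (ZMod 2) (G m)) (g : G m) : Op Λ :=
  if g ∈ H then S.U g else tensorOn (S.B ∪ S.R) fun i => (S.u i g).mat

/-- The Lie algebra `𝒜` generated by `T(𝒢)` under `i[·,·]` and real linear combinations. -/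
inductive LieAlg (H : Submodule (ZMod 2) (G m)) : Op Λ → Prop
  | gen (g : G m) (hg : g ∈ S.𝒢) : LieAlg H (S.T H g)
  | zero : LieAlg H 0
  | add (A A' : Op Λ) (hA : LieAlg H A) (hA' : LieAlg H A') : LieAlg H (A + A')
  | smul (c : ℝ) (A : Op Λ) (hA : LieAlg H A) : LieAlg H ((c : ℂ) • A)
  | bracket (A A' : Op Λ) (hA : LieAlg H A) (hA' : LieAlg H A') :
      LieAlg H (Complex.I • (A * A' - A' * A))

/-- The logical gates `𝓛 = exp(-i𝒜)`. -/
def gates (H : Submodule (ZMod 2) (G m)) : Set (Op Λ) :=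
  {V | ∃ A : Op Λ, S.LieAlg H A ∧ V = NormedSpace.exp (-(Complex.I • A))}

/-- A logical channel: a completely positive trace-preserving map whose Kraus operators belong to
the algebra generated by the logical observables. -/
def IsLogicalChannel (H : Submodule (ZMod 2) (G m)) (𝓔 : Op Λ → Op Λ) : Prop :=
  ∃ (n : ℕ) (K : Fin n → Op Λ), (∀ j, K j ∈ Algebra.adjoin ℂ (Set.range (S.T H))) ∧
    ∑ j, (K j)ᴴ * K j = 1 ∧ ∀ ρ, 𝓔 ρ = ∑ j, K j * ρ * (K j)ᴴ

/-- The `j`-th of the `rank H` logical qubits has the logical `Z`-observable `T(b j)`, where `b` is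
a basis of `H`. This is the projector onto the joint eigenspace of these commuting observables with
eigenvalues `(-1)^(z j)`. -/
noncomputable def logicalProj (H : Submodule (ZMod 2) (G m))
    (b : Module.Basis (Fin (Module.finrank (ZMod 2) H)) (ZMod 2) H)
    (z : Fin (Module.finrank (ZMod 2) H) → ZMod 2) : Op Λ :=
  (List.ofFn fun j => (1 / 2 : ℂ) • (1 + sgn (z j) • S.T H (b j : G m))).prod

end Setting

/-! ### Distance of channels -/

/-- The trace norm `‖X‖₁ = max |Tr (U X)|`, the maximum being over all unitaries `U`. -/
noncomputable def traceNorm {n : Type} [Fintype n] [DecidableEq n] (X : Matrix n n ℂ) : ℝ :=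
  ⨆ U : Matrix.unitaryGroup n ℂ, ‖((U : Matrix n n ℂ) * X).trace‖

/-- The map `𝓔 ⊗ id` with an ancilla system of dimension `k`. -/
def ampliate {Λ : Type} (k : ℕ) (𝓔 : Op Λ → Op Λ)
    (X : Matrix ((Λ → Fin 2) × Fin k) ((Λ → Fin 2) × Fin k) ℂ) :
    Matrix ((Λ → Fin 2) × Fin k) ((Λ → Fin 2) × Fin k) ℂ :=
  Matrix.of fun p q => 𝓔 (Matrix.of fun x y => X (x, p.2) (y, q.2)) p.1 q.1

open scoped ComplexOrder in
/-- Two channels are at diamond-norm distance at most `ε`. -/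
def DiamondDistLE {Λ : Type} [Fintype Λ] [DecidableEq Λ] (𝓔 𝓕 : Op Λ → Op Λ) (ε : ℝ) : Prop :=
  ∀ (k : ℕ) (ρ : Matrix ((Λ → Fin 2) × Fin k) ((Λ → Fin 2) × Fin k) ℂ),
    ρ.PosSemidef → ρ.trace = 1 → traceNorm (ampliate k 𝓔 ρ - ampliate k 𝓕 ρ) ≤ ε

/-! ### Measurement-based quantum computation -/

/-- An adaptive protocol of single-qubit measurements: the sites are measured one after the other,
each in the eigenbasis of a single-qubit observable with eigenvalues `1` and `-1`, which may depend
on the outcomes (`0` for `1`, `1` for `-1`) of the earlier measurements. -/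
structure Protocol (Λ : Type) where
  /-- the time at which a site is measured -/
  order : Λ → ℕ
  order_injective : Function.Injective order
  /-- the observable measured at a site, given the record of outcomes -/
  obs : Λ → (Λ → ZMod 2) → Matrix (Fin 2) (Fin 2) ℂ
  isHermitian : ∀ i s, (obs i s).IsHermitian
  sq_eq_one : ∀ i s, obs i s * obs i s = 1
  trace_eq_zero : ∀ i s, (obs i s).trace = 0
  adaptive : ∀ i s s', (∀ j, order j < order i → s j = s' j) → obs i s = obs i s'

/-- The projector onto the eigenspace of the observable at site `i` for its outcome in the
record `s`. -/
noncomputable def Protocol.proj {Λ : Type} (P : Protocol Λ) (i : Λ) (s : Λ → ZMod 2) :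
    Matrix (Fin 2) (Fin 2) ℂ :=
  (1 / 2 : ℂ) • (1 + sgn (s i) • P.obs i s)

open Classical in
/-- The operator that measures the record `s` on the sites outside `A` and the single-qubit
observables `q` on the sites in `A`. -/
noncomputable def Protocol.recordOp {Λ : Type} [Fintype Λ] (P : Protocol Λ) (A : Set Λ)
    (s : Λ → ZMod 2) (q : Λ → Matrix (Fin 2) (Fin 2) ℂ) : Op Λ :=
  tensor fun i => if i ∈ A then q i else P.proj i s

open Classical in
/-- MBQC on the resource state `Φ` implements the logical channel `𝓔` on the initial logical state
and reads out the logical qubits. All sites outside the right boundary `R` are measured first, then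
those of `R`. A byproduct sign `lam g`, computed from the outcomes outside `R`, is such that the
statistics of `V_R(g)` after the measurements outside `R`, corrected by this sign, are those of
`T(g)` in the state `𝓔 |Φ⟩⟨Φ|`, for each group element `g`. After the measurement of `R`, logical
bits computed from the outcomes are distributed as in a joint measurement of the `rank H` logical
`Z`-observables in the state `𝓔 |Φ⟩⟨Φ|`. -/
def Implements {m : ℕ} {Λ : Type} [Fintype Λ] [DecidableEq Λ] (S : Setting m Λ)
    (H : Submodule (ZMod 2) (G m)) (Φ : Vec Λ) (𝓔 : Op Λ → Op Λ) : Prop :=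
  ∃ (P : Protocol Λ) (lam : G m → (Λ → ZMod 2) → ZMod 2),
    (∀ i j, i ∉ S.R → j ∈ S.R → P.order i < P.order j) ∧
    (∀ g s s', (∀ i, i ∉ S.R → s i = s' i) → lam g s = lam g s') ∧
    (∀ g, ∑ s : Λ → ZMod 2 with (∀ i ∈ S.R, s i = 0),
        sgn (lam g s) * ev Φ (P.recordOp S.R s fun i => (S.u i g).mat) =
      (S.T H g * 𝓔 (ketbra Φ)).trace) ∧
    (∀ b : Module.Basis (Fin (Module.finrank (ZMod 2) H)) (ZMod 2) H,
      ∃ bits : (Λ → ZMod 2) → Fin (Module.finrank (ZMod 2) H) → ZMod 2,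
        ∀ z, ∑ s : Λ → ZMod 2 with bits s = z, ev Φ (P.recordOp ∅ s fun _ => 1) =
          (S.logicalProj H b z * 𝓔 (ketbra Φ)).trace)

/-- Initialization and readout of `rank H` logical qubits: the resource state is a joint
eigenvector of `T(H)` with eigenvalues `(-1)^χ`, and the other logical observables have expectation
value zero; if `H` acts faithfully, the `rank H` logical `Z`-observables are independent, all their
`2 ^ rank H` joint eigenspaces having the same nonzero dimension; and this logical state can be
read out by single-qubit measurements. -/
def InitAndReadout {m : ℕ} {Λ : Type} [Fintype Λ] [DecidableEq Λ] (S : Setting m Λ)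
    (H : Submodule (ZMod 2) (G m)) (Φ : Vec Λ) (χ : G m → ZMod 2) : Prop :=
  (∀ h ∈ H, S.T H h *ᵥ Φ = sgn (χ h) • Φ) ∧
  (∀ g, g ∉ H → ev Φ (S.T H g) = 0) ∧
  ((∀ h ∈ H, S.U h = 1 → h = 0) →
    ∀ (b : Module.Basis (Fin (Module.finrank (ZMod 2) H)) (ZMod 2) H) z,
      (2 : ℂ) ^ Module.finrank (ZMod 2) H * (S.logicalProj H b z).trace =
        (2 : ℂ) ^ Fintype.card Λ) ∧
  Implements S H Φ fun ρ => ρ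

/-! ### The resource states -/

/-- The conditions on the resource state `Φ`, apart from that on its order parameters. -/
structure IsResource {m : ℕ} {Λ : Type} [Fintype Λ] [DecidableEq Λ] (S : Setting m Λ)
    (H : Submodule (ZMod 2) (G m)) (Φ : Vec Λ) (χ : G m → ZMod 2) (Δ : ℕ) (d : ℝ) : Prop where
  /-- The distance `d` that is added to `2 * Δ` is positive. -/
  d_pos : 0 < d
  /-- `Φ` is the image of a stabilizer state, which decouples distant regions, under a unitary of
  spread `Δ` that commutes with the symmetry. -/
  exists_stabilizer : ∃ (Φ₀ : Vec Λ) (W : Op Λ), IsStabilizerState Φ₀ ∧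
    W ∈ Matrix.unitaryGroup (Λ → Fin 2) ℂ ∧ (∀ g, Commute W (S.U g)) ∧ S.HasSpread W Δ ∧
    Φ = W *ᵥ Φ₀ ∧ S.Decouples Φ₀ Δ d
  /-- `Φ` is symmetric. -/
  symmetric : ∀ g, S.U g *ᵥ Φ = sgn (χ g) • Φ
  /-- `H` is a maximal subgroup with commuting logical observables. -/
  maximal : S.IsMaximalAbelian H
  /-- The boundary representations of `H` are products of commuting single-qubit observables. -/
  sitewise : S.SitewiseCommuting H

/-- All computational order parameters `σ_k(g)`, `k` in the bulk and `g` localizable to `k`, are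
nonzero; here `β k g` is the Pauli operator that localizes `g` to `k`. -/
def OrderParametersNonzero {m : ℕ} {Λ : Type} [Fintype Λ] [DecidableEq Λ] (S : Setting m Λ)
    (Φ : Vec Λ) (β : Λ → G m → Pauli) : Prop :=
  ∀ k ∈ S.B, ∀ g ∈ S.GG k, S.Localizes k g (β k g) ∧ S.σ Φ k g (β k g) ≠ 0

/-- The bulk contains `N` groups of sites, ordered from left to right, such that each element of
`𝒢` is localizable to a site of each group and sites of different groups have horizontal distance
at least `2 * Δ + d`. -/
def HasRounds {m : ℕ} {Λ : Type} [Fintype Λ] [DecidableEq Λ] (S : Setting m Λ)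
    (Δ : ℕ) (d : ℝ) (N : ℕ) : Prop :=
  ∃ site : Fin N → G m → Λ,
    (∀ t, ∀ g ∈ S.𝒢, site t g ∈ S.B ∧ g ∈ S.GG (site t g)) ∧
    ∀ t t', t < t' → ∀ g ∈ S.𝒢, ∀ g' ∈ S.𝒢,
      S.pos (site t g) 0 + (2 * Δ + d) ≤ S.pos (site t' g') 0

end MBQC

/-!
Measure the sites of the left boundary and of the bulk in the eigenbases of the Pauli operators by
which the symmetry acts there: at a bulk site all group elements, and at a boundary site all
elements of `H`, act by powers of a single Pauli operator. The outcomes reveal `T(g)` up to the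
factor `V_R(g)`, and the remaining measurements reveal `T(h)` for `h ∈ H`. This initializes and
reads out the logical qubits (`initAndReadout`).

Tilting the measurement axis at a bulk site `k` to which `g` is localizable amounts to a conjugation
by the rotation about `R_k(g) T(g)`, because this product differs from the Pauli operator at `k`
only by operators whose outcomes are known (`pauliRecord_mul_R_mul_T`, `tensor_tiltedObs`). As
`R_k(g)` squares to one and commutes with all logical observables, it plays the role of a random
sign in a rotation about `T(g)`. The signs at distant sites are independent: on the symmetric state
the logical observables and the string operators that start further to the left act like operators
supported far to the left of `k` (`localActing`), since they agree with symmetry operators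
elsewhere, whereas `R_k(g)` has no support to the left of `k`. Correlations of distant operators in
the resource state become correlations in the stabilizer state, because the spread of `W` is
bounded, and these vanish if each generator of the stabilizer group commutes with one of the two
operators (`ev_mul_of_stabilizer`, `ev_mul_of_dist`). Therefore each tilted measurement effects a
rotation about `T(g)` by `±α`, with the order parameter `σ` as the expectation value of the sign
(`RotStep.ev_unitaries`, `implements_of_channels`).

For a small angle `α` such a random rotation agrees up to `O(α²)` with the rotation by `σ α`
(`diamondBound_randomRot`). A rotation by a given angle is thus approximated by `p` tilted
measurements up to `O(1 / p)`, with a constant that depends only on a lower bound for `|σ|`.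
Rotations about central `T(g)`, which the measurements do not effect, are invisible in the logical
observables (`RotStep.trace_mul_biasedChannels`).

It remains to write a logical gate as a product of boundedly many rotations, with a bound that does
not depend on the system. Up to signs, the logical observables obey the relations that are encoded
by `κ`, so that the ordered products of the `T(g)` span an algebra on which left multiplication is
given by universal matrices of a fixed size (`modelGen`, `Represents`). In this model the rotations
generate a bounded group, whose closure contains the exponentials of the Lie algebra by the Lie
product formula (`exp_mem_topologicalClosure`), and by compactness words of bounded length come
close to every element of the closure (`exists_word_length`). As there are finitely many `κ` and
`𝒢`, the bound depends only on `m` and on the accuracy (`exists_gate_word`). The evaluation of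
model vectors on the system turns a small error in the model into a combination of unitaries with
small coefficients, which is harmless in diamond norm (`diamondBound_conj`).
-/

namespace MBQC

open Matrix

/-! ### Tensor products of single-qubit operators -/

section Tensor

variable {Λ : Type} [Fintype Λ]

theorem tensor_apply (a : Λ → Matrix (Fin 2) (Fin 2) ℂ) (x y : Λ → Fin 2) :
    tensor a x y = ∏ i, a i (x i) (y i) := rfl

theorem tensor_conjTranspose (a : Λ → Matrix (Fin 2) (Fin 2) ℂ) :
    (tensor a)ᴴ = tensor fun i => (a i)ᴴ := by
  ext x y
  simp [tensor_apply, conjTranspose_apply, star_prod]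

theorem tensor_smul (c : Λ → ℂ) (a : Λ → Matrix (Fin 2) (Fin 2) ℂ) :
    tensor (fun i => c i • a i) = (∏ i, c i) • tensor a := by
  ext x y
  simp [tensor_apply, Finset.prod_mul_distrib]

theorem tensor_one [DecidableEq Λ] :
    tensor (fun _ : Λ => (1 : Matrix (Fin 2) (Fin 2) ℂ)) = 1 := by
  ext x y
  simp only [tensor_apply, one_apply]
  rw [Finset.prod_ite_zero]
  simp [funext_iff]

variable [DecidableEq Λ]

theorem tensor_mul (a b : Λ → Matrix (Fin 2) (Fin 2) ℂ) :
    tensor a * tensor b = tensor fun i => a i * b i := by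
  ext x y
  simp only [mul_apply, tensor_apply, ← Finset.prod_mul_distrib]
  rw [Finset.prod_univ_sum, Fintype.piFinset_univ]

theorem sum_tensor {ι : Type} [Fintype ι] (M : Λ → ι → Matrix (Fin 2) (Fin 2) ℂ) :
    ∑ s : Λ → ι, tensor (fun i => M i (s i)) = tensor fun i => ∑ a, M i a := by
  classical
  ext x y
  simp only [Matrix.sum_apply, tensor_apply]
  rw [Finset.prod_univ_sum, Fintype.piFinset_univ]

theorem tensor_trace (a : Λ → Matrix (Fin 2) (Fin 2) ℂ) :
    (tensor a).trace = ∏ i, (a i).trace := by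
  simp only [trace, diag_apply, tensor_apply]
  rw [Finset.prod_univ_sum, Fintype.piFinset_univ]

/-- The operator that acts as `E` on the site `k` and trivially on all other sites. -/
noncomputable def single (k : Λ) (E : Matrix (Fin 2) (Fin 2) ℂ) : Op Λ :=
  tensor fun i => if i = k then E else 1

theorem single_apply (k : Λ) (E : Matrix (Fin 2) (Fin 2) ℂ) (x y : Λ → Fin 2) :
    single k E x y = E (x k) (y k) * ∏ i ∈ Finset.univ.erase k,
      (1 : Matrix (Fin 2) (Fin 2) ℂ) (x i) (y i) := by
  rw [single, tensor_apply, ← Finset.mul_prod_erase _ _ (Finset.mem_univ k)]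
  congr 1
  · simp
  · exact Finset.prod_congr rfl fun i hi => by simp [Finset.ne_of_mem_erase hi]

theorem single_add (k : Λ) (E F : Matrix (Fin 2) (Fin 2) ℂ) :
    single k (E + F) = single k E + single k F := by
  ext x y
  simp [single_apply, add_mul]

theorem single_smul (k : Λ) (c : ℂ) (E : Matrix (Fin 2) (Fin 2) ℂ) :
    single k (c • E) = c • single k E := by
  ext x y
  simp [single_apply, mul_assoc]

theorem single_one (k : Λ) : single k 1 = (1 : Op Λ) := by
  simp [single, tensor_one]

theorem single_conjTranspose (k : Λ) (E : Matrix (Fin 2) (Fin 2) ℂ) :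
    (single k E)ᴴ = single k Eᴴ := by
  rw [single, tensor_conjTranspose, single]
  congr 1; ext1 i
  split_ifs <;> simp

end Tensor

/-! ### Signs -/

theorem sgn_zero : sgn 0 = 1 := by simp [sgn]

theorem sgn_one : sgn 1 = -1 := by simp [sgn]

theorem zmod_two_cases (a : ZMod 2) : a = 0 ∨ a = 1 := by
  revert a; decide

theorem sgn_add (a b : ZMod 2) : sgn (a + b) = sgn a * sgn b := by
  rcases zmod_two_cases a with rfl | rfl <;> rcases zmod_two_cases b with rfl | rfl <;>
    simp [sgn_zero, sgn_one, CharTwo.add_self_eq_zero]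

theorem sgn_mul_self (a : ZMod 2) : sgn a * sgn a = 1 := by
  rcases zmod_two_cases a with rfl | rfl <;> simp [sgn_zero, sgn_one]

theorem star_sgn (a : ZMod 2) : star (sgn a) = sgn a := by
  rcases zmod_two_cases a with rfl | rfl <;> simp [sgn_zero, sgn_one]

theorem sgn_injective : Function.Injective sgn := fun a b h => by
  rcases zmod_two_cases a with rfl | rfl <;> rcases zmod_two_cases b with rfl | rfl <;>
    simp_all [sgn_zero, sgn_one]
  · norm_num [eq_neg_iff_add_eq_zero] at h
  · norm_num [neg_eq_iff_add_eq_zero] at h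

theorem sgn_sum {ι : Type} (s : Finset ι) (f : ι → ZMod 2) :
    sgn (∑ i ∈ s, f i) = ∏ i ∈ s, sgn (f i) := by
  classical
  induction s using Finset.induction_on with
  | empty => simp [sgn_zero]
  | insert a s ha ih => rw [Finset.sum_insert ha, Finset.prod_insert ha, sgn_add, ih]

/-! ### Single-qubit Pauli operators -/

namespace Pauli

theorem mat_I : Pauli.I.mat = 1 := rfl

theorem mat_mul_self (p : Pauli) : p.mat * p.mat = 1 := by
  cases p <;> simp [Pauli.mat, ← Matrix.one_fin_two]

theorem mat_conjTranspose (p : Pauli) : p.matᴴ = p.mat := by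
  cases p <;> ext i j <;> fin_cases i <;> fin_cases j <;> simp [Pauli.mat]

theorem mat_isHermitian (p : Pauli) : p.mat.IsHermitian := p.mat_conjTranspose

theorem trace_mat {p : Pauli} (hp : p ≠ .I) : p.mat.trace = 0 := by
  cases p <;> simp_all [Pauli.mat, Matrix.trace_fin_two]

theorem commute_or_anticommute (p q : Pauli) :
    p.mat * q.mat = q.mat * p.mat ∨ p.mat * q.mat = -(q.mat * p.mat) := by
  cases p <;> cases q <;> simp [Pauli.mat]

theorem trace_mul_eq_zero {p q : Pauli} (h : p ≠ q) : (p.mat * q.mat).trace = 0 := by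
  cases p <;> cases q <;> simp_all [Pauli.mat, Matrix.trace_fin_two]

theorem anticommute {p q : Pauli} (hp : p ≠ .I) (hq : q ≠ .I) (h : p ≠ q) :
    p.mat * q.mat = -(q.mat * p.mat) := by
  cases p <;> cases q <;> simp_all [Pauli.mat]

theorem mat_mul_ne_zero (p q : Pauli) : p.mat * q.mat ≠ 0 := fun h => by
  have h1 : p.mat * (p.mat * q.mat) * q.mat = 1 := by
    rw [← mul_assoc, mat_mul_self, one_mul, mat_mul_self]
  rw [h] at h1
  simp at h1

/-- The labels of proportional Pauli matrices are equal. -/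
theorem eq_of_mat_eq_smul {p q : Pauli} {c : ℂ} (h : p.mat = c • q.mat) : p = q := by
  by_contra hpq
  have h1 : (p.mat * p.mat).trace = 0 := by
    have h2 : p.mat * p.mat = c • (p.mat * q.mat) := by rw [← Matrix.mul_smul, ← h]
    rw [h2, trace_smul, trace_mul_eq_zero hpq, smul_zero]
  rw [mat_mul_self] at h1
  simp at h1

theorem eq_of_commute {p q : Pauli} (hp : p ≠ .I) (hq : q ≠ .I) (h : Commute p.mat q.mat) :
    p = q := by
  by_contra hpq
  have h1 := anticommute hp hq hpq
  rw [h.eq, eq_neg_iff_add_eq_zero, ← two_smul ℂ, smul_eq_zero] at h1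
  exact h1.elim (by norm_num) (mat_mul_ne_zero q p)

end Pauli

/-! ### Supports of operators -/

section Support

open scoped Kronecker

variable {Λ : Type}

theorem SupportedOn.add {A B : Op Λ} {Ω : Set Λ} (hA : SupportedOn A Ω) (hB : SupportedOn B Ω) :
    SupportedOn (A + B) Ω := by
  obtain ⟨M, hM, hM'⟩ := hA
  obtain ⟨N, hN, hN'⟩ := hB
  exact ⟨fun x y => M x y + N x y, fun x y h => by rw [Matrix.add_apply, hM x y h, hN x y h],
    fun x y h => by rw [Matrix.add_apply, hM' x y h, hN' x y h, add_zero]⟩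

theorem SupportedOn.smul {A : Op Λ} {Ω : Set Λ} (c : ℂ) (hA : SupportedOn A Ω) :
    SupportedOn (c • A) Ω := by
  obtain ⟨M, hM, hM'⟩ := hA
  exact ⟨fun x y => c * M x y, fun x y h => by rw [Matrix.smul_apply, hM x y h, smul_eq_mul],
    fun x y h => by rw [Matrix.smul_apply, hM' x y h, smul_zero]⟩

theorem SupportedOn.mono {A : Op Λ} {Ω Ω' : Set Λ} (hA : SupportedOn A Ω) (h : Ω ⊆ Ω') :
    SupportedOn A Ω' := by
  classical
  obtain ⟨M, hM, hM'⟩ := hA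
  refine ⟨fun u v => if ∀ i : Ω', (i : Λ) ∉ Ω → u i = v i then
    M (fun i => u ⟨i, h i.2⟩) (fun i => v ⟨i, h i.2⟩) else 0, fun x y hxy => ?_, fun x y hxy => ?_⟩
  · dsimp only
    split_ifs with hc
    · exact hM x y fun i hi => if hi' : i ∈ Ω' then hc ⟨i, hi'⟩ hi else hxy i hi'
    · push Not at hc
      obtain ⟨i, hi, hi'⟩ := hc
      exact hM' x y ⟨i, hi, hi'⟩
  · obtain ⟨i, hi, hi'⟩ := hxy
    exact hM' x y ⟨i, fun hi2 => hi (h hi2), hi'⟩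

theorem supportedOn_tensor [Fintype Λ] {a : Λ → Matrix (Fin 2) (Fin 2) ℂ} {Ω : Set Λ}
    (h : ∀ i, i ∉ Ω → a i = 1) : SupportedOn (tensor a) Ω := by
  classical
  refine ⟨fun u v => ∏ i : Ω, a i (u i) (v i), fun x y hxy => ?_, fun x y hxy => ?_⟩
  · rw [tensor_apply, ← Finset.prod_subset (Finset.subset_univ (Finset.univ.filter (· ∈ Ω)))]
    · exact Finset.prod_subtype _ (by simp) _
    · intro i _ hi
      have hi' : i ∉ Ω := by simpa using hi
      rw [h i hi', hxy i hi', one_apply_eq]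
  · obtain ⟨i, hi, hi'⟩ := hxy
    exact Finset.prod_eq_zero (Finset.mem_univ i) (by rw [h i hi, one_apply_ne hi'])

open Classical in
/-- Splitting of the computational basis into the qubits in `Ω` and the other ones. -/
noncomputable def splitEquiv (Ω : Set Λ) :
    (Λ → Fin 2) ≃ ({i // i ∈ Ω} → Fin 2) × ({i // i ∉ Ω} → Fin 2) :=
  Equiv.piEquivPiSubtypeProd (· ∈ Ω) fun _ => Fin 2

theorem kronecker_submatrix_apply {Ω : Set Λ}
    (M : Matrix ({i // i ∈ Ω} → Fin 2) ({i // i ∈ Ω} → Fin 2) ℂ)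
    (N : Matrix ({i // i ∉ Ω} → Fin 2) ({i // i ∉ Ω} → Fin 2) ℂ) (x y : Λ → Fin 2) :
    (M ⊗ₖ N).submatrix (splitEquiv Ω) (splitEquiv Ω) x y =
      M (fun i => x i) (fun i => y i) * N (fun i => x i) (fun i => y i) := rfl

open Classical in
theorem supportedOn_iff_kronecker [Fintype Λ] {A : Op Λ} {Ω : Set Λ} :
    SupportedOn A Ω ↔ ∃ M : Matrix ({i // i ∈ Ω} → Fin 2) ({i // i ∈ Ω} → Fin 2) ℂ,
      A = (M ⊗ₖ (1 : Matrix ({i // i ∉ Ω} → Fin 2) ({i // i ∉ Ω} → Fin 2) ℂ)).submatrix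
        (splitEquiv Ω) (splitEquiv Ω) := by
  have heq : ∀ x y : Λ → Fin 2, (∀ i, i ∉ Ω → x i = y i) →
      (fun i : {i // i ∉ Ω} => x i) = fun i : {i // i ∉ Ω} => y i :=
    fun x y h => funext fun i => h i i.2
  have hne : ∀ x y : Λ → Fin 2, (∃ i, i ∉ Ω ∧ x i ≠ y i) →
      (fun i : {i // i ∉ Ω} => x i) ≠ fun i : {i // i ∉ Ω} => y i :=
    fun x y ⟨i, hi, hi'⟩ h' => hi' (congrFun h' ⟨i, hi⟩)
  constructor
  · rintro ⟨M, h⟩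
    refine ⟨Matrix.of M, ?_⟩
    ext x y
    rw [kronecker_submatrix_apply, of_apply]
    by_cases hxy : ∀ i, i ∉ Ω → x i = y i
    · rw [h.1 x y hxy, heq x y hxy, one_apply_eq, mul_one]
    · push Not at hxy
      rw [h.2 x y hxy, one_apply_ne (hne x y hxy), mul_zero]
  · rintro ⟨M, rfl⟩
    refine ⟨fun x y => M x y, fun x y hxy => ?_, fun x y hxy => ?_⟩
    · rw [kronecker_submatrix_apply, heq x y hxy, one_apply_eq, mul_one]
    · rw [kronecker_submatrix_apply, one_apply_ne (hne x y hxy), mul_zero]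

variable [Fintype Λ] [DecidableEq Λ]

theorem SupportedOn.mul {A B : Op Λ} {Ω : Set Λ} (hA : SupportedOn A Ω) (hB : SupportedOn B Ω) :
    SupportedOn (A * B) Ω := by
  classical
  obtain ⟨M, rfl⟩ := supportedOn_iff_kronecker.1 hA
  obtain ⟨N, rfl⟩ := supportedOn_iff_kronecker.1 hB
  refine supportedOn_iff_kronecker.2 ⟨M * N, ?_⟩
  rw [submatrix_mul_equiv, ← mul_kronecker_mul, one_mul]

/-- Operators with complementary supports commute. -/
theorem SupportedOn.commute_compl {A B : Op Λ} {Ω : Set Λ} (hA : SupportedOn A Ω)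
    (hB : SupportedOn B Ωᶜ) : Commute A B := by
  classical
  obtain ⟨M, rfl⟩ := supportedOn_iff_kronecker.1 hA
  obtain ⟨N, hN, hN'⟩ := hB
  have hB' : B = ((1 : Matrix ({i // i ∈ Ω} → Fin 2) ({i // i ∈ Ω} → Fin 2) ℂ) ⊗ₖ
      (Matrix.of N : Matrix ({i // i ∉ Ω} → Fin 2) ({i // i ∉ Ω} → Fin 2) ℂ)).submatrix
        (splitEquiv Ω) (splitEquiv Ω) := by
    ext x y
    rw [kronecker_submatrix_apply, of_apply]
    by_cases hxy : ∀ i, i ∉ Ωᶜ → x i = y i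
    · have : (fun i : {i // i ∈ Ω} => x i) = fun i : {i // i ∈ Ω} => y i :=
        funext fun i => hxy i fun h => h i.2
      rw [hN x y hxy, this, one_apply_eq, one_mul]
      rfl
    · push Not at hxy
      obtain ⟨i, hi, hi'⟩ := hxy
      have : (fun i : {i // i ∈ Ω} => x i) ≠ fun i : {i // i ∈ Ω} => y i :=
        fun h' => hi' (congrFun h' ⟨i, not_not.1 hi⟩)
      rw [hN' x y ⟨i, hi, hi'⟩, one_apply_ne this, zero_mul]
  rw [hB', commute_iff_eq, submatrix_mul_equiv, submatrix_mul_equiv, ← mul_kronecker_mul,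
    ← mul_kronecker_mul, one_mul, mul_one, one_mul, mul_one]

theorem SupportedOn.commute {A B : Op Λ} {Ω Ω' : Set Λ} (hA : SupportedOn A Ω)
    (hB : SupportedOn B Ω') (h : Disjoint Ω Ω') : Commute A B :=
  hA.commute_compl (hB.mono (Set.subset_compl_iff_disjoint_left.2 h))

theorem SupportedOn.one (Ω : Set Λ) : SupportedOn (1 : Op Λ) Ω := by
  rw [← tensor_one]
  exact supportedOn_tensor fun _ _ => rfl

end Support

/-! ### Expectation values -/

section Expectation

variable {Λ : Type} [Fintype Λ] [DecidableEq Λ]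

theorem ev_add (Φ : Vec Λ) (A B : Op Λ) : ev Φ (A + B) = ev Φ A + ev Φ B := by
  simp [ev, add_mulVec]

theorem ev_smul (Φ : Vec Λ) (c : ℂ) (A : Op Λ) : ev Φ (c • A) = c * ev Φ A := by
  simp [ev, smul_mulVec]

theorem ev_sum {ι : Type} (s : Finset ι) (Φ : Vec Λ) (A : ι → Op Λ) :
    ev Φ (∑ i ∈ s, A i) = ∑ i ∈ s, ev Φ (A i) := by
  simp [ev, sum_mulVec, dotProduct_sum]

theorem ev_eq_trace (Φ : Vec Λ) (A : Op Λ) : ev Φ A = (A * ketbra Φ).trace := by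
  rw [ketbra, mul_vecMulVec, trace_vecMulVec, ev, dotProduct_comm]

theorem ev_conj (Φ : Vec Λ) (W A : Op Λ) : ev (W *ᵥ Φ) A = ev Φ (Wᴴ * A * W) := by
  rw [ev, ev, star_mulVec, ← dotProduct_mulVec, mulVec_mulVec, mulVec_mulVec, mul_assoc]

theorem ev_mul_of_mulVec {Φ : Vec Λ} {A B C : Op Λ} (h : B *ᵥ Φ = C *ᵥ Φ) :
    ev Φ (A * B) = ev Φ (A * C) := by
  rw [ev, ev, ← mulVec_mulVec, h, mulVec_mulVec]

/-- Conjugation with a Hermitian operator that fixes `Φ` does not change expectation values. -/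
theorem ev_conj_of_fixed {Φ : Vec Λ} {s : Op Λ} (hs : sᴴ = s) (hΦ : s *ᵥ Φ = Φ) (A : Op Λ) :
    ev Φ (s * A * s) = ev Φ A := by
  conv_rhs => rw [← hΦ, ev_conj, hs]

end Expectation

/-! ### Factorization of correlations in stabilizer states -/

section Stabilizer

variable {Λ : Type} [Fintype Λ] [DecidableEq Λ] {Φ₀ : Vec Λ}

theorem conjTranspose_of_mem_stab {s : Op Λ} (hs : s ∈ stab Φ₀) : sᴴ = s := by
  obtain ⟨⟨p, rfl | rfl⟩, -⟩ := hs <;>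
    simp [tensor_conjTranspose, Pauli.mat_conjTranspose]

theorem mul_self_of_mem_stab {s : Op Λ} (hs : s ∈ stab Φ₀) : s * s = 1 := by
  obtain ⟨⟨p, rfl | rfl⟩, -⟩ := hs <;>
    simp [tensor_mul, Pauli.mat_mul_self, tensor_one]

theorem tensor_pauli_commute_or_anticommute (p q : Λ → Pauli) :
    (tensor fun i => (p i).mat) * (tensor fun i => (q i).mat) =
        (tensor fun i => (q i).mat) * (tensor fun i => (p i).mat) ∨
    (tensor fun i => (p i).mat) * (tensor fun i => (q i).mat) =
        -((tensor fun i => (q i).mat) * (tensor fun i => (p i).mat)) := by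
  classical
  have h : ∀ i, ∃ a : ZMod 2, (p i).mat * (q i).mat = sgn a • ((q i).mat * (p i).mat) := fun i => by
    rcases Pauli.commute_or_anticommute (p i) (q i) with h | h
    · exact ⟨0, by rw [h, sgn_zero, one_smul]⟩
    · exact ⟨1, by rw [h, sgn_one, neg_one_smul]⟩
  choose a ha using h
  simp only [tensor_mul, ha, tensor_smul, ← sgn_sum]
  rcases zmod_two_cases (∑ i, a i) with h | h
  · left; rw [h, sgn_zero, one_smul]
  · right; rw [h, sgn_one, neg_one_smul]

theorem commute_of_mem_stab (h0 : Φ₀ ≠ 0) {s t : Op Λ} (hs : s ∈ stab Φ₀) (ht : t ∈ stab Φ₀) :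
    Commute s t := by
  have key : s * t = t * s ∨ s * t = -(t * s) := by
    obtain ⟨⟨p, rfl | rfl⟩, -⟩ := hs <;> obtain ⟨⟨q, rfl | rfl⟩, -⟩ := ht <;>
      rcases tensor_pauli_commute_or_anticommute p q with h | h <;> simp [h]
  refine key.resolve_right fun h => h0 ?_
  have h1 := congrArg (· *ᵥ Φ₀) h
  simp only [neg_mulVec, ← mulVec_mulVec, hs.2, ht.2] at h1
  exact self_eq_neg.1 h1

theorem finite_stab (Φ₀ : Vec Λ) : (stab Φ₀).Finite := by
  have hP : Finite Pauli := by
    refine Finite.of_injective (fun p : Pauli => (Pauli.rec 0 1 2 3 p : Fin 4)) fun p q h => ?_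
    cases p <;> cases q <;> simp_all
  refine ((Set.finite_range fun p : Λ → Pauli => tensor fun i => (p i).mat).union
    (Set.finite_range fun p : Λ → Pauli => -tensor fun i => (p i).mat)).subset ?_
  rintro s ⟨⟨p, rfl | rfl⟩, -⟩
  · exact Or.inl ⟨p, rfl⟩
  · exact Or.inr ⟨p, rfl⟩

/-- Averaging `A` over conjugations with those stabilizers that commute with `B` changes neither
its expectation value nor its correlation with `B`, but makes it commute with the stabilizers. -/
theorem exists_average (h0 : Φ₀ ≠ 0) {A B : Op Λ} (F : Finset (Op Λ))
    (hF : ∀ s ∈ F, s ∈ stab Φ₀ ∧ (Commute s A ∨ Commute s B)) :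
    ∃ X : Op Λ, (∀ s ∈ F, Commute s X) ∧ (∀ s ∈ stab Φ₀, Commute s A → Commute s X) ∧
      ev Φ₀ (B * X) = ev Φ₀ (B * A) ∧ ev Φ₀ X = ev Φ₀ A := by
  classical
  induction F using Finset.induction_on with
  | empty => exact ⟨A, by simp, fun _ _ h => h, rfl, rfl⟩
  | insert s F hs ih =>
    obtain ⟨X, hXF, hXA, hBX, hX⟩ := ih fun t ht => hF t (Finset.mem_insert_of_mem ht)
    obtain ⟨hsS, hs'⟩ := hF s (Finset.mem_insert_self s F)
    rcases hs' with hsA | hsB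
    · refine ⟨X, fun t ht => ?_, hXA, hBX, hX⟩
      rcases Finset.mem_insert.1 ht with rfl | ht
      · exact hXA _ hsS hsA
      · exact hXF t ht
    · have hss := mul_self_of_mem_stab hsS
      have hsh := conjTranspose_of_mem_stab hsS
      have hcomm : ∀ t ∈ stab Φ₀, Commute t X → Commute t ((1 / 2 : ℂ) • (X + s * X * s)) :=
        fun t ht htX => (htX.add_right (((commute_of_mem_stab h0 ht hsS).mul_right htX).mul_right
          (commute_of_mem_stab h0 ht hsS))).smul_right _
      refine ⟨(1 / 2 : ℂ) • (X + s * X * s), fun t ht => ?_,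
        fun t ht htA => hcomm t ht (hXA t ht htA), ?_, ?_⟩
      · rcases Finset.mem_insert.1 ht with rfl | ht
        · refine Commute.smul_right ?_ _
          rw [commute_iff_eq, mul_add, add_mul, mul_assoc _ t t, hss, mul_one, mul_assoc t X t,
            ← mul_assoc t t, hss, one_mul, add_comm]
        · exact hcomm t (hF t (Finset.mem_insert_of_mem ht)).1 (hXF t ht)
      · have h1 : B * (s * X * s) = s * (B * X) * s := by
          rw [← mul_assoc, ← mul_assoc, ← hsB.eq, mul_assoc s B X]
        rw [Matrix.mul_smul, mul_add, h1, ev_smul, ev_add, ev_conj_of_fixed hsh hsS.2, hBX]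
        ring
      · rw [ev_smul, ev_add, ev_conj_of_fixed hsh hsS.2, hX]
        ring

/-- If each generator of the stabilizer group commutes with `A` or with `B`, then the stabilizer
state has no correlations between `A` and `B`. -/
theorem ev_mul_of_stabilizer (hΦ₀ : IsStabilizerState Φ₀) {gens : Set (Op Λ)}
    (hgens : (Submonoid.closure gens : Set (Op Λ)) = stab Φ₀) {A B : Op Λ}
    (h : ∀ s ∈ gens, Commute s A ∨ Commute s B) :
    ev Φ₀ (B * A) = ev Φ₀ B * ev Φ₀ A := by
  have h0 : Φ₀ ≠ 0 := fun h0 => by simpa [h0] using hΦ₀.1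
  have hsub : gens ⊆ stab Φ₀ := hgens ▸ Submonoid.subset_closure
  have hfin : gens.Finite := (finite_stab Φ₀).subset hsub
  obtain ⟨X, hXF, -, hBX, hX⟩ := exists_average (A := A) (B := B) h0 hfin.toFinset fun s hs =>
    ⟨hsub (hfin.mem_toFinset.1 hs), h s (hfin.mem_toFinset.1 hs)⟩
  have hcomm : ∀ s ∈ stab Φ₀, Commute s X := by
    intro s hs
    rw [← hgens] at hs
    induction hs using Submonoid.closure_induction with
    | mem s hs => exact hXF s (hfin.mem_toFinset.2 hs)
    | one => exact Commute.one_left X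
    | mul s t _ _ ihs iht => exact ihs.mul_left iht
  obtain ⟨c, hc⟩ := hΦ₀.2 (X *ᵥ Φ₀) fun s hs => by
    rw [mulVec_mulVec, (hcomm s hs).eq, ← mulVec_mulVec, hs.2]
  have h1 : ev Φ₀ X = c := by
    rw [ev, hc, dotProduct_smul, hΦ₀.1, smul_eq_mul, mul_one]
  rw [← hBX, ← hX, h1, ev, ← mulVec_mulVec, hc, mulVec_smul, dotProduct_smul, smul_eq_mul, mul_comm]
  rfl

end Stabilizer

/-- A state that is obtained from a stabilizer state, which decouples distant regions, by a unitary
of bounded spread has no correlations between distant regions. -/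
theorem ev_mul_of_dist {m : ℕ} {Λ : Type} [Fintype Λ] [DecidableEq Λ] {S : Setting m Λ}
    {H : Submodule (ZMod 2) (G m)} {Φ : Vec Λ} {χ : G m → ZMod 2} {Δ : ℕ} {d : ℝ}
    (hR : IsResource S H Φ χ Δ d) {P Q : Set Λ}
    (hPQ : ∀ a ∈ P, ∀ b ∈ Q, 2 * Δ + d ≤ dist (S.pos a) (S.pos b)) {A B : Op Λ}
    (hA : SupportedOn A P) (hB : SupportedOn B Q) :
    ev Φ (B * A) = ev Φ B * ev Φ A := by
  obtain ⟨Φ₀, W, hΦ₀, hW, -, hspread, rfl, hdec⟩ := hR.exists_stabilizer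
  obtain ⟨gens, hgens, hg⟩ := hdec P Q hPQ
  have hA' := hspread P A hA
  have hB' := hspread Q B hB
  have hdisj : Disjoint (S.nbhd Δ P) (S.nbhd Δ Q) := by
    rw [Set.disjoint_left]
    rintro z ⟨a, ha, hza⟩ ⟨b, hb, hzb⟩
    have h1 := hPQ a ha b hb
    have h2 := dist_triangle_left (S.pos a) (S.pos b) (S.pos z)
    linarith [hR.d_pos]
  have hWW : W * Wᴴ = 1 := Matrix.mem_unitaryGroup_iff.1 hW
  rw [ev_conj, ev_conj, ev_conj]
  have h1 : Wᴴ * (B * A) * W = (Wᴴ * B * W) * (Wᴴ * A * W) := by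
    simp only [mul_assoc]
    rw [← mul_assoc W Wᴴ, hWW, one_mul]
  rw [h1]
  refine ev_mul_of_stabilizer hΦ₀ hgens fun s hs => ?_
  by_cases h2 : SupportedOn s (S.nbhd Δ P)
  · exact Or.inr (h2.commute hB' hdisj)
  by_cases h3 : SupportedOn s (S.nbhd Δ P)ᶜ
  · exact Or.inl (hA'.commute_compl h3).symm
  · exact Or.inr (hB'.commute_compl (hg s hs h2 h3)).symm

/-! ### Commutation signs of Pauli operators -/

open Classical in
/-- The exponent of the commutation sign of two single-qubit Pauli operators. -/
noncomputable def csgn (p q : Pauli) : ZMod 2 := if Commute p.mat q.mat then 0 else 1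

theorem mat_mul_mat (p q : Pauli) : p.mat * q.mat = sgn (csgn p q) • (q.mat * p.mat) := by
  rw [csgn]
  split_ifs with h
  · rw [sgn_zero, one_smul, h.eq]
  · rw [sgn_one, neg_one_smul]
    exact (Pauli.commute_or_anticommute p q).resolve_left h

theorem csgn_eq_zero_of_commute {p q : Pauli} (h : Commute p.mat q.mat) : csgn p q = 0 := if_pos h

theorem csgn_self (p : Pauli) : csgn p p = 0 := csgn_eq_zero_of_commute (Commute.refl _)

theorem csgn_I_left (p : Pauli) : csgn .I p = 0 := csgn_eq_zero_of_commute (Commute.one_left _)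

theorem csgn_I_right (p : Pauli) : csgn p .I = 0 := csgn_eq_zero_of_commute (Commute.one_right _)

theorem csgn_comm (p q : Pauli) : csgn p q = csgn q p := by
  unfold csgn
  split_ifs with h1 h2 h2
  · rfl
  · exact absurd h1.symm h2
  · exact absurd h2.symm h1
  · rfl

theorem csgn_eq_of_mul_eq {p q : Pauli} {a : ZMod 2}
    (h : p.mat * q.mat = sgn a • (q.mat * p.mat)) : csgn p q = a := by
  rw [mat_mul_mat] at h
  exact sgn_injective (smul_left_injective ℂ (Pauli.mat_mul_ne_zero q p) h)

section PauliTensor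

variable {Λ : Type} [Fintype Λ]

/-- The tensor product of Pauli operators with given labels. -/
noncomputable def pauliTensor (p : Λ → Pauli) : Op Λ := tensor fun i => (p i).mat

theorem pauliTensor_conjTranspose (p : Λ → Pauli) : (pauliTensor p)ᴴ = pauliTensor p := by
  simp [pauliTensor, tensor_conjTranspose, Pauli.mat_conjTranspose]

variable [DecidableEq Λ]

theorem pauliTensor_mul_self (p : Λ → Pauli) : pauliTensor p * pauliTensor p = 1 := by
  simp [pauliTensor, tensor_mul, Pauli.mat_mul_self, tensor_one]

theorem pauliTensor_mul_ne_zero (p q : Λ → Pauli) : pauliTensor p * pauliTensor q ≠ 0 := fun h => by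
  have h1 : pauliTensor p * (pauliTensor p * pauliTensor q) * pauliTensor q = 1 := by
    rw [← mul_assoc, pauliTensor_mul_self, one_mul, pauliTensor_mul_self]
  rw [h] at h1
  simp at h1

theorem pauliTensor_mul (p q : Λ → Pauli) :
    pauliTensor p * pauliTensor q =
      sgn (∑ i, csgn (p i) (q i)) • (pauliTensor q * pauliTensor p) := by
  simp only [pauliTensor, tensor_mul]
  simp only [mat_mul_mat (p _) (q _), tensor_smul, ← sgn_sum]

theorem sum_csgn_eq_of_mul_eq {p q : Λ → Pauli} {a : ZMod 2}
    (h : pauliTensor p * pauliTensor q = sgn a • (pauliTensor q * pauliTensor p)) :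
    ∑ i, csgn (p i) (q i) = a := by
  rw [pauliTensor_mul] at h
  exact sgn_injective (smul_left_injective ℂ (pauliTensor_mul_ne_zero q p) h)

theorem pauliTensor_commute {p q : Λ → Pauli} (h : ∑ i, csgn (p i) (q i) = 0) :
    Commute (pauliTensor p) (pauliTensor q) := by
  rw [commute_iff_eq, pauliTensor_mul, h, sgn_zero, one_smul]

end PauliTensor

/-! ### The symmetry and the logical observables -/

namespace Setting

variable {m : ℕ} {Λ : Type} [Fintype Λ] [DecidableEq Λ] (S : Setting m Λ)

theorem notMem_B_of_mem_L {i : Λ} (hi : i ∈ S.L) : i ∉ S.B := fun h =>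
  lt_irrefl _ (S.left_lt_bulk i hi i h)

theorem notMem_R_of_mem_L {i : Λ} (hi : i ∈ S.L) : i ∉ S.R := fun h =>
  lt_irrefl _ (S.left_lt_right i hi i h)

theorem notMem_R_of_mem_B {i : Λ} (hi : i ∈ S.B) : i ∉ S.R := fun h =>
  lt_irrefl _ (S.bulk_lt_right i hi i h)

theorem mem_cases (i : Λ) : i ∈ S.L ∨ i ∈ S.B ∨ i ∈ S.R := by
  have h : i ∈ S.L ∪ S.B ∪ S.R := S.cover ▸ Set.mem_univ i
  rcases h with (h | h) | h
  · exact Or.inl h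
  · exact Or.inr (Or.inl h)
  · exact Or.inr (Or.inr h)

open Classical in
theorem sum_split (F : Λ → ZMod 2) :
    ∑ i, F i = ∑ i, (if i ∈ S.L then F i else 0) + ∑ i, (if i ∈ S.B then F i else 0) +
      ∑ i, (if i ∈ S.R then F i else 0) := by
  rw [← Finset.sum_add_distrib, ← Finset.sum_add_distrib]
  refine Finset.sum_congr rfl fun i _ => ?_
  rcases S.mem_cases i with h | h | h
  · simp [h, S.notMem_B_of_mem_L h, S.notMem_R_of_mem_L h]
  · simp [h, S.notMem_R_of_mem_B h, show i ∉ S.L from fun h' => S.notMem_B_of_mem_L h' h]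
  · simp [h, show i ∉ S.L from fun h' => S.notMem_R_of_mem_L h' h,
      show i ∉ S.B from fun h' => S.notMem_R_of_mem_B h' h]

open Classical in
theorem tensorOn_eq_pauliTensor (A : Set Λ) (g : G m) :
    tensorOn A (fun i => (S.u i g).mat) = pauliTensor fun i => if i ∈ A then S.u i g else .I := by
  simp only [tensorOn, pauliTensor]
  congr 1; ext1 i
  split_ifs <;> rfl

open Classical in
theorem sum_csgn_right (g g' : G m) :
    ∑ i, (if i ∈ S.R then csgn (S.u i g) (S.u i g') else 0) = S.κ g g' := by
  have h := S.comm_right g g'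
  rw [tensorOn_eq_pauliTensor, tensorOn_eq_pauliTensor] at h
  rw [← sum_csgn_eq_of_mul_eq h]
  refine Finset.sum_congr rfl fun i _ => ?_
  split_ifs
  · rfl
  · rw [csgn_self]

open Classical in
theorem sum_csgn_left (g g' : G m) :
    ∑ i, (if i ∈ S.L then csgn (S.u i g) (S.u i g') else 0) = S.κ g g' := by
  have h := S.comm_left g g'
  rw [tensorOn_eq_pauliTensor, tensorOn_eq_pauliTensor] at h
  rw [← sum_csgn_eq_of_mul_eq h]
  refine Finset.sum_congr rfl fun i _ => ?_
  split_ifs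
  · rfl
  · rw [csgn_self]

theorem κ_self (g : G m) : S.κ g g = 0 := by
  classical
  rw [← S.sum_csgn_right]
  simp [csgn_self]

theorem κ_comm (g g' : G m) : S.κ g g' = S.κ g' g := by
  classical
  rw [← S.sum_csgn_right, ← S.sum_csgn_right]
  simp only [csgn_comm]

theorem commute_bulk {i : Λ} (hi : i ∈ S.B) (g g' : G m) :
    Commute (S.u i g).mat (S.u i g').mat := by
  rw [commute_iff_eq, S.linear_bulk i hi, S.linear_bulk i hi, add_comm]

theorem csgn_bulk {i : Λ} (hi : i ∈ S.B) (g g' : G m) : csgn (S.u i g) (S.u i g') = 0 :=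
  csgn_eq_zero_of_commute (S.commute_bulk hi g g')

theorem commute_VR_iff (g g' : G m) : Commute (S.VR g) (S.VR g') ↔ S.κ g g' = 0 := by
  classical
  constructor
  · intro h
    have h1 := S.comm_right g g'
    rw [VR, VR, commute_iff_eq] at h
    rw [tensorOn_eq_pauliTensor, tensorOn_eq_pauliTensor] at h h1
    rw [← sum_csgn_eq_of_mul_eq h1]
    exact sum_csgn_eq_of_mul_eq (by rw [h, sgn_zero, one_smul])
  · intro h
    rw [commute_iff_eq, VR, VR, S.comm_right, h, sgn_zero, one_smul]

/-- The label of `u_i(g)` is multiplicative, also at the boundaries, where `u_i` is projective. -/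
theorem exists_mul_eq_smul (i : Λ) (g g' : G m) :
    ∃ c : ℂ, (S.u i g).mat * (S.u i g').mat = c • (S.u i (g + g')).mat := by
  rcases S.mem_cases i with h | h | h
  · exact S.projective_boundary i (Or.inl h) g g'
  · exact ⟨1, by rw [S.linear_bulk i h, one_smul]⟩
  · exact S.projective_boundary i (Or.inr h) g g'

theorem κ_add_left (g₁ g₂ g' : G m) : S.κ (g₁ + g₂) g' = S.κ g₁ g' + S.κ g₂ g' := by
  classical
  simp only [← S.sum_csgn_right, ← Finset.sum_add_distrib]
  refine Finset.sum_congr rfl fun i _ => ?_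
  split_ifs
  · obtain ⟨c, hc⟩ := S.exists_mul_eq_smul i g₁ g₂
    have hc0 : c ≠ 0 := fun h => Pauli.mat_mul_ne_zero _ _ (by rw [hc, h, zero_smul])
    refine csgn_eq_of_mul_eq ?_
    have h1 : (S.u i (g₁ + g₂)).mat = c⁻¹ • ((S.u i g₁).mat * (S.u i g₂).mat) := by
      rw [hc, smul_smul, inv_mul_cancel₀ hc0, one_smul]
    rw [h1, smul_mul_assoc, mul_assoc, mat_mul_mat (S.u i g₂), Matrix.mul_smul, ← mul_assoc,
      mat_mul_mat (S.u i g₁), sgn_add, Matrix.mul_smul, Matrix.smul_mul]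
    simp only [smul_smul, mul_assoc]
    congr 1
    ring
  · rw [add_zero]

variable {S} {H : Submodule (ZMod 2) (G m)}

theorem IsMaximalAbelian.κ_eq_zero (hH : S.IsMaximalAbelian H) {h h' : G m} (hh : h ∈ H)
    (hh' : h' ∈ H) : S.κ h h' = 0 :=
  (S.commute_VR_iff h h').1 (hH.prop h hh h' hh')

/-- By maximality, no element outside `H` commutes with all of `H`. -/
theorem IsMaximalAbelian.exists_κ_eq_one (hH : S.IsMaximalAbelian H) {g : G m} (hg : g ∉ H) :
    ∃ h ∈ H, S.κ h g = 1 := by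
  by_contra! hcon
  have h0 : ∀ h ∈ H, S.κ h g = 0 := fun h hh => (zmod_two_cases _).resolve_right (hcon h hh)
  refine hg (hH.le_of_ge (y := H ⊔ Submodule.span (ZMod 2) {g}) ?_ le_sup_left
    (Submodule.mem_sup_right (Submodule.mem_span_singleton_self g)))
  have key : ∀ x ∈ H ⊔ Submodule.span (ZMod 2) {g}, x ∈ H ∨ ∃ h ∈ H, x = h + g := by
    intro x hx
    obtain ⟨h, hh, y, hy, rfl⟩ := Submodule.mem_sup.1 hx
    obtain ⟨c, rfl⟩ := Submodule.mem_span_singleton.1 hy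
    rcases zmod_two_cases c with rfl | rfl
    · left; simpa using hh
    · right; exact ⟨h, hh, by rw [one_smul]⟩
  intro x hx y hy
  rw [commute_VR_iff]
  rcases key x hx with hx | ⟨h, hh, rfl⟩ <;> rcases key y hy with hy | ⟨h', hh', rfl⟩
  · exact hH.κ_eq_zero hx hy
  · rw [κ_comm, κ_add_left, hH.κ_eq_zero hh' hx, S.κ_comm g, h0 x hx, add_zero]
  · rw [κ_add_left, hH.κ_eq_zero hh hy, S.κ_comm g, h0 y hy, add_zero]
  · rw [κ_add_left, S.κ_comm h, S.κ_comm g, κ_add_left, κ_add_left, hH.κ_eq_zero hh' hh, κ_self,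
      S.κ_comm g, h0 h hh, h0 h' hh']
    simp

variable (S H)

open Classical in
/-- The Pauli labels of the logical observable `T(g)`. -/
noncomputable def tlab (g : G m) (i : Λ) : Pauli := if i ∈ S.L ∧ g ∉ H then .I else S.u i g

theorem T_eq (g : G m) : S.T H g = pauliTensor (S.tlab H g) := by
  classical
  rw [T]
  split_ifs with hg
  · simp only [U, pauliTensor, tlab, hg, not_true, and_false, if_false]
  · rw [tensorOn_eq_pauliTensor, pauliTensor, pauliTensor]
    congr 1; ext1 i
    congr 1
    rcases S.mem_cases i with h | h | h
    · simp [tlab, hg, h, S.notMem_B_of_mem_L h, S.notMem_R_of_mem_L h]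
    · simp [tlab, h, show i ∉ S.L from fun h' => S.notMem_B_of_mem_L h' h]
    · simp [tlab, h, show i ∉ S.L from fun h' => S.notMem_R_of_mem_L h' h]

theorem T_conjTranspose (g : G m) : (S.T H g)ᴴ = S.T H g := by
  rw [T_eq, pauliTensor_conjTranspose]

theorem T_mul_self (g : G m) : S.T H g * S.T H g = 1 := by
  rw [T_eq, pauliTensor_mul_self]

variable {S H}

theorem tlab_of_notMem_L {g : G m} {i : Λ} (hi : i ∉ S.L) : S.tlab H g i = S.u i g := by
  simp [tlab, hi]

theorem T_mul_T (hH : S.IsMaximalAbelian H) (g g' : G m) :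
    S.T H g * S.T H g' = sgn (S.κ g g') • (S.T H g' * S.T H g) := by
  classical
  rw [T_eq, T_eq, pauliTensor_mul]
  congr 2
  rw [S.sum_split]
  have hB : ∑ i, (if i ∈ S.B then csgn (S.tlab H g i) (S.tlab H g' i) else 0) = 0 :=
    Finset.sum_eq_zero fun i _ => by
      split_ifs with h
      · have hL : i ∉ S.L := fun h' => S.notMem_B_of_mem_L h' h
        rw [tlab_of_notMem_L hL, tlab_of_notMem_L hL, S.csgn_bulk h]
      · rfl
  have hR : ∑ i, (if i ∈ S.R then csgn (S.tlab H g i) (S.tlab H g' i) else 0) = S.κ g g' := by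
    rw [← S.sum_csgn_right]
    refine Finset.sum_congr rfl fun i _ => ?_
    split_ifs with h
    · have hL : i ∉ S.L := fun h' => S.notMem_R_of_mem_L h' h
      rw [tlab_of_notMem_L hL, tlab_of_notMem_L hL]
    · rfl
  have hL : ∑ i, (if i ∈ S.L then csgn (S.tlab H g i) (S.tlab H g' i) else 0) = 0 := by
    by_cases hg : g ∈ H ∧ g' ∈ H
    · refine Eq.trans ?_ (hH.κ_eq_zero hg.1 hg.2)
      rw [← S.sum_csgn_left]
      refine Finset.sum_congr rfl fun i _ => ?_
      simp [tlab, hg.1, hg.2]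
    · refine Finset.sum_eq_zero fun i _ => ?_
      split_ifs with h
      · rw [not_and_or] at hg
        rcases hg with hg | hg
        · simp [tlab, hg, h, csgn_I_left]
        · simp [tlab, hg, h, csgn_I_right]
      · rfl
  rw [hL, hB, hR, zero_add, zero_add]

variable (S)

open Classical in
/-- The Pauli labels of the operator `R_k(g)`. -/
noncomputable def rlab (k : Λ) (g : G m) (b : Pauli) (i : Λ) : Pauli :=
  if i = k then b else if S.pos k 0 < S.pos i 0 then S.u i g else .I

theorem Rop_eq (k : Λ) (g : G m) (b : Pauli) : S.Rop k g b = pauliTensor (S.rlab k g b) := by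
  simp only [Rop, pauliTensor, rlab]
  congr 1; ext1 i
  split_ifs <;> rfl

theorem Rop_mul_self (k : Λ) (g : G m) (b : Pauli) : S.Rop k g b * S.Rop k g b = 1 := by
  rw [Rop_eq, pauliTensor_mul_self]

theorem Rop_conjTranspose (k : Λ) (g : G m) (b : Pauli) : (S.Rop k g b)ᴴ = S.Rop k g b := by
  rw [Rop_eq, pauliTensor_conjTranspose]

variable {S}

/-- `R_k(g)` commutes with each Pauli operator that agrees with `u(g')` at `k` and to the right
of it: the sign at `k` cancels that of the right boundary. -/
theorem commute_Rop_pauliTensor {k : Λ} (hk : k ∈ S.B) {g : G m} {b : Pauli}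
    (hb : S.Localizes k g b) (g' : G m) {q : Λ → Pauli} (hqk : q k = S.u k g')
    (hq : ∀ i, S.pos k 0 < S.pos i 0 → q i = S.u i g') :
    Commute (S.Rop k g b) (pauliTensor q) := by
  classical
  rw [Rop_eq]
  apply pauliTensor_commute
  rw [S.sum_split]
  have hR : ∑ i, (if i ∈ S.R then csgn (S.rlab k g b i) (q i) else 0) = S.κ g g' := by
    rw [← S.sum_csgn_right]
    refine Finset.sum_congr rfl fun i _ => ?_
    split_ifs with h
    · have h1 := S.bulk_lt_right k hk i h
      have h2 : i ≠ k := fun h' => S.notMem_R_of_mem_B hk (h' ▸ h)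
      rw [hq i h1, rlab, if_neg h2, if_pos h1]
    · rfl
  have hB : ∑ i, (if i ∈ S.B then csgn (S.rlab k g b i) (q i) else 0) = S.κ g g' := by
    rw [Finset.sum_eq_single k]
    · rw [if_pos hk, hqk, rlab, if_pos rfl, csgn_comm]
      exact csgn_eq_of_mul_eq (hb g')
    · intro i _ hik
      split_ifs with h
      · rw [rlab, if_neg hik]
        split_ifs with h'
        · rw [hq i h', S.csgn_bulk h]
        · exact csgn_I_left _
      · rfl
    · simp
  have hL : ∑ i, (if i ∈ S.L then csgn (S.rlab k g b i) (q i) else 0) = 0 := by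
    refine Finset.sum_eq_zero fun i _ => ?_
    split_ifs with h
    · have h1 := S.left_lt_bulk i h k hk
      have h2 : i ≠ k := fun h' => S.notMem_B_of_mem_L h (h' ▸ hk)
      rw [rlab, if_neg h2, if_neg h1.not_gt, csgn_I_left]
    · rfl
  rw [hL, hB, hR, zero_add, CharTwo.add_self_eq_zero]

theorem commute_Rop_T {k : Λ} (hk : k ∈ S.B) {g : G m} {b : Pauli}
    (hb : S.Localizes k g b) (g' : G m) : Commute (S.Rop k g b) (S.T H g') := by
  rw [T_eq]
  refine commute_Rop_pauliTensor hk hb g' ?_ fun i hi => ?_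
  · exact tlab_of_notMem_L fun h => S.notMem_B_of_mem_L h hk
  · exact tlab_of_notMem_L fun h => (S.left_lt_bulk i h k hk).not_gt hi

theorem commute_Rop_Rop {k k' : Λ} (hk : k ∈ S.B) {g g' : G m} {b b' : Pauli}
    (hb : S.Localizes k g b) (hkk' : S.pos k' 0 < S.pos k 0) :
    Commute (S.Rop k g b) (S.Rop k' g' b') := by
  rw [S.Rop_eq k']
  refine commute_Rop_pauliTensor hk hb g' ?_ fun i hi => ?_
  · have : k ≠ k' := fun h => by simp [h] at hkk'
    rw [rlab, if_neg this, if_pos hkk']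
  · have h1 := hkk'.trans hi
    have : i ≠ k' := fun h => by simp [h] at h1
    rw [rlab, if_neg this, if_pos h1]

end Setting

/-! ### Rotations and random rotations -/

section Rotation

variable {A : Type} [Ring A] [Algebra ℂ A]

/-- The rotation `cos α - i sin α t`, which is `exp(-iαt)` if `t² = 1`. -/
noncomputable def rot (t : A) (α : ℝ) : A :=
  (Real.cos α : ℂ) • (1 : A) - (Complex.I * Real.sin α) • t

theorem rot_zero (t : A) : rot t 0 = 1 := by simp [rot]

theorem rot_mul_rot {t : A} (ht : t * t = 1) (α β : ℝ) : rot t α * rot t β = rot t (α + β) := by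
  simp only [rot, sub_mul, mul_sub, smul_mul_assoc, mul_smul_comm, one_mul, mul_one, ht,
    Real.cos_add, Real.sin_add]
  push_cast
  have hI : Complex.I * Complex.I = -1 := Complex.I_mul_I
  rw [← sub_eq_zero]
  match_scalars <;> first | ring1 | linear_combination (Complex.sin α * Complex.sin β) * hI

theorem rot_mul_rot_neg {t : A} (ht : t * t = 1) (α : ℝ) : rot t α * rot t (-α) = 1 := by
  rw [rot_mul_rot ht, add_neg_cancel, rot_zero]

theorem rot_neg_mul_rot {t : A} (ht : t * t = 1) (α : ℝ) : rot t (-α) * rot t α = 1 := by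
  rw [rot_mul_rot ht, neg_add_cancel, rot_zero]

theorem rot_pow {t : A} (ht : t * t = 1) (α : ℝ) (n : ℕ) : rot t α ^ n = rot t (n * α) := by
  induction n with
  | zero => simp [rot_zero]
  | succ n ih =>
    rw [pow_succ, ih, rot_mul_rot ht]
    congr 1
    push_cast
    ring

theorem Commute.rot_right {s t : A} (h : Commute s t) (α : ℝ) : Commute s (rot t α) :=
  ((Commute.one_right s).smul_right _).sub_right (h.smul_right _)

/-- The channel that rotates by `α` with probability `(1 + σ) / 2` and by `-α` otherwise. -/
noncomputable def randomRot (t : A) (σ α : ℝ) (ρ : A) : A :=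
  ((1 + σ) / 2 : ℂ) • (rot t α * ρ * rot t (-α)) + ((1 - σ) / 2 : ℂ) • (rot t (-α) * ρ * rot t α)

/-- The random rotation in terms of `ρ`, `t * ρ * t` and the commutator of `t` and `ρ`. -/
theorem randomRot_eq (t : A) (σ α : ℝ) (ρ : A) :
    randomRot t σ α ρ = ((Real.cos α : ℂ) ^ 2) • ρ + ((Real.sin α : ℂ) ^ 2) • (t * ρ * t) +
      (σ * (Complex.I * Real.sin α * Real.cos α)) • (ρ * t - t * ρ) := by
  have hI : Complex.I * Complex.I = -1 := Complex.I_mul_I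
  simp only [randomRot, rot, sub_mul, mul_sub, smul_mul_assoc, mul_smul_comm, one_mul, mul_one,
    Real.cos_neg, Real.sin_neg, smul_smul, smul_sub]
  rw [← sub_eq_zero]
  push_cast
  match_scalars
  all_goals first | ring1 | linear_combination (-(Complex.sin α * Complex.sin α)) * hI

end Rotation

theorem rot_conjTranspose {n : Type} [Fintype n] [DecidableEq n] {t : Matrix n n ℂ}
    (ht : tᴴ = t) (α : ℝ) : (rot t α)ᴴ = rot t (-α) := by
  simp only [rot, conjTranspose_sub, conjTranspose_smul, conjTranspose_one, ht, Real.cos_neg,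
    Real.sin_neg]
  congr 2
  · exact Complex.conj_ofReal _
  · rw [star_mul', Complex.star_def, Complex.conj_I, Complex.conj_ofReal]
    push_cast
    ring

/-- Random rotations are dual to the opposite random rotations. -/
theorem trace_mul_randomRot {n : Type} [Fintype n] [DecidableEq n] (t X ρ : Matrix n n ℂ)
    (σ α : ℝ) : (X * randomRot t σ α ρ).trace = (randomRot t σ (-α) X * ρ).trace := by
  have key : ∀ U V : Matrix n n ℂ, (X * (U * ρ * V)).trace = (V * X * U * ρ).trace := fun U V => by
    rw [← mul_assoc, trace_mul_comm, ← mul_assoc, ← mul_assoc]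
  simp only [randomRot, neg_neg, Matrix.mul_add, Matrix.add_mul, Matrix.mul_smul, Matrix.smul_mul,
    trace_add, trace_smul, key]

/-! ### Factorization of string correlations -/

section Factorization

variable {m : ℕ} {Λ : Type} [Fintype Λ] [DecidableEq Λ] {S : Setting m Λ}
  {H : Submodule (ZMod 2) (G m)} {Φ : Vec Λ} {χ : G m → ZMod 2} {Δ : ℕ} {d : ℝ}

/-- The operators that act on states `A Φ`, with `A` supported on `P`, like operators supported
on `P`. -/
def localActing (Φ : Vec Λ) (P : Set Λ) : Subalgebra ℂ (Op Λ) where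
  carrier := {M | ∀ A, SupportedOn A P → ∃ A', SupportedOn A' P ∧ M *ᵥ (A *ᵥ Φ) = A' *ᵥ Φ}
  mul_mem' := fun {M N} hM hN A hA => by
    obtain ⟨A₁, hA₁, h₁⟩ := hN A hA
    obtain ⟨A₂, hA₂, h₂⟩ := hM A₁ hA₁
    exact ⟨A₂, hA₂, by rw [← mulVec_mulVec, h₁, h₂]⟩
  add_mem' := fun {M N} hM hN A hA => by
    obtain ⟨A₁, hA₁, h₁⟩ := hM A hA
    obtain ⟨A₂, hA₂, h₂⟩ := hN A hA
    exact ⟨A₁ + A₂, hA₁.add hA₂, by rw [add_mulVec, add_mulVec, h₁, h₂]⟩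
  algebraMap_mem' := fun c A hA => ⟨c • A, hA.smul c, by
    rw [Algebra.algebraMap_eq_smul_one, smul_mulVec, one_mulVec, smul_mulVec]⟩

/-- An operator that agrees with a symmetry operator outside `P` acts on symmetric states like an
operator supported on `P`. -/
theorem pauliTensor_mem_localActing (hΦ : ∀ g, S.U g *ᵥ Φ = sgn (χ g) • Φ) {P : Set Λ} {g : G m}
    {p : Λ → Pauli} (hp : ∀ i, i ∉ P → p i = S.u i g) : pauliTensor p ∈ localActing Φ P := by
  classical
  intro A hA
  -- `p` is `U(g)` up to its part `q` in `P`
  let q : Λ → Pauli := fun i => if i ∈ P then p i else .I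
  let v : Λ → Pauli := fun i => if i ∈ P then S.u i g else .I
  let w : Λ → Pauli := fun i => if i ∈ P then .I else S.u i g
  have hq : SupportedOn (pauliTensor q) P := supportedOn_tensor fun i hi => by
    simp [q, hi, Pauli.mat_I]
  have hv : SupportedOn (pauliTensor v) P := supportedOn_tensor fun i hi => by
    simp [v, hi, Pauli.mat_I]
  have hw : SupportedOn (pauliTensor w) Pᶜ := supportedOn_tensor fun i hi => by
    simp [w, not_not.1 hi, Pauli.mat_I]
  have h1 : pauliTensor p = pauliTensor q * pauliTensor w := by
    rw [pauliTensor, pauliTensor, pauliTensor, tensor_mul]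
    congr 1; ext1 i
    by_cases hi : i ∈ P
    · simp [q, w, hi, Pauli.mat_I]
    · simp [q, w, hi, Pauli.mat_I, hp i hi]
  have h2 : pauliTensor w = pauliTensor v * S.U g := by
    rw [pauliTensor, pauliTensor, Setting.U, tensor_mul]
    congr 1; ext1 i
    by_cases hi : i ∈ P
    · simp [v, w, hi, Pauli.mat_I, Pauli.mat_mul_self]
    · simp [v, w, hi, Pauli.mat_I]
  refine ⟨sgn (χ g) • (pauliTensor q * A * pauliTensor v), ((hq.mul hA).mul hv).smul _, ?_⟩
  rw [h1, mulVec_mulVec, mul_assoc, ← (hA.commute_compl hw).eq, h2, ← mul_assoc, ← mul_assoc,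
    ← mulVec_mulVec, hΦ, mulVec_smul, smul_mulVec]

theorem le_dist_of_le (i j : Λ) {D : ℝ} (h : S.pos i 0 + D ≤ S.pos j 0) :
    D ≤ dist (S.pos i) (S.pos j) := by
  have h1 : dist (S.pos i 0) (S.pos j 0) ≤ dist (S.pos i) (S.pos j) := by
    rw [EuclideanSpace.dist_eq, ← Real.sqrt_sq (dist_nonneg (x := S.pos i 0) (y := S.pos j 0))]
    exact Real.sqrt_le_sqrt (Finset.single_le_sum (f := fun l => dist (S.pos i l) (S.pos j l) ^ 2)
      (fun _ _ => sq_nonneg _) (Finset.mem_univ 0))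
  rw [Real.dist_eq] at h1
  have h2 := neg_abs_le (S.pos i 0 - S.pos j 0)
  linarith

/-- A site of the bulk at which a logical rotation about `T(elt)` by an angle of size `angle` is
done, with the Pauli operator that localizes `elt` to this site. -/
structure RotStep (m : ℕ) (Λ : Type) where
  /-- the site -/
  site : Λ
  /-- the group element -/
  elt : G m
  /-- the Pauli operator at the site -/
  pauli : Pauli
  /-- the angle -/
  angle : ℝ

namespace RotStep

variable (S) in
/-- The operator `R_k(g)` of a rotation step. -/
noncomputable def R (x : RotStep m Λ) : Op Λ := S.Rop x.site x.elt x.pauli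

variable (S H) in
/-- The unitary by which the adaptive measurement at the site of the step differs from the
non-adaptive measurement of a Pauli operator. -/
noncomputable def unitary (x : RotStep m Λ) : Op Λ := rot (x.R S * S.T H x.elt) x.angle

variable (S H Φ) in
/-- The logical channel effected by a rotation step: a random rotation about `T(g)`, whose bias is
the order parameter. -/
noncomputable def channel (x : RotStep m Λ) : Op Λ → Op Λ :=
  randomRot (S.T H x.elt) (ev Φ (x.R S)).re x.angle

variable (S H) in
/-- The unitaries of several steps, the step at the head of the list coming last. -/
noncomputable def unitaries (ℓ : List (RotStep m Λ)) : Op Λ := (ℓ.map (unitary S H)).prod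

variable (S H Φ) in
/-- The channels of several steps, the step at the head of the list coming last. -/
noncomputable def channels (ℓ : List (RotStep m Λ)) : Op Λ → Op Λ :=
  ℓ.foldr (fun x 𝓔 => channel S H Φ x ∘ 𝓔) id

variable (S) in
/-- The steps are at sites of the bulk, whose horizontal distances from the sites of the left
boundary and from each other are at least `D`, the head of the list being to the right; and none of
the group elements is central. -/
structure Admissible (D : ℝ) (ℓ : List (RotStep m Λ)) : Prop where
  mem_bulk : ∀ x ∈ ℓ, x.site ∈ S.B
  localizes : ∀ x ∈ ℓ, S.Localizes x.site x.elt x.pauli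
  not_central : ∀ x ∈ ℓ, ∃ g', S.κ x.elt g' = 1
  separated : ℓ.Pairwise fun x y => S.pos y.site 0 + D ≤ S.pos x.site 0
  left : ∀ x ∈ ℓ, ∀ i ∈ S.L, S.pos i 0 + D ≤ S.pos x.site 0

theorem Admissible.tail {D : ℝ} {x : RotStep m Λ} {ℓ : List (RotStep m Λ)}
    (h : Admissible S D (x :: ℓ)) : Admissible S D ℓ where
  mem_bulk y hy := h.mem_bulk y (List.mem_cons_of_mem x hy)
  localizes y hy := h.localizes y (List.mem_cons_of_mem x hy)
  not_central y hy := h.not_central y (List.mem_cons_of_mem x hy)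
  separated := (List.pairwise_cons.1 h.separated).2
  left y hy := h.left y (List.mem_cons_of_mem x hy)

theorem Admissible.head_separated {D : ℝ} {x : RotStep m Λ} {ℓ : List (RotStep m Λ)}
    (h : Admissible S D (x :: ℓ)) : ∀ y ∈ ℓ, S.pos y.site 0 + D ≤ S.pos x.site 0 :=
  (List.pairwise_cons.1 h.separated).1

theorem R_mul_self (x : RotStep m Λ) : x.R S * x.R S = 1 := S.Rop_mul_self _ _ _

theorem R_conjTranspose (x : RotStep m Λ) : (x.R S)ᴴ = x.R S := S.Rop_conjTranspose _ _ _

theorem R_commute_T {x : RotStep m Λ} (hx : x.site ∈ S.B)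
    (hx' : S.Localizes x.site x.elt x.pauli) (g : G m) : Commute (x.R S) (S.T H g) :=
  Setting.commute_Rop_T hx hx' g

theorem conjTranspose_unitary {x : RotStep m Λ} (hx : x.site ∈ S.B)
    (hx' : S.Localizes x.site x.elt x.pauli) :
    (x.unitary S H)ᴴ = rot (x.R S * S.T H x.elt) (-x.angle) := by
  refine rot_conjTranspose ?_ _
  rw [conjTranspose_mul, S.T_conjTranspose, R_conjTranspose, (R_commute_T hx hx' _).eq]

/-- The correlations between `R_k(g)` and logical observables and string operators on its left
factorize. -/
theorem ev_R_mul (hR : IsResource S H Φ χ Δ d) {x : RotStep m Λ} {ℓ : List (RotStep m Λ)}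
    (hℓ : Admissible S (2 * Δ + d) (x :: ℓ)) {X : Op Λ}
    (hX : X ∈ Algebra.adjoin ℂ (Set.range (S.T H))) :
    ev Φ (x.R S * ((unitaries S H ℓ)ᴴ * X * unitaries S H ℓ)) =
      ev Φ (x.R S) * ev Φ ((unitaries S H ℓ)ᴴ * X * unitaries S H ℓ) := by
  have hD : 0 < 2 * Δ + d := by have := hR.d_pos; positivity
  set D : ℝ := 2 * Δ + d with hDdef
  let P : Set Λ := {i | S.pos i 0 + D ≤ S.pos x.site 0}
  let Q : Set Λ := {i | S.pos x.site 0 ≤ S.pos i 0}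
  have hPQ : ∀ a ∈ P, ∀ b ∈ Q, D ≤ dist (S.pos a) (S.pos b) := fun a ha b hb =>
    le_dist_of_le a b (ha.trans hb)
  have hxQ : SupportedOn (x.R S) Q := by
    rw [R, Setting.Rop_eq]
    refine supportedOn_tensor fun i hi => ?_
    have h1 : S.pos i 0 < S.pos x.site 0 := not_le.1 hi
    have h2 : i ≠ x.site := fun h => by simp [h] at h1
    rw [Setting.rlab, if_neg h2, if_neg h1.not_gt, Pauli.mat_I]
  have hT : ∀ g, S.T H g ∈ localActing Φ P := fun g => by
    rw [S.T_eq]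
    exact pauliTensor_mem_localActing hR.symmetric fun i hi => Setting.tlab_of_notMem_L
      fun hL => hi (hℓ.left x List.mem_cons_self i hL)
  have hRy : ∀ y ∈ ℓ, y.R S ∈ localActing Φ P := fun y hy => by
    rw [R, Setting.Rop_eq]
    refine pauliTensor_mem_localActing (g := y.elt) hR.symmetric fun i hi => ?_
    have h1 := hℓ.head_separated y hy
    have h2 : S.pos x.site 0 < S.pos i 0 + D := not_le.1 hi
    have h3 : S.pos y.site 0 < S.pos i 0 := by linarith
    have h4 : i ≠ y.site := fun h => by simp [h] at h3
    rw [Setting.rlab, if_neg h4, if_pos h3]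
  have hrot : ∀ y ∈ ℓ, ∀ α, rot (y.R S * S.T H y.elt) α ∈ localActing Φ P := fun y hy α =>
    Subalgebra.sub_mem _ (Subalgebra.smul_mem _ (Subalgebra.one_mem _) _)
      (Subalgebra.smul_mem _ (Subalgebra.mul_mem _ (hRy y hy) (hT _)) _)
  have hW : unitaries S H ℓ ∈ localActing Φ P := by
    refine Subalgebra.list_prod_mem _ fun M hM => ?_
    obtain ⟨y, hy, rfl⟩ := List.mem_map.1 hM
    exact hrot y hy _
  have hW' : (unitaries S H ℓ)ᴴ ∈ localActing Φ P := by
    rw [unitaries, conjTranspose_list_prod]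
    refine Subalgebra.list_prod_mem _ fun M hM => ?_
    simp only [List.mem_reverse, List.mem_map] at hM
    obtain ⟨_, ⟨y, hy, rfl⟩, rfl⟩ := hM
    have hy' := List.mem_cons_of_mem x hy
    rw [conjTranspose_unitary (hℓ.mem_bulk y hy') (hℓ.localizes y hy')]
    exact hrot y hy _
  have hX' : X ∈ localActing Φ P := by
    refine Algebra.adjoin_le ?_ hX
    rintro _ ⟨g, rfl⟩
    exact hT g
  obtain ⟨A, hA, hA'⟩ :=
    Subalgebra.mul_mem _ (Subalgebra.mul_mem _ hW' hX') hW 1 (SupportedOn.one P)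
  rw [one_mulVec] at hA'
  rw [ev_mul_of_mulVec hA', ev_mul_of_dist hR hPQ hA hxQ]
  congr 1
  rw [ev, ev, hA']

theorem R_commute_unitaries {D : ℝ} (hD : 0 < D) {x : RotStep m Λ} {ℓ : List (RotStep m Λ)}
    (hℓ : Admissible S D (x :: ℓ)) : Commute (x.R S) (unitaries S H ℓ) := by
  have hx := hℓ.mem_bulk x List.mem_cons_self
  have hx' := hℓ.localizes x List.mem_cons_self
  refine Commute.list_prod_right _ _ fun M hM => ?_
  obtain ⟨y, hy, rfl⟩ := List.mem_map.1 hM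
  refine Commute.rot_right (Commute.mul_right ?_ (R_commute_T hx hx' _)) _
  refine Setting.commute_Rop_Rop hx hx' ?_
  have := hℓ.head_separated y hy
  linarith

theorem im_ev_R (x : RotStep m Λ) : ((ev Φ (x.R S)).re : ℂ) = ev Φ (x.R S) := by
  refine Complex.conj_eq_iff_re.1 ?_
  rw [ev, ← Complex.star_def, ← star_dotProduct, star_mulVec, R_conjTranspose,
    ← dotProduct_mulVec]

/-- In the resource state, the string operators `R_k(g)` are independent random signs, so that the
rotation steps effect random rotations of the logical observables. -/
theorem ev_unitaries (hR : IsResource S H Φ χ Δ d) {ℓ : List (RotStep m Λ)}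
    (hℓ : Admissible S (2 * Δ + d) ℓ) {X : Op Λ}
    (hX : X ∈ Algebra.adjoin ℂ (Set.range (S.T H))) :
    ev Φ ((unitaries S H ℓ)ᴴ * X * unitaries S H ℓ) =
      (X * channels S H Φ ℓ (ketbra Φ)).trace := by
  have hD : 0 < 2 * Δ + d := by have := hR.d_pos; positivity
  induction ℓ generalizing X with
  | nil => simp [unitaries, channels, ev_eq_trace]
  | cons x ℓ ih =>
    have hx := hℓ.mem_bulk x List.mem_cons_self
    have hx' := hℓ.localizes x List.mem_cons_self
    have hT : S.T H x.elt ∈ Algebra.adjoin ℂ (Set.range (S.T H)) :=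
      Algebra.subset_adjoin ⟨_, rfl⟩
    set α := x.angle with hα
    set t := S.T H x.elt with ht
    set r := x.R S with hr
    set W := unitaries S H ℓ with hW
    let Y₀ : Op Λ := ((Real.cos α : ℂ) ^ 2) • X + ((Real.sin α : ℂ) ^ 2) • (t * X * t)
    let Y₁ : Op Λ := (Complex.I * Real.sin α * Real.cos α) • (t * X - X * t)
    have hY₀ : Y₀ ∈ Algebra.adjoin ℂ (Set.range (S.T H)) :=
      Subalgebra.add_mem _ (Subalgebra.smul_mem _ hX _)
        (Subalgebra.smul_mem _ (Subalgebra.mul_mem _ (Subalgebra.mul_mem _ hT hX) hT) _)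
    have hY₁ : Y₁ ∈ Algebra.adjoin ℂ (Set.range (S.T H)) :=
      Subalgebra.smul_mem _ (Subalgebra.sub_mem _ (Subalgebra.mul_mem _ hT hX)
        (Subalgebra.mul_mem _ hX hT)) _
    have hrX : Commute r X := by
      have : X ∈ Subalgebra.centralizer ℂ {r} := by
        refine Algebra.adjoin_le ?_ hX
        rintro _ ⟨g, rfl⟩
        rw [SetLike.mem_coe, Subalgebra.mem_centralizer_iff]
        rintro _ rfl
        exact (R_commute_T hx hx' g).eq
      exact (Subalgebra.mem_centralizer_iff ℂ).1 this r rfl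
    have hrt : Commute r t := R_commute_T hx hx' _
    have hrr : r * r = 1 := R_mul_self x
    have hstep : (x.unitary S H)ᴴ * X * x.unitary S H = Y₀ + r * Y₁ := by
      have h1 : ∀ Z, r * (t * Z) = t * (r * Z) := fun Z => by
        rw [← mul_assoc, hrt.eq, mul_assoc]
      have h2 : ∀ Z, r * (X * Z) = X * (r * Z) := fun Z => by
        rw [← mul_assoc, hrX.eq, mul_assoc]
      have h3 : ∀ Z, r * (r * Z) = Z := fun Z => by rw [← mul_assoc, hrr, one_mul]
      have hI : Complex.I * Complex.I = -1 := Complex.I_mul_I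
      have e1 : r * t * X * (r * t) = t * X * t := by
        rw [mul_assoc, mul_assoc, h1, h2, h3, mul_assoc]
      have e2 : X * (r * t) = r * (X * t) := (h2 t).symm
      rw [conjTranspose_unitary hx hx', unitary]
      simp only [rot, sub_mul, mul_sub, smul_mul_assoc, mul_smul_comm, one_mul, mul_one,
        Real.cos_neg, Real.sin_neg, smul_smul, smul_sub, Y₀, Y₁, ← ht, ← hr, ← hα, e1, e2]
      rw [← mul_assoc r t X, ← sub_eq_zero]
      push_cast
      match_scalars
      all_goals first | ring1 | linear_combination (-(Complex.sin α * Complex.sin α)) * hI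
    have hdual : randomRot t (ev Φ r).re (-α) X = Y₀ + ev Φ r • Y₁ := by
      rw [randomRot_eq, im_ev_R, ← hr]
      simp only [Real.cos_neg, Real.sin_neg, Y₀, Y₁, smul_smul, smul_sub]
      rw [← sub_eq_zero]
      push_cast
      match_scalars <;> ring
    have hrW : Commute r W := R_commute_unitaries hD hℓ
    have hrW' : Commute r Wᴴ := by
      have := congrArg conjTranspose hrW.eq
      rw [conjTranspose_mul, conjTranspose_mul, R_conjTranspose] at this
      exact this.symm
    have h1 : (unitaries S H (x :: ℓ))ᴴ * X * unitaries S H (x :: ℓ) =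
        Wᴴ * Y₀ * W + r * (Wᴴ * Y₁ * W) := by
      have h2 : unitaries S H (x :: ℓ) = x.unitary S H * W := by simp [unitaries, hW]
      have h3 : (x.unitary S H * W)ᴴ * X * (x.unitary S H * W) =
          Wᴴ * ((x.unitary S H)ᴴ * X * x.unitary S H) * W := by
        rw [conjTranspose_mul]; simp only [mul_assoc]
      rw [h2, h3, hstep, Matrix.mul_add, Matrix.add_mul, ← mul_assoc Wᴴ r, ← hrW'.eq]
      simp only [mul_assoc]
    have h4 : channels S H Φ (x :: ℓ) (ketbra Φ) =
        randomRot t (ev Φ r).re α (channels S H Φ ℓ (ketbra Φ)) := rfl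
    rw [h1, h4, trace_mul_randomRot, hdual, ev_add, ev_R_mul hR hℓ hY₁, ih hℓ.tail hY₀,
      ih hℓ.tail hY₁, Matrix.add_mul Y₀ (ev Φ r • Y₁), trace_add (Y₀ * _), Matrix.smul_mul _ Y₁,
      trace_smul (ev Φ r) (Y₁ * _), smul_eq_mul]

end RotStep

end Factorization

/-! ### Measurements in Pauli bases -/

section Axis

/-- The projector onto the eigenspace with eigenvalue `(-1)^a` of a Pauli operator. -/
noncomputable def axisProj (q : Pauli) (a : ZMod 2) : Matrix (Fin 2) (Fin 2) ℂ :=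
  (1 / 2 : ℂ) • (1 + sgn a • q.mat)

theorem sum_zmod_two {M : Type} [AddCommMonoid M] (F : ZMod 2 → M) : ∑ a, F a = F 0 + F 1 :=
  Fin.sum_univ_two F

theorem mat_mul_axisProj (q : Pauli) (a : ZMod 2) :
    q.mat * axisProj q a = sgn a • axisProj q a := by
  rw [axisProj, Matrix.mul_smul, Matrix.mul_add, mul_one, Matrix.mul_smul, Pauli.mat_mul_self,
    smul_comm (sgn a), smul_add (sgn a), smul_smul (sgn a), sgn_mul_self, one_smul, add_comm]

theorem axisProj_mul_mat (q : Pauli) (a : ZMod 2) :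
    axisProj q a * q.mat = sgn a • axisProj q a := by
  rw [axisProj, Matrix.smul_mul, Matrix.add_mul, one_mul, Matrix.smul_mul, Pauli.mat_mul_self,
    smul_comm (sgn a), smul_add (sgn a), smul_smul (sgn a), sgn_mul_self, one_smul, add_comm]

theorem axisProj_conjTranspose (q : Pauli) (a : ZMod 2) : (axisProj q a)ᴴ = axisProj q a := by
  simp [axisProj, Pauli.mat_conjTranspose, star_sgn]

theorem axisProj_mul (q : Pauli) (a b : ZMod 2) :
    axisProj q a * axisProj q b = if a = b then axisProj q a else 0 := by
  conv_lhs => rw [axisProj, Matrix.smul_mul, Matrix.add_mul, one_mul, Matrix.smul_mul,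
    mat_mul_axisProj, smul_smul]
  rcases zmod_two_cases a with rfl | rfl <;> rcases zmod_two_cases b with rfl | rfl
  all_goals simp [sgn_zero, sgn_one, ← two_smul ℂ (axisProj _ _)]

theorem axisProj_trace {q : Pauli} (hq : q ≠ .I) (a : ZMod 2) : (axisProj q a).trace = 1 := by
  simp [axisProj, Pauli.trace_mat hq]

theorem sum_axisProj (q : Pauli) : ∑ a, axisProj q a = 1 := by
  rw [sum_zmod_two, axisProj, axisProj, sgn_zero, sgn_one]
  module

end Axis

section Measurement

variable {m : ℕ} {Λ : Type} [Fintype Λ] [DecidableEq Λ] {S : Setting m Λ}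
  {H : Submodule (ZMod 2) (G m)}

/-- A choice of a Pauli operator for each site, of which each bulk operator `u_i(g)`, and each
boundary operator `u_i(h)` with `h ∈ H`, is a power. -/
def IsAxis (S : Setting m Λ) (H : Submodule (ZMod 2) (G m)) (Q : Λ → Pauli) : Prop :=
  ∀ i, Q i ≠ .I ∧ ∀ g, i ∈ S.B ∨ g ∈ H → S.u i g = .I ∨ S.u i g = Q i

theorem exists_isAxis (hH : S.SitewiseCommuting H) : ∃ Q, IsAxis S H Q := by
  have h : ∀ i, ∃ q : Pauli, q ≠ .I ∧ ∀ g, i ∈ S.B ∨ g ∈ H → S.u i g = .I ∨ S.u i g = q := by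
    intro i
    by_cases h : ∃ g, (i ∈ S.B ∨ g ∈ H) ∧ S.u i g ≠ .I
    · obtain ⟨g, hg, hgI⟩ := h
      refine ⟨S.u i g, hgI, fun g' hg' => or_iff_not_imp_left.2 fun hgI' => ?_⟩
      refine Pauli.eq_of_commute hgI' hgI ?_
      by_cases hB : i ∈ S.B
      · exact S.commute_bulk hB g' g
      · refine hH i ?_ g' (hg'.resolve_left hB) g (hg.resolve_left hB)
        rcases S.mem_cases i with h | h | h
        · exact Or.inl h
        · exact absurd h hB
        · exact Or.inr h
    · push Not at h
      exact ⟨.Z, by simp, fun g hg => Or.inl (h g hg)⟩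
  choose Q hQ using h
  exact ⟨Q, hQ⟩

open Classical in
/-- The exponent of the power of the axis that is equal to `u_i(g)`. -/
noncomputable def Setting.bit (S : Setting m Λ) (i : Λ) (g : G m) : ZMod 2 :=
  if S.u i g = .I then 0 else 1

variable {Q : Λ → Pauli}

theorem IsAxis.mat_mul_axisProj (hQ : IsAxis S H Q) {i : Λ} {g : G m} (hg : i ∈ S.B ∨ g ∈ H)
    (a : ZMod 2) : axisProj (Q i) a * (S.u i g).mat = sgn (S.bit i g * a) • axisProj (Q i) a := by
  rw [Setting.bit]
  split_ifs with h
  · rw [h, Pauli.mat_I, mul_one, zero_mul, sgn_zero, one_smul]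
  · rw [((hQ i).2 g hg).resolve_left h, axisProj_mul_mat, one_mul]

theorem IsAxis.sum_sgn (hQ : IsAxis S H Q) {i : Λ} {g : G m} (hg : i ∈ S.B ∨ g ∈ H) :
    ∑ a, sgn (S.bit i g * a) • axisProj (Q i) a = (S.u i g).mat := by
  simp only [← hQ.mat_mul_axisProj hg, ← Finset.sum_mul, sum_axisProj, one_mul]

theorem IsAxis.eq_zero_of_bit_eq_zero {i : Λ} {g : G m} (h : S.bit i g = 0) : S.u i g = .I := by
  by_contra h'
  simp [Setting.bit, h'] at h

open Classical in
/-- The operator that measures the record `s` in the Pauli basis `Q` on the sites outside `A`, and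
the single-qubit observables `q` on the sites in `A`. -/
noncomputable def pauliRecord (Q : Λ → Pauli) (A : Set Λ) (s : Λ → ZMod 2)
    (q : Λ → Matrix (Fin 2) (Fin 2) ℂ) : Op Λ :=
  tensor fun i => if i ∈ A then q i else axisProj (Q i) (s i)

variable (S H) in
open Classical in
/-- The byproduct exponent: the parity of the outcomes outside the right boundary that compares
`T(g)` with its restriction to the right boundary. -/
noncomputable def byproduct (g : G m) (s : Λ → ZMod 2) : ZMod 2 :=
  ∑ i, if i ∉ S.R ∧ (i ∈ S.B ∨ g ∈ H) then S.bit i g * s i else 0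

open Classical in
/-- Measuring all sites outside the right boundary in the Pauli bases, and `V_R(g)` on the right
boundary, amounts to a measurement of `T(g)`. -/
theorem sum_pauliRecord_right (hQ : IsAxis S H Q) (g : G m) :
    ∑ s : Λ → ZMod 2 with (∀ i ∈ S.R, s i = 0),
      sgn (byproduct S H g s) • pauliRecord Q S.R s (fun i => (S.u i g).mat) = S.T H g := by
  let M : Λ → ZMod 2 → Matrix (Fin 2) (Fin 2) ℂ := fun i a =>
    if i ∈ S.R then (if a = 0 then (S.u i g).mat else 0) else
      (if i ∈ S.B ∨ g ∈ H then sgn (S.bit i g * a) else 1) • axisProj (Q i) a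
  have h1 : ∀ s : Λ → ZMod 2, tensor (fun i => M i (s i)) =
      if (∀ i ∈ S.R, s i = 0) then
        sgn (byproduct S H g s) • pauliRecord Q S.R s (fun i => (S.u i g).mat) else 0 := by
    intro s
    split_ifs with h
    · rw [byproduct, sgn_sum, pauliRecord, ← tensor_smul]
      congr 1; ext1 i
      by_cases hi : i ∈ S.R
      · simp [M, hi, h i hi, sgn_zero]
      · by_cases hi' : i ∈ S.B ∨ g ∈ H
        · simp [M, hi, hi']
        · simp [M, hi, hi', sgn_zero]
    · push Not at h
      obtain ⟨i, hi, hsi⟩ := h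
      ext x y
      rw [tensor_apply, Finset.prod_eq_zero (Finset.mem_univ i)]
      · rfl
      · simp [M, hi, hsi]
  rw [Finset.sum_filter, ← Finset.sum_congr rfl fun s _ => h1 s, sum_tensor, S.T_eq, pauliTensor]
  congr 1; ext1 i
  rcases S.mem_cases i with hi | hi | hi
  · have hR := S.notMem_R_of_mem_L hi
    have hB := S.notMem_B_of_mem_L hi
    by_cases hg : g ∈ H
    · simp [M, hR, hg, Setting.tlab, hQ.sum_sgn (Or.inr hg)]
    · simp [M, hR, hB, hg, hi, Setting.tlab, sum_axisProj, Pauli.mat_I]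
  · have hR := S.notMem_R_of_mem_B hi
    have hL : i ∉ S.L := fun h => S.notMem_B_of_mem_L h hi
    simp [M, hR, hi, hL, Setting.tlab, hQ.sum_sgn (Or.inl hi)]
  · have hL : i ∉ S.L := fun h => S.notMem_R_of_mem_L h hi
    simp [M, hi, hL, Setting.tlab]

/-- The observable that takes the value `F s` on the record `s` of a measurement in the Pauli
bases `Q`. -/
noncomputable def recordObs (Q : Λ → Pauli) (F : (Λ → ZMod 2) → ℂ) : Op Λ :=
  ∑ s, F s • pauliRecord Q ∅ s fun _ => 1

theorem pauliRecord_mul (s s' : Λ → ZMod 2) :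
    pauliRecord Q ∅ s (fun _ => 1) * pauliRecord Q ∅ s' (fun _ => 1) =
      if s = s' then pauliRecord Q ∅ s fun _ => 1 else 0 := by
  simp only [pauliRecord, tensor_mul, Set.mem_empty_iff_false, if_false, axisProj_mul]
  split_ifs with h
  · subst h; simp
  · obtain ⟨i, hi⟩ := Function.ne_iff.1 h
    ext x y
    rw [tensor_apply, Finset.prod_eq_zero (Finset.mem_univ i)]
    · rfl
    · simp [hi]

theorem recordObs_mul (F F' : (Λ → ZMod 2) → ℂ) :
    recordObs Q F * recordObs Q F' = recordObs Q (F * F') := by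
  simp only [recordObs, Finset.sum_mul, Finset.mul_sum, Matrix.smul_mul, Matrix.mul_smul,
    pauliRecord_mul, smul_ite, smul_zero, Finset.sum_ite_eq', Finset.mem_univ, if_true, smul_smul,
    Pi.mul_apply, mul_comm]

theorem recordObs_one : recordObs Q 1 = 1 := by
  simp only [recordObs, pauliRecord, Pi.one_apply, one_smul, Set.mem_empty_iff_false, if_false]
  rw [sum_tensor fun i a => axisProj (Q i) a]
  simp only [sum_axisProj, tensor_one]

theorem recordObs_add (F F' : (Λ → ZMod 2) → ℂ) :
    recordObs Q (F + F') = recordObs Q F + recordObs Q F' := by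
  simp [recordObs, add_smul, Finset.sum_add_distrib]

theorem recordObs_smul (c : ℂ) (F : (Λ → ZMod 2) → ℂ) :
    recordObs Q (c • F) = c • recordObs Q F := by
  simp [recordObs, Finset.smul_sum, smul_smul]

theorem recordObs_list_prod (l : List ((Λ → ZMod 2) → ℂ)) :
    (l.map (recordObs Q)).prod = recordObs Q l.prod := by
  induction l with
  | nil => simp [recordObs_one]
  | cons F l ih => rw [List.map_cons, List.prod_cons, ih, recordObs_mul, List.prod_cons]

theorem recordObs_trace (hQ : ∀ i, Q i ≠ .I) (F : (Λ → ZMod 2) → ℂ) :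
    (recordObs Q F).trace = ∑ s, F s := by
  simp [recordObs, trace_sum, pauliRecord, tensor_trace, axisProj_trace (hQ _)]

theorem T_eq_recordObs (hQ : IsAxis S H Q) {g : G m} (hg : g ∈ H) :
    S.T H g = recordObs Q fun s => sgn (∑ i, S.bit i g * s i) := by
  rw [recordObs, S.T_eq, pauliTensor]
  simp only [sgn_sum, pauliRecord, ← tensor_smul, Set.mem_empty_iff_false, if_false]
  rw [sum_tensor fun i a => sgn (S.bit i g * a) • axisProj (Q i) a]
  simp [hQ.sum_sgn (Or.inr hg), Setting.tlab, hg]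

/-- The logical bits that are computed from a complete record. -/
noncomputable def logicalBits (S : Setting m Λ) {r : ℕ} (b : Fin r → G m) (s : Λ → ZMod 2)
    (j : Fin r) : ZMod 2 :=
  ∑ i, S.bit i (b j) * s i

theorem half_one_add_sgn (a b : ZMod 2) :
    (1 / 2 : ℂ) * (1 + sgn a * sgn b) = if b = a then 1 else 0 := by
  rcases zmod_two_cases a with rfl | rfl <;> rcases zmod_two_cases b with rfl | rfl <;>
    norm_num [sgn_zero, sgn_one]

open Classical in
theorem logicalProj_eq_recordObs (hQ : IsAxis S H Q)
    (b : Module.Basis (Fin (Module.finrank (ZMod 2) H)) (ZMod 2) H)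
    (z : Fin (Module.finrank (ZMod 2) H) → ZMod 2) :
    S.logicalProj H b z = recordObs Q fun s =>
      if logicalBits S (fun j => (b j : G m)) s = z then 1 else 0 := by
  have h1 : ∀ j, (1 / 2 : ℂ) • (1 + sgn (z j) • S.T H (b j : G m)) =
      recordObs Q fun s => if logicalBits S (fun j => (b j : G m)) s j = z j then 1 else 0 := by
    intro j
    rw [T_eq_recordObs hQ (b j).2, ← recordObs_one (Q := Q), ← recordObs_smul, ← recordObs_add,
      ← recordObs_smul]
    congr 1
    ext s
    simp only [Pi.smul_apply, Pi.add_apply, Pi.one_apply, smul_eq_mul, half_one_add_sgn]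
    rfl
  have h2 := recordObs_list_prod (Q := Q) (List.ofFn fun j => fun s : Λ → ZMod 2 =>
    if logicalBits S (fun j => (b j : G m)) s j = z j then (1 : ℂ) else 0)
  rw [List.map_ofFn] at h2
  rw [Setting.logicalProj]
  simp only [h1]
  refine h2.trans ?_
  congr 1
  ext s
  rw [List.prod_ofFn, Finset.prod_apply, Finset.prod_ite_zero]
  simp [funext_iff]

open Classical in
theorem sum_pauliRecord_bits (hQ : IsAxis S H Q)
    (b : Module.Basis (Fin (Module.finrank (ZMod 2) H)) (ZMod 2) H)
    (z : Fin (Module.finrank (ZMod 2) H) → ZMod 2) :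
    ∑ s : Λ → ZMod 2 with logicalBits S (fun j => (b j : G m)) s = z,
      pauliRecord Q ∅ s (fun _ => 1) = S.logicalProj H b z := by
  rw [logicalProj_eq_recordObs hQ, recordObs, Finset.sum_filter]
  refine Finset.sum_congr rfl fun s _ => ?_
  split_ifs <;> simp

end Measurement

/-! ### Adaptive measurements -/

section Order

/-- A finite set that is mapped injectively to a linear order can be enumerated in that order. -/
theorem exists_enumeration {Λ K : Type} [Fintype Λ] [LinearOrder K] (key : Λ → K) :
    ∃ ord : Λ → ℕ, ∀ i j, key i < key j → ord i < ord j := by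
  classical
  refine ⟨fun i => (Finset.univ.filter fun j => key j < key i).card, fun i j hij => ?_⟩
  refine Finset.card_lt_card (Finset.ssubset_iff_of_subset ?_ |>.2 ⟨i, ?_, ?_⟩)
  · intro l hl
    simp only [Finset.mem_filter, Finset.mem_univ, true_and] at hl ⊢
    exact hl.trans hij
  · simpa using hij
  · simp

/-- An order of measurements from left to right, with the right boundary coming last and the sites
of `A`, which are in different columns, coming last in their columns. -/
theorem exists_measurement_order {m : ℕ} {Λ : Type} [Fintype Λ] [DecidableEq Λ] (S : Setting m Λ)
    {A : Set Λ} (hAB : A ⊆ S.B) (hA : ∀ i ∈ A, ∀ j ∈ A, S.pos i 0 = S.pos j 0 → i = j) :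
    ∃ ord : Λ → ℕ, Function.Injective ord ∧ (∀ i j, i ∉ S.R → j ∈ S.R → ord i < ord j) ∧
      ∀ k ∈ A, ∀ i, i ≠ k → S.pos i 0 ≤ S.pos k 0 → ord i < ord k := by
  classical
  let e := Fintype.equivFin Λ
  let key : Λ → ℕ ×ₗ ℝ ×ₗ ℕ ×ₗ Fin (Fintype.card Λ) := fun i =>
    toLex (if i ∈ S.R then 1 else 0, toLex (S.pos i 0, toLex (if i ∈ A then 1 else 0, e i)))
  obtain ⟨ord, hord⟩ := exists_enumeration key
  have hkey : Function.Injective key := fun i j h => by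
    have h1 := congrArg (fun x => (ofLex (ofLex (ofLex x).2).2).2) h
    exact e.injective h1
  refine ⟨ord, fun i j h => ?_, fun i j hi hj => hord i j ?_, fun k hk i hik hpos => hord i k ?_⟩
  · by_contra hij
    rcases lt_or_gt_of_ne (hkey.ne hij) with h1 | h1
    · exact (hord i j h1).ne h
    · exact (hord j i h1).ne' h
  · simp only [key, Prod.Lex.toLex_lt_toLex, hi, hj, if_true, if_false]
    exact Or.inl zero_lt_one
  · have hkR : k ∉ S.R := S.notMem_R_of_mem_B (hAB hk)
    have hiR : i ∉ S.R := fun h => (S.bulk_lt_right k (hAB hk) i h).not_ge hpos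
    simp only [key, Prod.Lex.toLex_lt_toLex, hkR, hiR, if_false, lt_irrefl, false_or, true_and]
    rcases hpos.lt_or_eq with h | h
    · exact Or.inl h
    · have hiA : i ∉ A := fun hi => hik (hA i hi k hk h)
      exact Or.inr ⟨h, Or.inl (by simp [hiA, hk])⟩

end Order

section Tilt

variable {m : ℕ} {Λ : Type} [Fintype Λ] [DecidableEq Λ] {S : Setting m Λ}
  {H : Submodule (ZMod 2) (G m)} {Q : Λ → Pauli}

namespace RotStep

variable (S H) in
open Classical in
/-- The parity of the outcomes to the left of a step that determines the sign of its angle: the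
byproduct operators there that do not commute with the rotation. -/
noncomputable def parity (x : RotStep m Λ) (s : Λ → ZMod 2) : ZMod 2 :=
  ∑ i, if i ≠ x.site ∧ S.pos i 0 ≤ S.pos x.site 0 ∧ (i ∈ S.B ∨ x.elt ∈ H) then
    S.bit i x.elt * s i else 0

variable (S H) in
/-- The single-qubit rotation by which the measured observable is tilted. -/
noncomputable def tilt (x : RotStep m Λ) (s : Λ → ZMod 2) : Matrix (Fin 2) (Fin 2) ℂ :=
  (Real.cos x.angle : ℂ) • 1 -
    (Complex.I * Real.sin x.angle * sgn (x.parity S H s)) • x.pauli.mat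

theorem tilt_eq_rot (x : RotStep m Λ) (s : Λ → ZMod 2) :
    ∃ α, x.tilt S H s = rot x.pauli.mat α := by
  rcases zmod_two_cases (x.parity S H s) with h | h
  · exact ⟨x.angle, by rw [tilt, rot, h, sgn_zero, mul_one]⟩
  · refine ⟨-x.angle, ?_⟩
    rw [tilt, rot, h, sgn_one, Real.cos_neg, Real.sin_neg]
    push_cast
    congr 2
    ring

theorem tilt_conjTranspose_mul (x : RotStep m Λ) (s : Λ → ZMod 2) :
    (x.tilt S H s)ᴴ * x.tilt S H s = 1 := by
  obtain ⟨α, h⟩ := x.tilt_eq_rot (S := S) (H := H) s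
  rw [h, rot_conjTranspose x.pauli.mat_conjTranspose, rot_neg_mul_rot x.pauli.mat_mul_self]

theorem tilt_mul_conjTranspose (x : RotStep m Λ) (s : Λ → ZMod 2) :
    x.tilt S H s * (x.tilt S H s)ᴴ = 1 := by
  obtain ⟨α, h⟩ := x.tilt_eq_rot (S := S) (H := H) s
  rw [h, rot_conjTranspose x.pauli.mat_conjTranspose, rot_mul_rot_neg x.pauli.mat_mul_self]

variable (S H Q) in
/-- The observables measured at the sites: tilted Pauli operators at the sites of the steps, and
Pauli operators at the other sites. -/
noncomputable def tiltedObs : List (RotStep m Λ) → Λ → (Λ → ZMod 2) → Matrix (Fin 2) (Fin 2) ℂ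
  | [], i, _ => (Q i).mat
  | x :: ℓ, i, s =>
    if i = x.site then (x.tilt S H s)ᴴ * (Q i).mat * x.tilt S H s else tiltedObs ℓ i s

theorem tiltedObs_of_ne {ℓ : List (RotStep m Λ)} {i : Λ} (h : ∀ x ∈ ℓ, i ≠ x.site)
    (s : Λ → ZMod 2) : tiltedObs S H Q ℓ i s = (Q i).mat := by
  induction ℓ with
  | nil => rfl
  | cons x ℓ ih =>
    rw [tiltedObs, if_neg (h x List.mem_cons_self)]
    exact ih fun y hy => h y (List.mem_cons_of_mem x hy)

theorem tiltedObs_cases (ℓ : List (RotStep m Λ)) (i : Λ) :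
    (∀ s, tiltedObs S H Q ℓ i s = (Q i).mat) ∨ ∃ x ∈ ℓ, i = x.site ∧
      ∀ s, tiltedObs S H Q ℓ i s = (x.tilt S H s)ᴴ * (Q i).mat * x.tilt S H s := by
  induction ℓ with
  | nil => exact Or.inl fun s => rfl
  | cons x ℓ ih =>
    by_cases hi : i = x.site
    · exact Or.inr ⟨x, List.mem_cons_self, hi, fun s => by rw [tiltedObs, if_pos hi]⟩
    · simp only [tiltedObs, if_neg hi]
      rcases ih with ih | ⟨y, hy, ih⟩
      · exact Or.inl ih
      · exact Or.inr ⟨y, List.mem_cons_of_mem x hy, ih⟩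

variable (S H Q) in
/-- The adaptive protocol in which tilted Pauli operators are measured at the sites of the steps,
and Pauli operators at the other sites. -/
noncomputable def protocol (hQ : ∀ i, Q i ≠ .I) (ℓ : List (RotStep m Λ)) (ord : Λ → ℕ)
    (hord : Function.Injective ord)
    (h : ∀ x ∈ ℓ, ∀ i, i ≠ x.site → S.pos i 0 ≤ S.pos x.site 0 → ord i < ord x.site) :
    Protocol Λ where
  order := ord
  order_injective := hord
  obs := tiltedObs S H Q ℓ
  isHermitian i s := by
    rcases tiltedObs_cases (S := S) (H := H) (Q := Q) ℓ i with h | ⟨x, -, -, h⟩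
    · rw [h]; exact (Q i).mat_isHermitian
    · rw [h]; exact isHermitian_conjTranspose_mul_mul _ (Q i).mat_isHermitian
  sq_eq_one i s := by
    rcases tiltedObs_cases (S := S) (H := H) (Q := Q) ℓ i with h | ⟨x, -, -, h⟩
    · rw [h, (Q i).mat_mul_self]
    · rw [h]
      calc _ = (x.tilt S H s)ᴴ * ((Q i).mat * (x.tilt S H s * (x.tilt S H s)ᴴ) * (Q i).mat) *
            x.tilt S H s := by simp only [mul_assoc]
        _ = 1 := by
          rw [tilt_mul_conjTranspose, mul_one, (Q i).mat_mul_self, mul_one, tilt_conjTranspose_mul]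
  trace_eq_zero i s := by
    rcases tiltedObs_cases (S := S) (H := H) (Q := Q) ℓ i with h | ⟨x, -, -, h⟩
    · rw [h, Pauli.trace_mat (hQ i)]
    · rw [h, trace_mul_comm, ← mul_assoc, tilt_mul_conjTranspose, one_mul, Pauli.trace_mat (hQ i)]
  adaptive i s s' hs := by
    rcases tiltedObs_cases (S := S) (H := H) (Q := Q) ℓ i with h' | ⟨x, hx, rfl, h'⟩
    · rw [h', h']
    · have hp : x.parity S H s = x.parity S H s' := by
        classical
        refine Finset.sum_congr rfl fun i _ => ?_
        split_ifs with hi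
        · rw [hs i (h x hx i hi.1 hi.2.1)]
        · rfl
      rw [h', h', tilt, tilt, hp]

/-- The site at which `g` is localized by a nontrivial commutation sign is not acted on by `g`. -/
theorem u_site (hQ : IsAxis S H Q) {x : RotStep m Λ} (hx : x.site ∈ S.B)
    (hx' : S.Localizes x.site x.elt x.pauli) (hκ : ∃ g', S.κ x.elt g' = 1) :
    S.u x.site x.elt = .I := by
  obtain ⟨g', hg'⟩ := hκ
  have h1 : csgn (S.u x.site g') x.pauli = 1 := by
    rw [← hg']; exact csgn_eq_of_mul_eq (hx' g')
  have h2 : csgn (S.u x.site x.elt) x.pauli = 0 := by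
    rw [← S.κ_self x.elt]; exact csgn_eq_of_mul_eq (hx' x.elt)
  rcases (hQ x.site).2 x.elt (Or.inl hx) with h | h
  · exact h
  · rcases (hQ x.site).2 g' (Or.inl hx) with h' | h'
    · rw [h', csgn_I_left] at h1
      exact absurd h1 zero_ne_one
    · rw [h', ← h, h2] at h1
      exact absurd h1 zero_ne_one

theorem pauliRecord_mul_R_mul_T (hQ : IsAxis S H Q) {x : RotStep m Λ} (hx : x.site ∈ S.B)
    (hx' : S.Localizes x.site x.elt x.pauli) (hκ : ∃ g', S.κ x.elt g' = 1) {A : Set Λ}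
    (hA : A ⊆ S.R) (s : Λ → ZMod 2) (q : Λ → Matrix (Fin 2) (Fin 2) ℂ) :
    pauliRecord Q A s q * (x.R S * S.T H x.elt) =
      sgn (x.parity S H s) • (pauliRecord Q A s q * single x.site x.pauli.mat) := by
  classical
  rw [R, S.Rop_eq, S.T_eq, pauliTensor, pauliTensor, tensor_mul, pauliRecord, tensor_mul, single,
    tensor_mul, parity, sgn_sum, ← tensor_smul]
  congr 1; ext1 i
  by_cases hi : i = x.site
  · subst hi
    have hL : x.site ∉ S.L := fun h => S.notMem_B_of_mem_L h hx
    simp [Setting.rlab, Setting.tlab, hL, u_site hQ hx hx' hκ, Pauli.mat_I, sgn_zero]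
  by_cases hpos : S.pos x.site 0 < S.pos i 0
  · have hL : i ∉ S.L := fun h => (S.left_lt_bulk i h x.site hx).not_gt hpos
    simp [Setting.rlab, Setting.tlab, hL, hi, hpos, hpos.not_ge, Pauli.mat_mul_self, sgn_zero]
  · have hR : i ∉ S.R := fun h => hpos (S.bulk_lt_right x.site hx i h)
    have hiA : i ∉ A := fun h => hR (hA h)
    by_cases hL : i ∈ S.L ∧ x.elt ∉ H
    · have hB := S.notMem_B_of_mem_L hL.1
      simp [Setting.rlab, Setting.tlab, hL, hi, hpos, hB, Pauli.mat_I, sgn_zero]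
    · have hBH : i ∈ S.B ∨ x.elt ∈ H := by
        rcases S.mem_cases i with h | h | h
        · exact Or.inr (by_contra fun h' => hL ⟨h, h'⟩)
        · exact Or.inl h
        · exact absurd h hR
      simp [Setting.rlab, Setting.tlab, hL, hi, hpos, hiA, not_lt.1 hpos, hBH, Pauli.mat_I,
        hQ.mat_mul_axisProj hBH]

theorem pauliRecord_mul_unitary (hQ : IsAxis S H Q) {x : RotStep m Λ} (hx : x.site ∈ S.B)
    (hx' : S.Localizes x.site x.elt x.pauli) (hκ : ∃ g', S.κ x.elt g' = 1) {A : Set Λ}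
    (hA : A ⊆ S.R) (s : Λ → ZMod 2) (q : Λ → Matrix (Fin 2) (Fin 2) ℂ) :
    pauliRecord Q A s q * x.unitary S H =
      pauliRecord Q A s q * single x.site (x.tilt S H s) := by
  have h : x.tilt S H s = (Real.cos x.angle : ℂ) • 1 +
      (-(Complex.I * Real.sin x.angle * sgn (x.parity S H s))) • x.pauli.mat := by
    rw [tilt, neg_smul, sub_eq_add_neg]
  rw [h, single_add, single_smul, single_smul, single_one, unitary, rot, mul_sub, Matrix.mul_add,
    Matrix.mul_smul, Matrix.mul_smul, Matrix.mul_smul,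
    pauliRecord_mul_R_mul_T hQ hx hx' hκ hA, smul_smul, neg_smul, sub_eq_add_neg]

theorem unitaries_commute_single {D : ℝ} (hD : 0 < D) {x : RotStep m Λ} {ℓ : List (RotStep m Λ)}
    (hℓ : Admissible S D (x :: ℓ)) (E : Matrix (Fin 2) (Fin 2) ℂ) :
    Commute (single x.site E) (unitaries S H ℓ) := by
  classical
  refine Commute.list_prod_right _ _ fun M hM => ?_
  obtain ⟨y, hy, rfl⟩ := List.mem_map.1 hM
  refine Commute.rot_right ?_ _
  have h1 := hℓ.head_separated y hy
  have h2 : S.pos y.site 0 < S.pos x.site 0 := by linarith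
  have h3 : x.site ≠ y.site := fun h => by simp [h] at h2
  have h4 : x.site ∉ S.L := fun h => S.notMem_B_of_mem_L h (hℓ.mem_bulk x List.mem_cons_self)
  rw [R, S.Rop_eq, S.T_eq, pauliTensor, pauliTensor, tensor_mul, single, commute_iff_eq,
    tensor_mul, tensor_mul]
  congr 1; ext1 i
  by_cases hi : i = x.site
  · subst hi
    simp [Setting.rlab, Setting.tlab, h2, h3, h4, Pauli.mat_mul_self]
  · simp [hi]

/-- The adaptive measurement of tilted Pauli operators is the non-adaptive measurement of Pauli
operators, after the unitaries of the steps. -/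
theorem tensor_tiltedObs (hQ : IsAxis S H Q) {D : ℝ} (hD : 0 < D) {ℓ : List (RotStep m Λ)}
    (hℓ : Admissible S D ℓ) {A : Set Λ} [DecidablePred (· ∈ A)] (hA : A ⊆ S.R) (s : Λ → ZMod 2)
    {q : Λ → Matrix (Fin 2) (Fin 2) ℂ} (hq : ∀ i, (q i)ᴴ = q i) :
    (tensor fun i => if i ∈ A then q i else
      (1 / 2 : ℂ) • (1 + sgn (s i) • tiltedObs S H Q ℓ i s)) =
      (unitaries S H ℓ)ᴴ * pauliRecord Q A s q * unitaries S H ℓ := by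
  induction ℓ with
  | nil =>
    simp only [unitaries, tiltedObs, List.map_nil, List.prod_nil, conjTranspose_one, one_mul,
      mul_one, pauliRecord, axisProj]
    congr 1; ext1 i
    congr
  | cons x ℓ ih =>
    have hx := hℓ.mem_bulk x List.mem_cons_self
    have hx' := hℓ.localizes x List.mem_cons_self
    have hκ := hℓ.not_central x List.mem_cons_self
    set W := unitaries S H ℓ with hW
    set E := x.tilt S H s with hE
    set B₀ := pauliRecord Q A s q with hB₀
    have h1 : B₀ * x.unitary S H = B₀ * single x.site E :=
      pauliRecord_mul_unitary hQ hx hx' hκ hA s q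
    have hB₀h : B₀ᴴ = B₀ := by
      rw [hB₀, pauliRecord, tensor_conjTranspose]
      congr 1; ext1 i
      split_ifs
      · exact hq i
      · exact axisProj_conjTranspose _ _
    have h_conj :
        (x.unitary S H)ᴴ * B₀ * x.unitary S H = single x.site Eᴴ * B₀ * single x.site E := by
      have h2 := congrArg conjTranspose h1
      rw [conjTranspose_mul, conjTranspose_mul, hB₀h, single_conjTranspose] at h2
      rw [mul_assoc, h1, ← mul_assoc, h2]
    have hc : Commute (single x.site E) W := unitaries_commute_single hD hℓ E
    have hc' : Commute (single x.site Eᴴ) Wᴴ := by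
      have h2 := congrArg conjTranspose hc.eq
      rw [conjTranspose_mul, conjTranspose_mul, single_conjTranspose] at h2
      exact h2.symm
    have h2 : unitaries S H (x :: ℓ) = x.unitary S H * W := by simp [unitaries, hW]
    have h3 : (x.unitary S H * W)ᴴ * B₀ * (x.unitary S H * W) =
        single x.site Eᴴ * (Wᴴ * B₀ * W) * single x.site E := by
      calc _ = Wᴴ * ((x.unitary S H)ᴴ * B₀ * x.unitary S H) * W := by
            rw [conjTranspose_mul]; simp only [mul_assoc]
        _ = (Wᴴ * single x.site Eᴴ) * B₀ * (single x.site E * W) := by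
            rw [h_conj]; simp only [mul_assoc]
        _ = _ := by rw [hc.eq, ← hc'.eq]; simp only [mul_assoc]
    rw [h2, h3, ← ih hℓ.tail, single, single, tensor_mul, tensor_mul]
    congr 1; ext1 i
    by_cases hi : i = x.site
    · subst hi
      have hiA : x.site ∉ A := fun h => S.notMem_R_of_mem_B hx (hA h)
      have hne : ∀ y ∈ ℓ, x.site ≠ y.site := fun y hy h => by
        have := hℓ.head_separated y hy
        rw [h] at this
        linarith
      simp only [hiA, if_false, tiltedObs, if_true, tiltedObs_of_ne hne]
      rw [Matrix.mul_smul, Matrix.smul_mul, Matrix.mul_add, Matrix.add_mul, mul_one,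
        tilt_conjTranspose_mul, Matrix.mul_smul, Matrix.smul_mul]
    · simp [hi, tiltedObs]

end RotStep

/-- A logical channel is implemented if its action on the initial logical state cannot be told from
that of the channels of an admissible list of steps by logical observables. -/
theorem implements_of_channels {Φ : Vec Λ} {χ : G m → ZMod 2} {Δ : ℕ} {d : ℝ}
    (hR : IsResource S H Φ χ Δ d) {ℓ : List (RotStep m Λ)}
    (hℓ : RotStep.Admissible S (2 * Δ + d) ℓ) {𝓔 : Op Λ → Op Λ}
    (h𝓔 : ∀ X ∈ Algebra.adjoin ℂ (Set.range (S.T H)),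
      (X * 𝓔 (ketbra Φ)).trace = (X * RotStep.channels S H Φ ℓ (ketbra Φ)).trace) :
    Implements S H Φ 𝓔 := by
  classical
  obtain ⟨Q, hQ⟩ := exists_isAxis hR.sitewise
  have hD : 0 < 2 * Δ + d := by have := hR.d_pos; positivity
  have hsite : ∀ x ∈ ℓ, ∀ y ∈ ℓ, S.pos x.site 0 = S.pos y.site 0 → x.site = y.site := by
    intro x hx y hy
    have : Std.Symm fun x y : RotStep m Λ => S.pos x.site 0 = S.pos y.site 0 → x.site = y.site :=
      ⟨fun x y h h' => (h h'.symm).symm⟩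
    refine List.Pairwise.forall_of_forall (R := fun x y : RotStep m Λ =>
      S.pos x.site 0 = S.pos y.site 0 → x.site = y.site)
      (fun _ _ _ => rfl) (hℓ.separated.imp fun {x y} h h' => ?_) hx hy
    rw [h'] at h
    linarith
  obtain ⟨ord, hinj, hordR, hord⟩ := exists_measurement_order S (A := {i | ∃ x ∈ ℓ, i = x.site})
    (by rintro _ ⟨x, hx, rfl⟩; exact hℓ.mem_bulk x hx)
    (by rintro _ ⟨x, hx, rfl⟩ _ ⟨y, hy, rfl⟩; exact hsite x hx y hy)
  refine ⟨RotStep.protocol S H Q (fun i => (hQ i).1) ℓ ord hinj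
    fun x hx i => hord x.site ⟨x, hx, rfl⟩ i, byproduct S H, hordR, fun g s s' hs => ?_,
    fun g => ?_, fun b => ⟨logicalBits S fun j => (b j : G m), fun z => ?_⟩⟩
  · refine Finset.sum_congr rfl fun i _ => ?_
    split_ifs with hi
    · rw [hs i hi.1]
    · rfl
  · have hrec := fun s => RotStep.tensor_tiltedObs hQ hD hℓ (subset_refl S.R) s
      (q := fun i => (S.u i g).mat) fun i => Pauli.mat_conjTranspose _
    have hX : S.T H g ∈ Algebra.adjoin ℂ (Set.range (S.T H)) := Algebra.subset_adjoin ⟨g, rfl⟩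
    rw [h𝓔 _ hX, ← RotStep.ev_unitaries hR hℓ hX, ← sum_pauliRecord_right hQ g, Finset.mul_sum,
      Finset.sum_mul, ev_sum]
    refine Finset.sum_congr (by ext; simp) fun s _ => ?_
    rw [Matrix.mul_smul, Matrix.smul_mul, ev_smul, ← hrec s]
    rfl
  · have hrec := fun s => RotStep.tensor_tiltedObs hQ hD hℓ (Set.empty_subset S.R) s
      (q := fun _ => 1) fun i => conjTranspose_one
    have hX : S.logicalProj H b z ∈ Algebra.adjoin ℂ (Set.range (S.T H)) := by
      refine Subalgebra.list_prod_mem _ fun M hM => ?_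
      obtain ⟨j, rfl⟩ := (List.mem_ofFn' _ _).1 hM
      exact Subalgebra.smul_mem _ (Subalgebra.add_mem _ (Subalgebra.one_mem _)
        (Subalgebra.smul_mem _ (Algebra.subset_adjoin (Set.mem_range_self _)) _)) _
    rw [h𝓔 _ hX, ← RotStep.ev_unitaries hR hℓ hX, ← sum_pauliRecord_bits hQ b z, Finset.mul_sum,
      Finset.sum_mul, ev_sum]
    refine Finset.sum_congr (by ext; simp) fun s _ => ?_
    rw [← hrec s, Protocol.recordOp]
    congr 2; ext1 i
    simp [Protocol.proj, RotStep.protocol]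

end Tilt

/-! ### Initialization and readout -/

section Init

variable {m : ℕ} {Λ : Type} [Fintype Λ] [DecidableEq Λ] {S : Setting m Λ}
  {H : Submodule (ZMod 2) (G m)} {Q : Λ → Pauli}

theorem IsAxis.bit_add (hQ : IsAxis S H Q) (i : Λ) {g g' : G m} (hg : g ∈ H) (hg' : g' ∈ H) :
    S.bit i (g + g') = S.bit i g + S.bit i g' := by
  obtain ⟨c, hc⟩ := S.exists_mul_eq_smul i g g'
  have hQI := (hQ i).1
  have hc0 : c ≠ 0 := fun h => Pauli.mat_mul_ne_zero _ _ (by rw [hc, h, zero_smul])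
  have key : ∀ p : Pauli, (S.u i g).mat * (S.u i g').mat = p.mat → S.u i (g + g') = p := by
    intro p hp
    refine Pauli.eq_of_mat_eq_smul (c := c⁻¹) ?_
    rw [← hp, hc, smul_smul, inv_mul_cancel₀ hc0, one_smul]
  rcases (hQ i).2 g (Or.inr hg) with h | h <;> rcases (hQ i).2 g' (Or.inr hg') with h' | h'
  · have := key .I (by rw [h, h', Pauli.mat_I, one_mul])
    simp [Setting.bit, h, h', this]
  · have := key (Q i) (by rw [h, h', Pauli.mat_I, one_mul])
    rw [Setting.bit, Setting.bit, Setting.bit, h, h', this, if_pos rfl, zero_add]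
  · have := key (Q i) (by rw [h, h', Pauli.mat_I, mul_one])
    rw [Setting.bit, Setting.bit, Setting.bit, h, h', this, if_pos rfl, add_zero]
  · have := key .I (by rw [h, h', Pauli.mat_mul_self, Pauli.mat_I])
    simp [Setting.bit, h, h', this, hQI, CharTwo.add_self_eq_zero]

/-- On `H`, the exponents of the axis are linear. -/
noncomputable def IsAxis.bitHom (hQ : IsAxis S H Q) (i : Λ) : H →ₗ[ZMod 2] ZMod 2 :=
  AddMonoidHom.toZModLinearMap 2 (AddMonoidHom.mk' (fun h : H => S.bit i (h : G m))
    fun h h' => hQ.bit_add i h.2 h'.2)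

theorem IsAxis.bitHom_apply (hQ : IsAxis S H Q) (i : Λ) (h : H) :
    hQ.bitHom i h = S.bit i (h : G m) := rfl

open Classical in
/-- For independent logical observables, all values of the logical bits occur in the same number of
records. The number is found by Fourier transformation: the nontrivial Fourier modes vanish, since
a nontrivial combination of the logical bits depends on the outcome at some site. -/
theorem two_pow_mul_sum_logicalBits (hQ : IsAxis S H Q) (hU : ∀ h ∈ H, S.U h = 1 → h = 0)
    {r : ℕ} {b : Fin r → H} (hb : LinearIndependent (ZMod 2) b) (z : Fin r → ZMod 2) :
    (2 : ℂ) ^ r * ∑ s : Λ → ZMod 2,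
        (if logicalBits S (fun j => (b j : G m)) s = z then 1 else 0) =
      (2 : ℂ) ^ Fintype.card Λ := by
  have h1 : ∀ s : Λ → ZMod 2,
      (2 : ℂ) ^ r * (if logicalBits S (fun j => (b j : G m)) s = z then 1 else 0) =
        ∑ y : Fin r → ZMod 2, sgn (∑ j, y j * z j) *
          ∏ i, sgn (hQ.bitHom i (∑ j, y j • b j) * s i) := by
    intro s
    have e1 : (2 : ℂ) ^ r * (if logicalBits S (fun j => (b j : G m)) s = z then 1 else 0) =
        ∏ j : Fin r, ∑ a : ZMod 2, sgn (a * (z j + logicalBits S (fun j => (b j : G m)) s j)) := by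
      have e2 : ∀ c e : ZMod 2, ∑ a : ZMod 2, sgn (a * (c + e)) =
          2 * if e = c then (1 : ℂ) else 0 := by
        intro c e
        rw [sum_zmod_two, ← half_one_add_sgn, zero_mul, one_mul, sgn_zero, sgn_add]
        ring
      simp only [e2, Finset.prod_mul_distrib, Finset.prod_const, Finset.card_univ, Fintype.card_fin,
        Finset.prod_ite_zero, one_pow, Finset.mem_univ, forall_const, funext_iff]
    rw [e1, Finset.prod_univ_sum, Fintype.piFinset_univ]
    refine Finset.sum_congr rfl fun y _ => ?_
    rw [← sgn_sum, ← sgn_sum, ← sgn_add]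
    congr 1
    simp only [mul_add, Finset.sum_add_distrib, map_sum, map_smul, IsAxis.bitHom_apply,
      smul_eq_mul, logicalBits, Finset.mul_sum, Finset.sum_mul]
    rw [Finset.sum_comm (f := fun i j => y i * (S.bit j (b i : G m) * s j))]
    simp only [mul_assoc]
  rw [Finset.mul_sum, Finset.sum_congr rfl fun s _ => h1 s, Finset.sum_comm,
    Finset.sum_eq_single 0]
  · simp [sgn_zero, ZMod.card]
  · intro y _ hy
    rw [← Finset.mul_sum]
    refine mul_eq_zero_of_right _ ?_
    have h2 := Finset.prod_univ_sum (fun _ : Λ => (Finset.univ : Finset (ZMod 2)))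
      fun i a => sgn (hQ.bitHom i (∑ j, y j • b j) * a)
    rw [Fintype.piFinset_univ] at h2
    have hne : ∑ j, y j • b j ≠ 0 := fun h => hy (funext (Fintype.linearIndependent_iff.1 hb y h))
    have hi : ∃ i, hQ.bitHom i (∑ j, y j • b j) ≠ 0 := by
      by_contra! hcon
      refine hne (Subtype.ext (hU _ (Subtype.mem _) ?_))
      rw [Setting.U, ← tensor_one]
      congr 1; ext1 i
      rw [IsAxis.eq_zero_of_bit_eq_zero (hcon i), Pauli.mat_I]
    obtain ⟨i, hi⟩ := hi
    rw [← h2]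
    refine Finset.prod_eq_zero (Finset.mem_univ i) ?_
    rw [(zmod_two_cases _).resolve_left hi, sum_zmod_two, mul_zero, one_mul, sgn_zero, sgn_one,
      add_neg_cancel]
  · simp

theorem initAndReadout {Φ : Vec Λ} {χ : G m → ZMod 2} {Δ : ℕ} {d : ℝ}
    (hR : IsResource S H Φ χ Δ d) : InitAndReadout S H Φ χ := by
  have hT : ∀ h ∈ H, S.T H h *ᵥ Φ = sgn (χ h) • Φ := fun h hh => by
    rw [Setting.T, if_pos hh, hR.symmetric]
  refine ⟨hT, fun g hg => ?_, fun hU b z => ?_, ?_⟩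
  · -- `T(g)` anticommutes with some `T(h)`, of which the state is an eigenvector.
    obtain ⟨h, hh, hκ⟩ := hR.maximal.exists_κ_eq_one hg
    have h1 : (S.T H h)ᴴ * S.T H g * S.T H h = -S.T H g := by
      rw [S.T_conjTranspose, Setting.T_mul_T hR.maximal, hκ, sgn_one, neg_one_smul,
        Matrix.neg_mul, mul_assoc, S.T_mul_self, mul_one]
    have h2 := ev_conj Φ (S.T H h) (S.T H g)
    rw [h1, hT h hh] at h2
    have h3 : ev (sgn (χ h) • Φ) (S.T H g) = ev Φ (S.T H g) := by
      rw [ev, ev, star_smul, smul_dotProduct, mulVec_smul, dotProduct_smul, star_sgn, smul_smul,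
        sgn_mul_self, one_smul]
    rw [h3, ← neg_one_smul ℂ, ev_smul, neg_one_mul] at h2
    exact self_eq_neg.1 h2
  · obtain ⟨Q, hQ⟩ := exists_isAxis hR.sitewise
    rw [logicalProj_eq_recordObs hQ, recordObs_trace fun i => (hQ i).1]
    exact two_pow_mul_sum_logicalBits hQ hU b.linearIndependent z
  · exact implements_of_channels hR (ℓ := []) ⟨by simp, by simp, by simp, by simp, by simp⟩
      fun X _ => rfl

end Init

/-! ### Trace norm and diamond norm estimates -/

section TraceNorm

open scoped ComplexOrder

variable {n : Type} [Fintype n] [DecidableEq n]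

/-- The trace norm of `X` is at most `c`. -/
def TraceBound (X : Matrix n n ℂ) (c : ℝ) : Prop :=
  ∀ U ∈ unitaryGroup n ℂ, ‖(U * X).trace‖ ≤ c

theorem TraceBound.traceNorm_le {X : Matrix n n ℂ} {c : ℝ} (h : TraceBound X c) :
    traceNorm X ≤ c :=
  ciSup_le fun U => h U U.2

theorem TraceBound.add {X Y : Matrix n n ℂ} {a b : ℝ} (hX : TraceBound X a)
    (hY : TraceBound Y b) : TraceBound (X + Y) (a + b) := fun U hU => by
  rw [Matrix.mul_add, trace_add]
  exact (norm_add_le _ _).trans (add_le_add (hX U hU) (hY U hU))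

theorem TraceBound.smul {X : Matrix n n ℂ} {a : ℝ} (c : ℂ) (hX : TraceBound X a) :
    TraceBound (c • X) (‖c‖ * a) := fun U hU => by
  rw [Matrix.mul_smul, trace_smul, norm_smul]
  exact mul_le_mul_of_nonneg_left (hX U hU) (norm_nonneg c)

theorem TraceBound.mono {X : Matrix n n ℂ} {a b : ℝ} (hX : TraceBound X a) (h : a ≤ b) :
    TraceBound X b := fun U hU => (hX U hU).trans h

theorem TraceBound.sum {ι : Type} (s : Finset ι) {X : ι → Matrix n n ℂ} {a : ι → ℝ}
    (h : ∀ i ∈ s, TraceBound (X i) (a i)) : TraceBound (∑ i ∈ s, X i) (∑ i ∈ s, a i) :=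
  fun U hU => by
    rw [Finset.mul_sum, trace_sum]
    exact norm_sum_le_of_le _ fun i hi => h i hi U hU

theorem TraceBound.conj {X : Matrix n n ℂ} {a : ℝ} (hX : TraceBound X a) {V : Matrix n n ℂ}
    (hV : V ∈ unitaryGroup n ℂ) : TraceBound (V * X * Vᴴ) a := fun U hU => by
  have h : (U * (V * X * Vᴴ)).trace = (Vᴴ * U * V * X).trace := by
    rw [← mul_assoc, trace_mul_comm, ← mul_assoc, ← mul_assoc]
  rw [h]
  exact hX _ (mul_mem (mul_mem (Unitary.star_mem hV) hU) hV)

/-- The trace norm of a state is one: for unitary `Y` and a suitable phase `c`, the trace of the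
positive matrix `(1 - cY) ρ (1 - cY)ᴴ` is `2 - 2 |Tr (Y ρ)|`. -/
theorem traceBound_of_posSemidef {ρ : Matrix n n ℂ} (hρ : ρ.PosSemidef) (htr : ρ.trace = 1) :
    TraceBound ρ 1 := by
  intro Y hY
  obtain ⟨c, hc, hcY⟩ : ∃ c : ℂ, star c * c = 1 ∧ c * (Y * ρ).trace = ‖(Y * ρ).trace‖ := by
    by_cases h0 : (Y * ρ).trace = 0
    · exact ⟨1, by simp, by simp [h0]⟩
    · have h1 : (‖(Y * ρ).trace‖ : ℂ) ≠ 0 := by simpa using h0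
      have h2 : star (Y * ρ).trace * (Y * ρ).trace = (‖(Y * ρ).trace‖ : ℂ) ^ 2 :=
        Complex.conj_mul' _
      refine ⟨star (Y * ρ).trace / ‖(Y * ρ).trace‖, ?_, ?_⟩
      · rw [star_div₀, star_star, Complex.star_def, Complex.conj_ofReal,
          div_mul_div_comm, ← Complex.star_def, mul_comm, h2, ← sq, div_self (pow_ne_zero 2 h1)]
      · rw [div_mul_eq_mul_div, h2, sq, mul_div_assoc, div_self h1, mul_one]
  set Z := c • Y with hZ
  have hZZ : Zᴴ * Z = 1 := by
    rw [hZ, conjTranspose_smul, Matrix.smul_mul, Matrix.mul_smul, smul_smul, hc, one_smul]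
    exact mem_unitaryGroup_iff'.1 hY
  have hpos := (hρ.mul_mul_conjTranspose_same (1 - Z)).trace_nonneg
  have e1 : (Z * ρ).trace = ‖(Y * ρ).trace‖ := by
    rw [hZ, Matrix.smul_mul, trace_smul, smul_eq_mul, hcY]
  have e2 : (ρ * Zᴴ).trace = ‖(Y * ρ).trace‖ := by
    have : ρ * Zᴴ = (Z * ρ)ᴴ := by rw [conjTranspose_mul, hρ.1.eq]
    rw [this, trace_conjTranspose, e1, Complex.star_def, Complex.conj_ofReal]
  have e3 : (Z * ρ * Zᴴ).trace = 1 := by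
    rw [trace_mul_comm, ← mul_assoc, hZZ, one_mul, htr]
  rw [conjTranspose_sub, conjTranspose_one, sub_mul, one_mul, mul_sub, mul_one, sub_mul, trace_sub,
    trace_sub, trace_sub, htr, e1, e2, e3] at hpos
  have hre := (Complex.le_def.1 hpos).1
  simp at hre
  linarith

theorem TraceBound.mul_mul {X : Matrix n n ℂ} {a : ℝ} (hX : TraceBound X a) {V W : Matrix n n ℂ}
    (hV : V ∈ unitaryGroup n ℂ) (hW : W ∈ unitaryGroup n ℂ) : TraceBound (V * X * W) a :=
  fun U hU => by
    have h : (U * (V * X * W)).trace = (W * U * V * X).trace := by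
      rw [← mul_assoc, trace_mul_comm, ← mul_assoc, ← mul_assoc]
    rw [h]
    exact hX _ (mul_mem (mul_mem hW hU) hV)

end TraceNorm

section Diamond

open scoped ComplexOrder Kronecker

variable {Λ : Type}

/-- The operator `K ⊗ 1` with an ancilla system of dimension `k`. -/
def withAncilla (k : ℕ) (K : Op Λ) : Matrix ((Λ → Fin 2) × Fin k) ((Λ → Fin 2) × Fin k) ℂ :=
  K ⊗ₖ (1 : Matrix (Fin k) (Fin k) ℂ)

theorem withAncilla_conjTranspose (k : ℕ) (K : Op Λ) : (withAncilla k K)ᴴ = withAncilla k Kᴴ := by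
  rw [withAncilla, withAncilla, conjTranspose_kronecker, conjTranspose_one]

theorem withAncilla_add (k : ℕ) (K L : Op Λ) :
    withAncilla k (K + L) = withAncilla k K + withAncilla k L := add_kronecker _ _ _

theorem withAncilla_smul (k : ℕ) (c : ℂ) (K : Op Λ) :
    withAncilla k (c • K) = c • withAncilla k K := smul_kronecker _ _ _

theorem ampliate_add (k : ℕ) (𝓔 𝓕 : Op Λ → Op Λ)
    (X : Matrix ((Λ → Fin 2) × Fin k) ((Λ → Fin 2) × Fin k) ℂ) :
    ampliate k (fun ρ => 𝓔 ρ + 𝓕 ρ) X = ampliate k 𝓔 X + ampliate k 𝓕 X := rfl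

theorem ampliate_smul (k : ℕ) (c : ℂ) (𝓔 : Op Λ → Op Λ)
    (X : Matrix ((Λ → Fin 2) × Fin k) ((Λ → Fin 2) × Fin k) ℂ) :
    ampliate k (fun ρ => c • 𝓔 ρ) X = c • ampliate k 𝓔 X := rfl

theorem ampliate_sum {ι : Type} (s : Finset ι) (k : ℕ) (𝓔 : ι → Op Λ → Op Λ)
    (X : Matrix ((Λ → Fin 2) × Fin k) ((Λ → Fin 2) × Fin k) ℂ) :
    ampliate k (fun ρ => ∑ i ∈ s, 𝓔 i ρ) X = ∑ i ∈ s, ampliate k (𝓔 i) X := by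
  ext p q
  simp [ampliate, Matrix.sum_apply]

theorem ampliate_comp (k : ℕ) (𝓔 𝓕 : Op Λ → Op Λ)
    (X : Matrix ((Λ → Fin 2) × Fin k) ((Λ → Fin 2) × Fin k) ℂ) :
    ampliate k (𝓔 ∘ 𝓕) X = ampliate k 𝓔 (ampliate k 𝓕 X) := rfl

theorem withAncilla_sum {ι : Type} (s : Finset ι) (k : ℕ) (K : ι → Op Λ) :
    withAncilla k (∑ i ∈ s, K i) = ∑ i ∈ s, withAncilla k (K i) :=
  map_sum (AddMonoidHom.mk' (withAncilla k) (withAncilla_add k)) K s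

variable [Fintype Λ]

theorem withAncilla_one (k : ℕ) : withAncilla k (1 : Op Λ) = 1 := one_kronecker_one

variable [DecidableEq Λ]

theorem withAncilla_mul (k : ℕ) (K L : Op Λ) :
    withAncilla k (K * L) = withAncilla k K * withAncilla k L := by
  rw [withAncilla, withAncilla, withAncilla, ← mul_kronecker_mul, one_mul]

theorem withAncilla_mem_unitaryGroup (k : ℕ) {K : Op Λ} (hK : K ∈ unitaryGroup (Λ → Fin 2) ℂ) :
    withAncilla k K ∈ unitaryGroup ((Λ → Fin 2) × Fin k) ℂ := by
  rw [mem_unitaryGroup_iff, star_eq_conjTranspose, withAncilla_conjTranspose, ← withAncilla_mul,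
    ← star_eq_conjTranspose, mem_unitaryGroup_iff.1 hK, withAncilla_one]

theorem ampliate_mul_mul (k : ℕ) (K L : Op Λ)
    (X : Matrix ((Λ → Fin 2) × Fin k) ((Λ → Fin 2) × Fin k) ℂ) :
    ampliate k (fun ρ => K * ρ * L) X = withAncilla k K * X * withAncilla k L := by
  ext p q
  simp only [ampliate, withAncilla, of_apply, mul_apply, Fintype.sum_prod_type, kroneckerMap_apply,
    one_apply, mul_ite, mul_one, mul_zero, ite_mul, zero_mul, Finset.sum_ite_eq, Finset.mem_univ,
    if_true, Finset.sum_ite_eq']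

/-- The map, with an ancilla system of any dimension, sends states to states. -/
def StatePreserving (𝓔 : Op Λ → Op Λ) : Prop :=
  ∀ (k : ℕ) (ρ : Matrix ((Λ → Fin 2) × Fin k) ((Λ → Fin 2) × Fin k) ℂ),
    ρ.PosSemidef → ρ.trace = 1 → (ampliate k 𝓔 ρ).PosSemidef ∧ (ampliate k 𝓔 ρ).trace = 1

theorem statePreserving_of_kraus {r : ℕ} {K : Fin r → Op Λ} (hK : ∑ j, (K j)ᴴ * K j = 1)
    {𝓔 : Op Λ → Op Λ} (h𝓔 : ∀ ρ, 𝓔 ρ = ∑ j, K j * ρ * (K j)ᴴ) : StatePreserving 𝓔 := by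
  intro k ρ hρ htr
  have h : ampliate k 𝓔 ρ = ∑ j, withAncilla k (K j) * ρ * (withAncilla k (K j))ᴴ := by
    rw [show 𝓔 = fun ρ => ∑ j, K j * ρ * (K j)ᴴ from funext h𝓔, ampliate_sum]
    simp only [ampliate_mul_mul, withAncilla_conjTranspose]
  rw [h]
  constructor
  · exact posSemidef_sum _ fun j _ => hρ.mul_mul_conjTranspose_same _
  · rw [trace_sum]
    have h1 : ∀ j, (withAncilla k (K j) * ρ * (withAncilla k (K j))ᴴ).trace =
        (withAncilla k ((K j)ᴴ * K j) * ρ).trace := by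
      intro j
      rw [trace_mul_comm, ← mul_assoc, withAncilla_conjTranspose, ← withAncilla_mul]
    rw [Finset.sum_congr rfl fun j _ => h1 j, ← trace_sum, ← Finset.sum_mul, ← withAncilla_sum, hK,
      withAncilla_one, one_mul, htr]

/-- The diamond-norm distance is at most `ε`. -/
def DiamondBound (𝓔 𝓕 : Op Λ → Op Λ) (ε : ℝ) : Prop :=
  ∀ (k : ℕ) (ρ : Matrix ((Λ → Fin 2) × Fin k) ((Λ → Fin 2) × Fin k) ℂ),
    ρ.PosSemidef → ρ.trace = 1 → TraceBound (ampliate k 𝓔 ρ - ampliate k 𝓕 ρ) ε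

theorem DiamondBound.diamondDistLE {𝓔 𝓕 : Op Λ → Op Λ} {ε : ℝ} (h : DiamondBound 𝓔 𝓕 ε) :
    DiamondDistLE 𝓔 𝓕 ε := fun k ρ hρ htr => (h k ρ hρ htr).traceNorm_le

theorem DiamondBound.trans {𝓔 𝓕 𝓖 : Op Λ → Op Λ} {ε δ : ℝ} (h : DiamondBound 𝓔 𝓕 ε)
    (h' : DiamondBound 𝓕 𝓖 δ) : DiamondBound 𝓔 𝓖 (ε + δ) := fun k ρ hρ htr => by
  rw [← sub_add_sub_cancel _ (ampliate k 𝓕 ρ)]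
  exact (h k ρ hρ htr).add (h' k ρ hρ htr)

/-- Errors add up under composition with a unitary channel. -/
theorem DiamondBound.comp_conj {𝓔 𝓕 𝓔' : Op Λ → Op Λ} {V : Op Λ} {ε δ : ℝ}
    (h : DiamondBound 𝓔 𝓕 ε) (h𝓔 : StatePreserving 𝓔) (hV : V ∈ unitaryGroup (Λ → Fin 2) ℂ)
    (h' : DiamondBound 𝓔' (fun ρ => V * ρ * Vᴴ) δ) :
    DiamondBound (𝓔' ∘ 𝓔) (fun ρ => V * 𝓕 ρ * Vᴴ) (δ + ε) := fun k ρ hρ htr => by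
  obtain ⟨hρ', htr'⟩ := h𝓔 k ρ hρ htr
  have h1 : ampliate k (fun ρ => V * 𝓕 ρ * Vᴴ) ρ =
      ampliate k (fun ρ => V * ρ * Vᴴ) (ampliate k 𝓕 ρ) := rfl
  rw [ampliate_comp, h1, ← sub_add_sub_cancel _ (ampliate k (fun ρ => V * ρ * Vᴴ) (ampliate k 𝓔 ρ))]
  refine (h' k _ hρ' htr').add ?_
  rw [ampliate_mul_mul, ampliate_mul_mul, ← sub_mul, ← mul_sub, ← withAncilla_conjTranspose]
  exact (h k ρ hρ htr).conj (withAncilla_mem_unitaryGroup k hV)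

/-- Conjugations with unitaries are close to each other if the difference of the unitaries is a
combination of unitaries with small coefficients. -/
theorem diamondBound_conj {ι : Type} [Fintype ι] {V W : Op Λ}
    (hV : V ∈ unitaryGroup (Λ → Fin 2) ℂ) (hW : W ∈ unitaryGroup (Λ → Fin 2) ℂ) {c : ι → ℂ}
    {P : ι → Op Λ} (hP : ∀ i, P i ∈ unitaryGroup (Λ → Fin 2) ℂ) (h : V - W = ∑ i, c i • P i) :
    DiamondBound (fun ρ => V * ρ * Vᴴ) (fun ρ => W * ρ * Wᴴ) (2 * ∑ i, ‖c i‖) := by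
  intro k ρ hρ htr
  have hT := traceBound_of_posSemidef hρ htr
  have hu : ∀ {K : Op Λ}, K ∈ unitaryGroup (Λ → Fin 2) ℂ → Kᴴ ∈ unitaryGroup (Λ → Fin 2) ℂ :=
    fun hK => Unitary.star_mem hK
  have h2 : Vᴴ - Wᴴ = ∑ i, star (c i) • (P i)ᴴ := by
    rw [← conjTranspose_sub, h, conjTranspose_sum]
    simp only [conjTranspose_smul]
  have h3 : withAncilla k V - withAncilla k W = ∑ i, c i • withAncilla k (P i) := by
    have : withAncilla k V = withAncilla k (V - W) + withAncilla k W := by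
      rw [← withAncilla_add, sub_add_cancel]
    rw [this, add_sub_cancel_right, h, withAncilla_sum]
    simp only [withAncilla_smul]
  have h4 : withAncilla k Vᴴ - withAncilla k Wᴴ = ∑ i, star (c i) • withAncilla k (P i)ᴴ := by
    have : withAncilla k Vᴴ = withAncilla k (Vᴴ - Wᴴ) + withAncilla k Wᴴ := by
      rw [← withAncilla_add, sub_add_cancel]
    rw [this, add_sub_cancel_right, h2, withAncilla_sum]
    simp only [withAncilla_smul]
  have h5 : withAncilla k V * ρ * withAncilla k Vᴴ - withAncilla k W * ρ * withAncilla k Wᴴ =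
      ∑ i, c i • (withAncilla k (P i) * ρ * withAncilla k Vᴴ) +
        ∑ i, star (c i) • (withAncilla k W * ρ * withAncilla k (P i)ᴴ) := by
    have e1 : withAncilla k V * ρ * withAncilla k Vᴴ - withAncilla k W * ρ * withAncilla k Wᴴ =
        (withAncilla k V - withAncilla k W) * ρ * withAncilla k Vᴴ +
          withAncilla k W * ρ * (withAncilla k Vᴴ - withAncilla k Wᴴ) := by
      rw [sub_mul, sub_mul, mul_sub]; abel
    rw [e1, h3, h4, Finset.sum_mul, Finset.sum_mul, Finset.mul_sum]
    simp only [Matrix.smul_mul, Matrix.mul_smul]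
  rw [ampliate_mul_mul, ampliate_mul_mul, h5]
  have b1 := TraceBound.sum Finset.univ fun i (_ : i ∈ Finset.univ) => (hT.mul_mul
    (withAncilla_mem_unitaryGroup k (hP i)) (withAncilla_mem_unitaryGroup k (hu hV))).smul (c i)
  have b2 := TraceBound.sum Finset.univ fun i (_ : i ∈ Finset.univ) => (hT.mul_mul
    (withAncilla_mem_unitaryGroup k hW) (withAncilla_mem_unitaryGroup k (hu (hP i)))).smul
      (star (c i))
  refine (b1.add b2).mono (le_of_eq ?_)
  simp only [mul_one, norm_star, two_mul]

theorem abs_sub_sin_le_sq (x : ℝ) : |x - Real.sin x| ≤ x ^ 2 := by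
  have key : ∀ x : ℝ, 0 < x → |x - Real.sin x| ≤ x ^ 2 := by
    intro x hx
    rw [abs_of_pos (sub_pos.2 (Real.sin_lt hx))]
    rcases le_or_gt x 1 with h1 | h1
    · have h2 := Real.sin_gt_sub_cube hx
      nlinarith [mul_pos hx hx, mul_pos (mul_pos hx hx) hx]
    · rcases le_or_gt x 2 with h2 | h2
      · have h3 := Real.sin_pos_of_pos_of_lt_pi hx (by linarith [Real.pi_gt_three])
        nlinarith
      · have h3 := Real.neg_one_le_sin x
        nlinarith
  rcases lt_trichotomy x 0 with h | rfl | h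
  · have h1 := key (-x) (neg_pos.2 h)
    rwa [Real.sin_neg, neg_sub_neg, abs_sub_comm, neg_sq] at h1
  · simp
  · exact key x h

/-- A random rotation with small angle `α` and bias `σ` is, up to terms of second order, the
rotation by the angle `σ α`. -/
theorem diamondBound_randomRot {t : Op Λ} (ht : tᴴ = t) (htt : t * t = 1) {σ : ℝ}
    (hσ : |σ| ≤ 1) (α : ℝ) :
    DiamondBound (randomRot t σ α) (fun ρ => rot t (σ * α) * ρ * (rot t (σ * α))ᴴ)
      (10 * α ^ 2) := by
  set φ := σ * α with hφ
  have htu : t ∈ unitaryGroup (Λ → Fin 2) ℂ := by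
    rw [mem_unitaryGroup_iff, star_eq_conjTranspose, ht, htt]
  intro k ρ hρ htr
  have hT := traceBound_of_posSemidef hρ htr
  have htk := withAncilla_mem_unitaryGroup k htu
  have h1k := one_mem (unitaryGroup ((Λ → Fin 2) × Fin k) ℂ)
  have e1 : ∀ s a : ℝ, ampliate k (randomRot t s a) ρ =
      ((Real.cos a : ℂ) ^ 2) • ρ +
      ((Real.sin a : ℂ) ^ 2) • (withAncilla k t * ρ * withAncilla k t) +
      (s * (Complex.I * Real.sin a * Real.cos a)) • (1 * ρ * withAncilla k t) +
      (-(s * (Complex.I * Real.sin a * Real.cos a))) • (withAncilla k t * ρ * 1) := by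
    intro s a
    have h1 : randomRot t s a = fun ρ => ((Real.cos a : ℂ) ^ 2) • (1 * ρ * 1) +
        ((Real.sin a : ℂ) ^ 2) • (t * ρ * t) +
        (s * (Complex.I * Real.sin a * Real.cos a)) • (1 * ρ * t) +
        (-(s * (Complex.I * Real.sin a * Real.cos a))) • (t * ρ * 1) := by
      funext ρ
      rw [randomRot_eq, smul_sub, one_mul, mul_one, mul_one, neg_smul]
      abel
    rw [h1]
    simp only [ampliate_add, ampliate_smul, ampliate_mul_mul, withAncilla_one]
    rw [one_mul, mul_one]
  have e2 : (fun ρ => rot t φ * ρ * (rot t φ)ᴴ) = randomRot t 1 φ := by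
    funext ρ
    rw [randomRot, rot_conjTranspose ht]
    norm_num
  set b : ℂ := σ * (Complex.I * Real.sin α * Real.cos α) -
    (1 : ℝ) * (Complex.I * Real.sin φ * Real.cos φ) with hb
  have e3 : ampliate k (randomRot t σ α) ρ - ampliate k (randomRot t 1 φ) ρ =
      ((Real.cos α : ℂ) ^ 2 - (Real.cos φ : ℂ) ^ 2) • ρ +
      ((Real.sin α : ℂ) ^ 2 - (Real.sin φ : ℂ) ^ 2) • (withAncilla k t * ρ * withAncilla k t) +
      b • (1 * ρ * withAncilla k t) + (-b) • (withAncilla k t * ρ * 1) := by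
    rw [e1, e1, hb]
    module
  rw [e2, e3]
  refine ((((hT.smul _).add ((hT.mul_mul htk htk).smul _)).add ((hT.mul_mul h1k htk).smul _)).add
    ((hT.mul_mul htk h1k).smul _)).mono ?_
  have hφα : φ ^ 2 ≤ α ^ 2 := by
    rw [hφ, mul_pow]
    have : σ ^ 2 ≤ 1 := (sq_le_one_iff_abs_le_one σ).2 hσ
    nlinarith [sq_nonneg α]
  have hsin : ∀ x : ℝ, Real.sin x ^ 2 ≤ x ^ 2 := fun x => sq_le_sq.2 Real.abs_sin_le_abs
  have hd : |Real.sin α ^ 2 - Real.sin φ ^ 2| ≤ α ^ 2 := by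
    rw [abs_le]
    constructor <;> nlinarith [hsin α, hsin φ, sq_nonneg (Real.sin α), sq_nonneg (Real.sin φ)]
  have b1 : ‖(Real.sin α : ℂ) ^ 2 - (Real.sin φ : ℂ) ^ 2‖ ≤ α ^ 2 := by
    have : (Real.sin α : ℂ) ^ 2 - (Real.sin φ : ℂ) ^ 2 =
      ((Real.sin α ^ 2 - Real.sin φ ^ 2 : ℝ) : ℂ) := by push_cast; ring
    rw [this, Complex.norm_real]
    exact hd
  have b2 : ‖(Real.cos α : ℂ) ^ 2 - (Real.cos φ : ℂ) ^ 2‖ ≤ α ^ 2 := by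
    have : (Real.cos α : ℂ) ^ 2 - (Real.cos φ : ℂ) ^ 2 =
      ((-(Real.sin α ^ 2 - Real.sin φ ^ 2) : ℝ) : ℂ) := by
        rw [← Complex.ofReal_pow, ← Complex.ofReal_pow, Real.cos_sq', Real.cos_sq']
        push_cast; ring
    rw [this, Complex.norm_real, norm_neg]
    exact hd
  have b3 : ‖b‖ ≤ 4 * α ^ 2 := by
    have : b = Complex.I * (((σ * Real.sin (2 * α) - Real.sin (2 * φ)) / 2 : ℝ) : ℂ) := by
      rw [hb, Real.sin_two_mul, Real.sin_two_mul]
      push_cast; ring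
    rw [this, norm_mul, Complex.norm_I, one_mul, Complex.norm_real, Real.norm_eq_abs, abs_div,
      abs_two, div_le_iff₀ two_pos]
    have e4 : σ * Real.sin (2 * α) - Real.sin (2 * φ) =
        (2 * φ - Real.sin (2 * φ)) - σ * (2 * α - Real.sin (2 * α)) := by
      rw [hφ]; ring
    rw [e4]
    refine (abs_sub _ _).trans ?_
    rw [abs_mul]
    have h1 := abs_sub_sin_le_sq (2 * φ)
    have h2 := abs_sub_sin_le_sq (2 * α)
    have h3 := mul_le_mul hσ h2 (abs_nonneg _) zero_le_one
    nlinarith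
  rw [norm_neg]
  linarith

end Diamond

/-! ### One-parameter subgroups of compact groups -/

/-- The Lie algebra generated by a set under `i[·,·]` and real linear combinations. -/
inductive LieSpan {A : Type} [Ring A] [Algebra ℂ A] (X : Set A) : A → Prop
  | gen (a : A) (ha : a ∈ X) : LieSpan X a
  | zero : LieSpan X 0
  | add (a b : A) (ha : LieSpan X a) (hb : LieSpan X b) : LieSpan X (a + b)
  | smul (c : ℝ) (a : A) (ha : LieSpan X a) : LieSpan X ((c : ℂ) • a)
  | bracket (a b : A) (ha : LieSpan X a) (hb : LieSpan X b) :
      LieSpan X (Complex.I • (a * b - b * a))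

section OneParameter

open Filter Topology NormedSpace

variable {𝔸 : Type} [NormedRing 𝔸]

theorem norm_pow_sub_pow_le {X Y : 𝔸} {C C' : ℝ} {n : ℕ} (hX : ∀ i, ‖X ^ i‖ ≤ C)
    (hY : ∀ i ≤ n, ‖Y ^ i‖ ≤ C') : ‖X ^ n - Y ^ n‖ ≤ n * (C * C' * ‖X - Y‖) := by
  have hC : 0 ≤ C := (norm_nonneg _).trans (hX 0)
  have key : ∀ k j, k + j ≤ n → ‖(X ^ k - Y ^ k) * Y ^ j‖ ≤ k * (C * C' * ‖X - Y‖) := by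
    intro k
    induction k with
    | zero => intro j _; simp
    | succ k ih =>
      intro j hj
      have h1 : (X ^ (k + 1) - Y ^ (k + 1)) * Y ^ j =
          X ^ k * (X - Y) * Y ^ j + (X ^ k - Y ^ k) * Y ^ (j + 1) := by
        rw [pow_succ X, pow_succ Y k, pow_succ' Y j]
        noncomm_ring
      have h2 : ‖X ^ k * (X - Y) * Y ^ j‖ ≤ C * C' * ‖X - Y‖ := by
        calc _ ≤ ‖X ^ k‖ * ‖X - Y‖ * ‖Y ^ j‖ :=
              (norm_mul_le _ _).trans (mul_le_mul_of_nonneg_right (norm_mul_le _ _) (norm_nonneg _))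
          _ ≤ C * ‖X - Y‖ * C' := by
              gcongr
              · exact hX k
              · exact hY j (by omega)
          _ = _ := by ring
      rw [h1]
      refine (norm_add_le _ _).trans ?_
      have h3 := ih (j + 1) (by omega)
      push_cast
      linarith
  simpa using key n 0 (by omega)

theorem tendsto_inv_natCast_ne_zero :
    Tendsto (fun n : ℕ => ((n : ℂ))⁻¹) atTop (𝓝[≠] 0) := by
  refine tendsto_nhdsWithin_iff.2 ⟨tendsto_inv_atTop_nhds_zero_nat, ?_⟩
  filter_upwards [eventually_gt_atTop 0] with n hn
  simp [hn.ne']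

variable [NormedAlgebra ℂ 𝔸]

/-- The generators of the one-parameter subgroups of a submonoid. -/
def oneParam (K : Submonoid 𝔸) : Set 𝔸 := {x | ∀ r : ℝ, exp ((r : ℂ) • x) ∈ K}

variable {K : Submonoid 𝔸}

theorem zero_mem_oneParam : (0 : 𝔸) ∈ oneParam K := fun r => by
  rw [smul_zero, exp_zero]; exact K.one_mem

theorem smul_mem_oneParam {x : 𝔸} (hx : x ∈ oneParam K) (c : ℝ) : (c : ℂ) • x ∈ oneParam K :=
  fun r => by
    rw [smul_smul, ← Complex.ofReal_mul]
    exact hx _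

/-- The exponential of an involution. -/
theorem exp_smul_eq_rot {t : 𝔸} (ht : t * t = 1) (r : ℝ) :
    exp ((r : ℂ) • -(Complex.I • t)) = rot t r := by
  let := NormedAlgebra.restrictScalars ℚ ℂ 𝔸
  -- `f (x, y) = x p + y q`, where `p` and `q` are the projectors onto the eigenspaces of `t`
  let f : ℂ × ℂ →+* 𝔸 :=
    { toFun := fun z => ((z.1 + z.2) / 2) • (1 : 𝔸) + ((z.1 - z.2) / 2) • t
      map_one' := by simp
      map_zero' := by simp
      map_add' := fun z w => by
        simp only [Prod.fst_add, Prod.snd_add]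
        module
      map_mul' := fun z w => by
        simp only [Prod.fst_mul, Prod.snd_mul, add_mul, mul_add, smul_mul_assoc, mul_smul_comm,
          one_mul, mul_one, ht]
        module }
  have hf : Continuous f := by
    change Continuous fun z : ℂ × ℂ => ((z.1 + z.2) / 2) • (1 : 𝔸) + ((z.1 - z.2) / 2) • t
    fun_prop
  have h1 : (r : ℂ) • -(Complex.I • t) = f (-(Complex.I * r), Complex.I * r) := by
    change _ = ((-(Complex.I * r) + Complex.I * r) / 2) • (1 : 𝔸) +
      ((-(Complex.I * r) - Complex.I * r) / 2) • t
    module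
  rw [h1, ← map_exp f hf]
  change (((exp (-(Complex.I * (r : ℂ)), Complex.I * (r : ℂ))).1 +
    (exp (-(Complex.I * (r : ℂ)), Complex.I * (r : ℂ))).2) / 2) • (1 : 𝔸) +
    (((exp (-(Complex.I * (r : ℂ)), Complex.I * (r : ℂ))).1 -
    (exp (-(Complex.I * (r : ℂ)), Complex.I * (r : ℂ))).2) / 2) • t = _
  rw [Prod.fst_exp, Prod.snd_exp]
  simp only [← Complex.exp_eq_exp_ℂ]
  have h2 : Complex.exp (Complex.I * r) = Complex.cos r + Complex.sin r * Complex.I := by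
    rw [mul_comm, Complex.exp_mul_I]
  have h3 : Complex.exp (-(Complex.I * r)) = Complex.cos r - Complex.sin r * Complex.I := by
    rw [mul_comm, ← neg_mul, Complex.exp_mul_I, Complex.cos_neg, Complex.sin_neg]
    ring
  rw [h2, h3, rot]
  push_cast
  module

/-- In a bounded group, words of bounded length are dense up to `ε`. -/
theorem exists_word_length [FiniteDimensional ℂ 𝔸] {X : Set 𝔸} {C : ℝ}
    (hC : ∀ x ∈ Submonoid.closure X, ‖x‖ ≤ C) {ε : ℝ} (hε : 0 < ε) :
    ∃ n : ℕ, ∀ v ∈ (Submonoid.closure X).topologicalClosure,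
      ∃ l : List 𝔸, l.length ≤ n ∧ (∀ y ∈ l, y ∈ X) ∧ ‖v - l.prod‖ < ε := by
  have : ProperSpace 𝔸 := FiniteDimensional.proper ℂ 𝔸
  have hb : Bornology.IsBounded (Submonoid.closure X : Set 𝔸) :=
    isBounded_iff_forall_norm_le.2 ⟨C, hC⟩
  obtain ⟨t, htX, htfin, hcover⟩ := Metric.finite_approx_of_totallyBounded
    (hb.isCompact_closure.totallyBounded.subset subset_closure) (ε / 2) (half_pos hε)
  have hword : ∀ y : 𝔸, ∃ l : List 𝔸, y ∈ t → (∀ z ∈ l, z ∈ X) ∧ l.prod = y := by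
    intro y
    by_cases hy : y ∈ t
    · obtain ⟨l, hl, hly⟩ := Submonoid.exists_list_of_mem_closure (htX hy)
      exact ⟨l, fun _ => ⟨hl, hly⟩⟩
    · exact ⟨[], fun h => absurd h hy⟩
  choose w hw using hword
  refine ⟨htfin.toFinset.sup fun y => (w y).length, fun v hv => ?_⟩
  have hv' : v ∈ closure (Submonoid.closure X : Set 𝔸) := hv
  obtain ⟨u, hu, huv⟩ := Metric.mem_closure_iff.1 hv' (ε / 2) (half_pos hε)
  obtain ⟨y, hy, hyu⟩ := Set.mem_iUnion₂.1 (hcover hu)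
  obtain ⟨hwX, hwy⟩ := hw y hy
  refine ⟨w y, Finset.le_sup (f := fun y => (w y).length) (htfin.mem_toFinset.2 hy), hwX, ?_⟩
  rw [hwy, ← dist_eq_norm]
  calc dist v y ≤ dist v u + dist u y := dist_triangle _ _ _
    _ < ε := by linarith [Metric.mem_ball.1 hyu]

variable [CompleteSpace 𝔸]

theorem exp_add_smul (x : 𝔸) (a b : ℂ) : exp ((a + b) • x) = exp (a • x) * exp (b • x) := by
  let := NormedAlgebra.restrictScalars ℚ ℂ 𝔸
  rw [add_smul]
  exact exp_add_of_commute (((Commute.refl x).smul_left a).smul_right b)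

theorem exp_smul_mul_exp_neg_smul (x : 𝔸) (a : ℂ) : exp (a • x) * exp ((-a) • x) = 1 := by
  rw [← exp_add_smul, add_neg_cancel, zero_smul, exp_zero]

theorem exp_smul_pow (x : 𝔸) (a : ℂ) (n : ℕ) : exp (a • x) ^ n = exp ((n * a) • x) := by
  induction n with
  | zero => simp [exp_zero]
  | succ n ih =>
    rw [pow_succ, ih, ← exp_add_smul]
    push_cast
    congr 2
    ring

/-- The Lie product formula, under the assumption of bounded powers. -/
theorem tendsto_exp_mul_exp_pow {x y : 𝔸} {C : ℝ}
    (hC : ∀ n i : ℕ, ‖(exp ((n : ℂ)⁻¹ • x) * exp ((n : ℂ)⁻¹ • y)) ^ i‖ ≤ C) :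
    Tendsto (fun n : ℕ => (exp ((n : ℂ)⁻¹ • x) * exp ((n : ℂ)⁻¹ • y)) ^ n) atTop
      (𝓝 (exp (x + y))) := by
  let := NormedAlgebra.restrictScalars ℚ ℂ 𝔸
  let f : ℂ → 𝔸 := fun u => exp (u • x) * exp (u • y) - exp (u • (x + y))
  have hf : HasDerivAt f 0 0 := by
    have h := ((hasDerivAt_exp_smul_const x (0 : ℂ)).mul (hasDerivAt_exp_smul_const y (0 : ℂ))).sub
      (hasDerivAt_exp_smul_const (x + y) (0 : ℂ))
    simp only [zero_smul, exp_zero, one_mul, mul_one, sub_self] at h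
    exact h
  have hf0 : f 0 = 0 := by simp [f, exp_zero]
  have hlim := (hasDerivAt_iff_tendsto_slope_zero.1 hf).comp tendsto_inv_natCast_ne_zero
  obtain ⟨C', hC'⟩ := (isCompact_Icc (a := (0 : ℝ)) (b := 1)).exists_bound_of_continuousOn
    (f := fun u : ℝ => exp ((u : ℂ) • (x + y)))
    (exp_continuous.comp (Complex.continuous_ofReal.smul continuous_const)).continuousOn
  rw [tendsto_iff_norm_sub_tendsto_zero]
  have hlim' := (hlim.norm.const_mul (C * C'))
  rw [norm_zero, mul_zero] at hlim'
  refine squeeze_zero' (Eventually.of_forall fun n => norm_nonneg _) ?_ hlim'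
  filter_upwards [eventually_gt_atTop 0] with n hn
  have hn0 : (n : ℂ) ≠ 0 := by exact_mod_cast hn.ne'
  have hn' : (0 : ℝ) < n := by exact_mod_cast hn
  have hY : ∀ i ≤ n, ‖exp ((n : ℂ)⁻¹ • (x + y)) ^ i‖ ≤ C' := by
    intro i hi
    rw [exp_smul_pow]
    have := hC' ((i : ℝ) * (n : ℝ)⁻¹) ⟨by positivity, by
      rw [← div_eq_mul_inv, div_le_one hn']; exact_mod_cast hi⟩
    simpa using this
  have h := norm_pow_sub_pow_le (hC n) hY
  rw [exp_smul_pow _ _ n, mul_inv_cancel₀ hn0, one_smul] at h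
  refine h.trans (le_of_eq ?_)
  simp only [Function.comp, inv_inv, zero_add, hf0, sub_zero, norm_smul, Complex.norm_natCast, f]
  ring

theorem add_mem_oneParam (hK : IsClosed (K : Set 𝔸)) {C : ℝ} (hC : ∀ x ∈ K, ‖x‖ ≤ C) {x y : 𝔸}
    (hx : x ∈ oneParam K) (hy : y ∈ oneParam K) : x + y ∈ oneParam K := by
  intro r
  have hmem : ∀ n i : ℕ,
      (exp ((n : ℂ)⁻¹ • ((r : ℂ) • x)) * exp ((n : ℂ)⁻¹ • ((r : ℂ) • y))) ^ i ∈ K := by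
    intro n i
    have h : (n : ℂ)⁻¹ * r = (((n : ℝ)⁻¹ * r : ℝ) : ℂ) := by push_cast; rfl
    refine K.pow_mem (K.mul_mem ?_ ?_) i
    · rw [smul_smul, h]; exact hx _
    · rw [smul_smul, h]; exact hy _
  rw [smul_add]
  exact hK.mem_of_tendsto (tendsto_exp_mul_exp_pow fun n i => hC _ (hmem n i))
    (Eventually.of_forall fun n => hmem n n)

theorem isClosed_oneParam (hK : IsClosed (K : Set 𝔸)) : IsClosed (oneParam K) := by
  let := NormedAlgebra.restrictScalars ℚ ℂ 𝔸
  have h : oneParam K = ⋂ r : ℝ, (fun x => exp ((r : ℂ) • x)) ⁻¹' K := by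
    ext x; simp [oneParam]
  rw [h]
  exact isClosed_iInter fun r => hK.preimage (exp_continuous.comp (continuous_const_smul _))

theorem conj_mem_oneParam {x y : 𝔸} (hx : x ∈ oneParam K) (hy : y ∈ oneParam K) (s : ℝ) :
    exp ((s : ℂ) • x) * y * exp ((-(s : ℂ)) • x) ∈ oneParam K := by
  let := NormedAlgebra.restrictScalars ℚ ℂ 𝔸
  intro r
  let U : 𝔸ˣ := ⟨exp ((s : ℂ) • x), exp ((-(s : ℂ)) • x), exp_smul_mul_exp_neg_smul x _, by
    simpa using exp_smul_mul_exp_neg_smul x (-(s : ℂ))⟩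
  have h : (r : ℂ) • (exp ((s : ℂ) • x) * y * exp ((-(s : ℂ)) • x)) =
      U * ((r : ℂ) • y) * (U⁻¹ : 𝔸ˣ) := by
    rw [mul_smul_comm, smul_mul_assoc]; rfl
  rw [h, NormedSpace.exp_units_conj]
  refine K.mul_mem (K.mul_mem (hx s) (hy r)) ?_
  have := hx (-s)
  rwa [Complex.ofReal_neg] at this

/-- The commutator is the derivative of the adjoint action. -/
theorem bracket_mem_oneParam (hK : IsClosed (K : Set 𝔸)) {C : ℝ} (hC : ∀ x ∈ K, ‖x‖ ≤ C)
    {x y : 𝔸} (hx : x ∈ oneParam K) (hy : y ∈ oneParam K) : x * y - y * x ∈ oneParam K := by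
  let f : ℂ → 𝔸 := fun u => exp (u • x) * y * exp ((-u) • x)
  have hf : HasDerivAt f (x * y - y * x) 0 := by
    have h1 := hasDerivAt_exp_smul_const x (0 : ℂ)
    have h2 : HasDerivAt (fun u : ℂ => exp ((-u) • x)) (-x) 0 := by
      have h3 : HasDerivAt (fun u : ℂ => exp (u • x)) (exp ((-0 : ℂ) • x) * x) (-0) :=
        hasDerivAt_exp_smul_const x (-0 : ℂ)
      have := h3.scomp (0 : ℂ) (hasDerivAt_neg (0 : ℂ))
      simp only [neg_zero, zero_smul, exp_zero, one_mul, neg_smul, one_smul] at this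
      simpa [Function.comp_def] using this
    have h := (h1.mul_const y).mul h2
    simp only [neg_zero, zero_smul, exp_zero, one_mul, mul_one, mul_neg] at h
    rw [sub_eq_add_neg]
    exact h
  have hf0 : f 0 = y := by simp [f, exp_zero]
  have hlim := (hasDerivAt_iff_tendsto_slope_zero.1 hf).comp tendsto_inv_natCast_ne_zero
  refine (isClosed_oneParam hK).mem_of_tendsto hlim (Eventually.of_forall fun n => ?_)
  have h4 : (n : ℂ)⁻¹ = (((n : ℝ)⁻¹ : ℝ) : ℂ) := by push_cast; rfl
  have h5 : ((n : ℂ)⁻¹)⁻¹ = ((n : ℝ) : ℂ) := by rw [inv_inv]; norm_cast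
  simp only [Function.comp, zero_add, hf0]
  rw [h5, h4]
  refine smul_mem_oneParam ?_ _
  have h6 := add_mem_oneParam hK hC (conj_mem_oneParam hx hy ((n : ℝ)⁻¹))
    (smul_mem_oneParam hy (-1))
  rw [Complex.ofReal_neg, Complex.ofReal_one, neg_one_smul, ← sub_eq_add_neg] at h6
  exact h6

/-- If involutions generate a bounded group of rotations, then the exponentials of the Lie algebra
that they generate are limits of products of rotations. -/
theorem exp_mem_topologicalClosure {X : Set 𝔸} (hX : ∀ t ∈ X, t * t = 1) {C : ℝ}
    (hC : ∀ x ∈ Submonoid.closure {x : 𝔸 | ∃ t ∈ X, ∃ θ, x = rot t θ}, ‖x‖ ≤ C) {a : 𝔸}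
    (ha : LieSpan X a) :
    exp (-(Complex.I • a)) ∈
      (Submonoid.closure {x : 𝔸 | ∃ t ∈ X, ∃ θ, x = rot t θ}).topologicalClosure := by
  set K := (Submonoid.closure {x : 𝔸 | ∃ t ∈ X, ∃ θ, x = rot t θ}).topologicalClosure with hKdef
  have hK : IsClosed (K : Set 𝔸) := Submonoid.isClosed_topologicalClosure _
  have hC' : ∀ x ∈ K, ‖x‖ ≤ C := fun x hx => by
    have h1 : x ∈ closure (Submonoid.closure {x : 𝔸 | ∃ t ∈ X, ∃ θ, x = rot t θ} : Set 𝔸) := hx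
    exact closure_minimal (t := {x : 𝔸 | ‖x‖ ≤ C}) (fun x hx => hC x hx)
      (isClosed_le continuous_norm continuous_const) h1
  have key : -(Complex.I • a) ∈ oneParam K := by
    induction ha with
    | gen t ht =>
      intro r
      rw [exp_smul_eq_rot (hX t ht)]
      exact Submonoid.le_topologicalClosure _ (Submonoid.subset_closure ⟨t, ht, r, rfl⟩)
    | zero => simpa using zero_mem_oneParam
    | add a b _ _ iha ihb =>
      rw [smul_add, neg_add]
      exact add_mem_oneParam hK hC' iha ihb
    | smul c a _ iha =>
      rw [smul_comm, ← smul_neg]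
      exact smul_mem_oneParam iha c
    | bracket a b _ _ iha ihb =>
      have h := smul_mem_oneParam (bracket_mem_oneParam hK hC' iha ihb) (-1)
      have e : -(Complex.I • Complex.I • (a * b - b * a)) = ((-1 : ℝ) : ℂ) •
          (-(Complex.I • a) * -(Complex.I • b) - -(Complex.I • b) * -(Complex.I • a)) := by
        simp only [neg_mul_neg, smul_mul_assoc, mul_smul_comm, smul_smul, Complex.I_mul_I]
        push_cast
        module
      rw [e]
      exact h
  simpa using key 1

end OneParameter

/-! ### The universal model of the logical observables -/

/-- `t ^ z` for an involution `t` and an exponent `z` modulo `2`. -/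
def ipow {A : Type} [Monoid A] (t : A) (z : ZMod 2) : A := if z = 0 then 1 else t

theorem mul_ipow_self {A : Type} [Monoid A] {t : A} (ht : t * t = 1) (z : ZMod 2) :
    t * ipow t z = ipow t (z + 1) := by
  rcases zmod_two_cases z with rfl | rfl
  · simp [ipow]
  · have h : (1 + 1 : ZMod 2) = 0 := by decide
    simp [ipow, h, ht]

theorem mul_ipow {A : Type} [Ring A] [Algebra ℂ A] {s t : A} {a : ZMod 2}
    (h : s * t = sgn a • (t * s)) (z : ZMod 2) :
    s * ipow t z = sgn (a * z) • (ipow t z * s) := by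
  rcases zmod_two_cases z with rfl | rfl <;> simp [ipow, h, sgn_zero]

section Model

variable {ι : Type}

/-- The ordered product of the involutions `t` with exponents `z`. -/
def orderedProd {A : Type} [Monoid A] (t : ι → A) (z : ι → ZMod 2) (l : List ι) : A :=
  (l.map fun a => ipow (t a) (z a)).prod

theorem orderedProd_mem_unitaryGroup {n : Type} [Fintype n] [DecidableEq n]
    {t : ι → Matrix n n ℂ} (ht : ∀ a, t a ∈ unitaryGroup n ℂ) (z : ι → ZMod 2) (l : List ι) :
    orderedProd t z l ∈ unitaryGroup n ℂ := by
  refine Submonoid.list_prod_mem _ fun x hx => ?_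
  obtain ⟨a, -, rfl⟩ := List.mem_map.1 hx
  unfold ipow
  split_ifs
  exacts [one_mem _, ht a]

variable [DecidableEq ι]

theorem add_single_add_single (g : ι) (z : ι → ZMod 2) :
    z + Pi.single g 1 + Pi.single g 1 = z := by
  ext i
  have : ∀ a b : ZMod 2, a + b + b = a := by decide
  exact this _ _

variable (κ : ι → ι → ZMod 2)

/-- The exponent of the sign that arises when the `g`-th of a list of involutions with commutation
signs `(-1)^κ` is moved to its place in the ordered product with exponents `z`. -/
def moveSign (g : ι) (z : ι → ZMod 2) : List ι → ZMod 2
  | [] => 0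
  | a :: l => if g = a then 0 else κ g a * z a + moveSign g z l

theorem moveSign_add_single (g : ι) (z : ι → ZMod 2) (l : List ι) :
    moveSign κ g (z + Pi.single g 1) l = moveSign κ g z l := by
  induction l with
  | nil => rfl
  | cons a l ih =>
    rw [moveSign, moveSign, ih]
    split_ifs with h
    · rfl
    · simp [Pi.single_eq_of_ne (Ne.symm h)]

variable {κ}

theorem orderedProd_add_single_of_notMem {A : Type} [Monoid A] (t : ι → A) (z : ι → ZMod 2) {g : ι}
    {l : List ι} (hg : g ∉ l) :
    orderedProd t (z + Pi.single g 1) l = orderedProd t z l := by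
  unfold orderedProd
  congr 1
  refine List.map_congr_left fun a ha => ?_
  have h : a ≠ g := fun h => hg (h ▸ ha)
  simp [Pi.single_eq_of_ne h]

theorem mul_orderedProd {A : Type} [Ring A] [Algebra ℂ A] {t : ι → A} (ht : ∀ a, t a * t a = 1)
    (hκ : ∀ a b, t a * t b = sgn (κ a b) • (t b * t a)) {l : List ι} (hl : l.Nodup) {g : ι}
    (hg : g ∈ l) (z : ι → ZMod 2) :
    t g * orderedProd t z l =
      sgn (moveSign κ g z l) • orderedProd t (z + Pi.single g 1) l := by
  induction l with
  | nil => simp at hg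
  | cons a l ih =>
    have hcons : ∀ z, orderedProd t z (a :: l) = ipow (t a) (z a) * orderedProd t z l :=
      fun z => by simp [orderedProd]
    rw [List.nodup_cons] at hl
    rw [hcons, hcons, moveSign]
    by_cases h : g = a
    · subst h
      rw [if_pos rfl, sgn_zero, one_smul, ← mul_assoc, mul_ipow_self (ht g),
        orderedProd_add_single_of_notMem t z hl.1]
      simp
    · have h' : g ∈ l := (List.mem_cons.1 hg).resolve_left h
      rw [if_neg h, ← mul_assoc, mul_ipow (hκ g a), smul_mul_assoc, mul_assoc, ih hl.2 h',
        mul_smul_comm, smul_smul, ← sgn_add]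
      simp [Pi.single_eq_of_ne (Ne.symm h)]

variable [Fintype ι]

variable (κ) in
/-- The left regular representation of involutions with commutation signs `(-1)^κ` on the formal
linear combinations of their ordered products. -/
noncomputable def modelGen (g : ι) : Matrix (ι → ZMod 2) (ι → ZMod 2) ℂ :=
  of fun z' z => if z = z' + Pi.single g 1 then sgn (moveSign κ g z' Finset.univ.toList) else 0

theorem modelGen_mulVec (g : ι) (v : (ι → ZMod 2) → ℂ) (z : ι → ZMod 2) :
    (modelGen κ g *ᵥ v) z = sgn (moveSign κ g z Finset.univ.toList) * v (z + Pi.single g 1) := by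
  simp [modelGen, mulVec, dotProduct, of_apply, ite_mul]

theorem modelGen_conjTranspose (g : ι) : (modelGen κ g)ᴴ = modelGen κ g := by
  ext z' z
  have h : z' = z + Pi.single g 1 ↔ z = z' + Pi.single g 1 :=
    ⟨fun h => by rw [h, add_single_add_single], fun h => by rw [h, add_single_add_single]⟩
  simp only [conjTranspose_apply, modelGen, of_apply, h]
  split_ifs with h'
  · rw [star_sgn, h', moveSign_add_single]
  · simp

theorem modelGen_mul_self (g : ι) : modelGen κ g * modelGen κ g = 1 := by
  refine ext_of_mulVec_single fun z => ?_
  ext z'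
  rw [← mulVec_mulVec, modelGen_mulVec, modelGen_mulVec, moveSign_add_single, ← mul_assoc,
    sgn_mul_self, one_mul, add_single_add_single, one_mulVec]

theorem rot_mem_unitaryGroup {n : Type} [Fintype n] [DecidableEq n] {t : Matrix n n ℂ}
    (ht : tᴴ = t) (htt : t * t = 1) (α : ℝ) : rot t α ∈ unitaryGroup n ℂ := by
  rw [mem_unitaryGroup_iff, star_eq_conjTranspose, rot_conjTranspose ht, rot_mul_rot_neg htt]

/-- The evaluation of formal linear combinations of ordered products. -/
noncomputable def evalModel {A : Type} [Ring A] [Algebra ℂ A] (t : ι → A) :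
    ((ι → ZMod 2) → ℂ) →ₗ[ℂ] A :=
  ∑ z, (LinearMap.proj z).smulRight (orderedProd t z Finset.univ.toList)

theorem evalModel_apply {A : Type} [Ring A] [Algebra ℂ A] (t : ι → A) (v : (ι → ZMod 2) → ℂ) :
    evalModel t v = ∑ z, v z • orderedProd t z Finset.univ.toList := by
  simp [evalModel]

theorem evalModel_one {A : Type} [Ring A] [Algebra ℂ A] (t : ι → A) :
    evalModel t (Pi.single 0 1) = 1 := by
  rw [evalModel_apply, Finset.sum_eq_single 0]
  · simp [orderedProd, ipow]
  · intro z _ hz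
    rw [Pi.single_eq_of_ne hz, zero_smul]
  · simp

/-- The operator `a` on formal linear combinations represents the left multiplication by `b`. -/
def Represents {A : Type} [Ring A] [Algebra ℂ A] (t : ι → A)
    (a : Matrix (ι → ZMod 2) (ι → ZMod 2) ℂ) (b : A) : Prop :=
  ∀ v, evalModel t (a *ᵥ v) = b * evalModel t v

namespace Represents

section Ring

variable {A : Type} [Ring A] [Algebra ℂ A] {t : ι → A}
  {a a' : Matrix (ι → ZMod 2) (ι → ZMod 2) ℂ} {b b' : A}

theorem gen (ht : ∀ a, t a * t a = 1) (hκ : ∀ a b, t a * t b = sgn (κ a b) • (t b * t a)) (g : ι) :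
    Represents t (modelGen κ g) (t g) := fun v => by
  rw [evalModel_apply, evalModel_apply, Finset.mul_sum,
    ← Equiv.sum_comp (Equiv.addRight (Pi.single g (1 : ZMod 2) : ι → ZMod 2))]
  refine Finset.sum_congr rfl fun z _ => ?_
  rw [Equiv.coe_addRight, modelGen_mulVec, moveSign_add_single, add_single_add_single,
    mul_smul_comm, mul_orderedProd ht hκ (Finset.nodup_toList _)
      (Finset.mem_toList.2 (Finset.mem_univ g)), smul_smul, mul_comm]

theorem zero : Represents t 0 0 := fun v => by simp

theorem one : Represents t 1 1 := fun v => by simp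

theorem add (h : Represents t a b) (h' : Represents t a' b') : Represents t (a + a') (b + b') :=
  fun v => by rw [add_mulVec, map_add, h v, h' v, add_mul]

theorem smul (h : Represents t a b) (c : ℂ) : Represents t (c • a) (c • b) :=
  fun v => by rw [smul_mulVec, map_smul, h v, smul_mul_assoc]

theorem neg (h : Represents t a b) : Represents t (-a) (-b) :=
  fun v => by rw [neg_mulVec, map_neg, h v, neg_mul]

theorem sub (h : Represents t a b) (h' : Represents t a' b') : Represents t (a - a') (b - b') :=
  fun v => by rw [sub_mulVec, map_sub, h v, h' v, sub_mul]

theorem mul (h : Represents t a b) (h' : Represents t a' b') : Represents t (a * a') (b * b') :=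
  fun v => by rw [← mulVec_mulVec, h, h' v, mul_assoc]

theorem pow (h : Represents t a b) (n : ℕ) : Represents t (a ^ n) (b ^ n) := by
  induction n with
  | zero => simpa using one
  | succ n ih => rw [pow_succ, pow_succ]; exact ih.mul h

theorem rot (h : Represents t a b) (θ : ℝ) : Represents t (rot a θ) (rot b θ) :=
  (one.smul _).sub (h.smul _)

theorem list_prod {σ : Type} {l : List σ} {f : σ → Matrix (ι → ZMod 2) (ι → ZMod 2) ℂ} {f' : σ → A}
    (h : ∀ x ∈ l, Represents t (f x) (f' x)) : Represents t (l.map f).prod (l.map f').prod := by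
  induction l with
  | nil => simpa using one
  | cons x l ih =>
    rw [List.map_cons, List.map_cons, List.prod_cons, List.prod_cons]
    exact (h x (by simp)).mul (ih fun y hy => h y (by simp [hy]))

end Ring

theorem exp {n : Type} [Fintype n] [DecidableEq n] {t : ι → Matrix n n ℂ}
    {a : Matrix (ι → ZMod 2) (ι → ZMod 2) ℂ} {b : Matrix n n ℂ} (h : Represents t a b) :
    Represents t (NormedSpace.exp a) (NormedSpace.exp b) := fun v => by
  let := Matrix.linftyOpNormedRing (n := n) (α := ℂ)
  let := Matrix.linftyOpNormedAlgebra (R := ℂ) (n := n) (α := ℂ)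
  let := Matrix.linftyOpNormedRing (n := ι → ZMod 2) (α := ℂ)
  let := Matrix.linftyOpNormedAlgebra (R := ℂ) (n := ι → ZMod 2) (α := ℂ)
  let f : Matrix (ι → ZMod 2) (ι → ZMod 2) ℂ →ₗ[ℂ] Matrix n n ℂ :=
    { toFun := fun a => evalModel t (a *ᵥ v)
      map_add' := fun a a' => by rw [add_mulVec, map_add]
      map_smul' := fun c a => by rw [smul_mulVec, map_smul]; rfl }
  have h1 : HasSum (fun k : ℕ => f ((k.factorial⁻¹ : ℂ) • a ^ k)) (f (NormedSpace.exp a)) :=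
    (NormedSpace.exp_series_hasSum_exp' (𝕂 := ℂ) a).map f f.continuous_of_finiteDimensional
  have h2 : HasSum (fun k : ℕ => ((k.factorial⁻¹ : ℂ) • b ^ k) * evalModel t v)
      (NormedSpace.exp b * evalModel t v) :=
    (NormedSpace.exp_series_hasSum_exp' (𝕂 := ℂ) b).mul_right _
  have h3 : (fun k : ℕ => f ((k.factorial⁻¹ : ℂ) • a ^ k)) =
      fun k : ℕ => ((k.factorial⁻¹ : ℂ) • b ^ k) * evalModel t v :=
    funext fun k => ((h.pow k).smul _) v
  rw [h3] at h1
  exact h1.unique h2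

end Represents

/-- The exponentials of the Lie algebra that is generated by some of the operators `modelGen κ g`
are approximated by products of boundedly many rotations. -/
theorem exists_model_word (Γ : Set ι) {η : ℝ} (hη : 0 < η) :
    ∃ N : ℕ, ∀ a, LieSpan (modelGen κ '' Γ) a → ∃ l : List (ι × ℝ), l.length ≤ N ∧
      (∀ x ∈ l, x.1 ∈ Γ) ∧ ∑ z, ‖((NormedSpace.exp (-(Complex.I • a)) -
        (l.map fun x => rot (modelGen κ x.1) x.2).prod) *ᵥ Pi.single 0 1) z‖ ≤ η := by
  let := Matrix.linftyOpNormedRing (n := ι → ZMod 2) (α := ℂ)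
  let := Matrix.linftyOpNormedAlgebra (R := ℂ) (n := ι → ZMod 2) (α := ℂ)
  set X : Set (Matrix (ι → ZMod 2) (ι → ZMod 2) ℂ) :=
    {x | ∃ t ∈ modelGen κ '' Γ, ∃ θ, x = rot t θ} with hX
  have hC : ∀ x ∈ Submonoid.closure X, ‖x‖ ≤ Fintype.card (ι → ZMod 2) := by
    intro x hx
    have hu : x ∈ unitaryGroup (ι → ZMod 2) ℂ := by
      refine (Submonoid.closure_le (S := unitaryGroup (ι → ZMod 2) ℂ)).2 ?_ hx
      rintro _ ⟨_, ⟨g, -, rfl⟩, θ, rfl⟩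
      exact rot_mem_unitaryGroup (modelGen_conjTranspose g) (modelGen_mul_self g) θ
    rw [Matrix.linfty_opNorm_def]
    have : (Finset.univ.sup fun i => ∑ j, ‖x i j‖₊) ≤ (Fintype.card (ι → ZMod 2) : NNReal) := by
      refine Finset.sup_le fun i _ => ?_
      refine (Finset.sum_le_card_nsmul _ _ 1 fun j _ => ?_).trans (by simp)
      exact entry_norm_bound_of_unitary hu i j
    exact_mod_cast this
  have hη' : 0 < η / Fintype.card (ι → ZMod 2) := by positivity
  obtain ⟨N, hN⟩ := exists_word_length hC hη'
  refine ⟨N, fun a ha => ?_⟩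
  obtain ⟨l, hlN, hlX, hl⟩ := hN _ (exp_mem_topologicalClosure (C := Fintype.card (ι → ZMod 2))
    (by rintro _ ⟨g, -, rfl⟩; exact modelGen_mul_self g) hC ha)
  have hlift : ∃ l' : List (ι × ℝ), (∀ x ∈ l', x.1 ∈ Γ) ∧
      (l'.map fun x => rot (modelGen κ x.1) x.2) = l := by
    clear hl hlN
    induction l with
    | nil => exact ⟨[], by simp⟩
    | cons y l ih =>
      obtain ⟨_, ⟨g, hg, rfl⟩, θ, hy⟩ := hlX y (by simp)
      obtain ⟨l', h1, h2⟩ := ih fun z hz => hlX z (by simp [hz])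
      refine ⟨(g, θ) :: l', ?_, by rw [List.map_cons, h2, hy]⟩
      rintro x hx
      rcases List.mem_cons.1 hx with rfl | hx
      exacts [hg, h1 x hx]
  obtain ⟨l', hl'Γ, hl'⟩ := hlift
  refine ⟨l', ?_, hl'Γ, ?_⟩
  · rw [← hl', List.length_map] at hlN
    exact hlN
  rw [hl']
  have hentry : ∀ z, ‖((NormedSpace.exp (-(Complex.I • a)) - l.prod) *ᵥ Pi.single 0 1) z‖ ≤
      η / Fintype.card (ι → ZMod 2) := by
    intro z
    rw [mulVec_single_one]
    refine le_trans ?_ hl.le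
    rw [Matrix.linfty_opNorm_def]
    set M := NormedSpace.exp (-(Complex.I • a)) - l.prod
    have h1 : ‖M z 0‖₊ ≤ Finset.univ.sup fun i => ∑ j, ‖M i j‖₊ :=
      (Finset.single_le_sum (f := fun j => ‖M z j‖₊) (fun _ _ => zero_le)
        (Finset.mem_univ 0)).trans
        (Finset.le_sup (f := fun i => ∑ j, ‖M i j‖₊) (Finset.mem_univ z))
    exact_mod_cast h1
  refine (Finset.sum_le_sum fun z _ => hentry z).trans (le_of_eq ?_)
  rw [Finset.sum_const, Finset.card_univ, nsmul_eq_mul]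
  field_simp

end Model

/-! ### Approximation of logical gates by products of rotations -/

section Gates

variable {m : ℕ} {Λ : Type} [Fintype Λ] [DecidableEq Λ] {S : Setting m Λ}
  {H : Submodule (ZMod 2) (G m)}

namespace Setting

theorem T_mem_unitaryGroup (g : G m) : S.T H g ∈ unitaryGroup (Λ → Fin 2) ℂ := by
  rw [mem_unitaryGroup_iff, star_eq_conjTranspose, S.T_conjTranspose, S.T_mul_self]

theorem LieAlg.exists_represents (hH : S.IsMaximalAbelian H) {A : Op Λ} (hA : S.LieAlg H A) :
    ∃ a, LieSpan (modelGen S.κ '' S.𝒢) a ∧ Represents (S.T H) a A := by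
  induction hA with
  | gen g hg =>
    exact ⟨_, .gen _ ⟨g, hg, rfl⟩, .gen (S.T_mul_self H) (T_mul_T hH) g⟩
  | zero => exact ⟨0, .zero, .zero⟩
  | add A A' _ _ ih ih' =>
    obtain ⟨a, ha, h⟩ := ih
    obtain ⟨a', ha', h'⟩ := ih'
    exact ⟨_, ha.add _ _ ha', h.add h'⟩
  | smul c A _ ih =>
    obtain ⟨a, ha, h⟩ := ih
    exact ⟨_, ha.smul c _, h.smul _⟩
  | bracket A A' _ _ ih ih' =>
    obtain ⟨a, ha, h⟩ := ih
    obtain ⟨a', ha', h'⟩ := ih'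
    exact ⟨_, ha.bracket _ _ ha', ((h.mul h').sub (h'.mul h)).smul _⟩

end Setting

end Gates

/-- Each logical gate is up to `η` a product of boundedly many rotations about localizable logical
observables; the bound depends only on `m` and `η`, because there are finitely many commutation
signs `κ` and sets `𝒢`. The error is measured by the coefficients of an expansion into
unitaries. -/
theorem exists_gate_word (m : ℕ) {η : ℝ} (hη : 0 < η) :
    ∃ N : ℕ, ∀ (Λ : Type) [Fintype Λ] [DecidableEq Λ] (S : Setting m Λ)
      (H : Submodule (ZMod 2) (G m)), S.IsMaximalAbelian H → ∀ V ∈ S.gates H,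
      ∃ l : List (G m × ℝ), l.length ≤ N ∧ (∀ x ∈ l, x.1 ∈ S.𝒢) ∧
        ∃ (c : (G m → ZMod 2) → ℂ) (P : (G m → ZMod 2) → Op Λ),
          (∀ z, P z ∈ unitaryGroup (Λ → Fin 2) ℂ) ∧
          V - (l.map fun x => rot (S.T H x.1) x.2).prod = ∑ z, c z • P z ∧ ∑ z, ‖c z‖ ≤ η := by
  classical
  choose N hN using fun p : (G m → G m → ZMod 2) × Set (G m) =>
    exists_model_word (κ := p.1) p.2 hη
  refine ⟨Finset.univ.sup N, fun Λ _ _ S H hH V ⟨A, hA, hV⟩ => ?_⟩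
  obtain ⟨a, ha, hrep⟩ := hA.exists_represents hH
  obtain ⟨l, hlN, hl𝒢, hl⟩ := hN (S.κ, S.𝒢) a ha
  refine ⟨l, hlN.trans (Finset.le_sup (f := N) (Finset.mem_univ _)), hl𝒢, _,
    fun z => orderedProd (S.T H) z Finset.univ.toList,
    fun z => orderedProd_mem_unitaryGroup (fun g => Setting.T_mem_unitaryGroup g) z _, ?_, hl⟩
  have h1 : Represents (S.T H) (NormedSpace.exp (-(Complex.I • a)) -
      (l.map fun x => rot (modelGen S.κ x.1) x.2).prod)
      (V - (l.map fun x => rot (S.T H x.1) x.2).prod) := by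
    rw [hV]
    exact (hrep.smul _).neg.exp.sub
      (.list_prod fun x _ => (Represents.gen (S.T_mul_self H) (Setting.T_mul_T hH) x.1).rot x.2)
  have h2 := h1 (Pi.single 0 1)
  rw [evalModel_one, mul_one] at h2
  rw [← h2, evalModel_apply]

/-! ### Logical channels -/

section LogicalChannels

variable {m : ℕ} {Λ : Type} [Fintype Λ] [DecidableEq Λ] {S : Setting m Λ}
  {H : Submodule (ZMod 2) (G m)} {Φ : Vec Λ}

theorem isLogicalChannel_of_kraus {ι : Type} [Fintype ι] {K : ι → Op Λ}
    (hK : ∀ j, K j ∈ Algebra.adjoin ℂ (Set.range (S.T H))) (h1 : ∑ j, (K j)ᴴ * K j = 1)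
    {𝓔 : Op Λ → Op Λ} (h𝓔 : ∀ ρ, 𝓔 ρ = ∑ j, K j * ρ * (K j)ᴴ) : S.IsLogicalChannel H 𝓔 := by
  let e := (Fintype.equivFin ι).symm
  refine ⟨Fintype.card ι, fun j => K (e j), fun j => hK _, ?_, fun ρ => ?_⟩
  · rw [← h1]
    exact e.sum_comp fun j => (K j)ᴴ * K j
  · rw [h𝓔]
    exact (e.sum_comp fun j => K j * ρ * (K j)ᴴ).symm

namespace Setting.IsLogicalChannel

theorem statePreserving {𝓔 : Op Λ → Op Λ} (h : S.IsLogicalChannel H 𝓔) : StatePreserving 𝓔 := by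
  obtain ⟨_, K, -, h1, h𝓔⟩ := h
  exact statePreserving_of_kraus h1 h𝓔

theorem id : S.IsLogicalChannel H id :=
  isLogicalChannel_of_kraus (ι := Unit) (K := fun _ => 1) (fun _ => one_mem _) (by simp)
    fun ρ => by simp

theorem comp {𝓔 𝓕 : Op Λ → Op Λ} (h𝓔 : S.IsLogicalChannel H 𝓔) (h𝓕 : S.IsLogicalChannel H 𝓕) :
    S.IsLogicalChannel H (𝓔 ∘ 𝓕) := by
  obtain ⟨a, K, hK, hK1, h𝓔⟩ := h𝓔
  obtain ⟨b, M, hM, hM1, h𝓕⟩ := h𝓕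
  refine isLogicalChannel_of_kraus (K := fun p : Fin b × Fin a => K p.2 * M p.1)
    (fun p => mul_mem (hK _) (hM _)) ?_ fun ρ => ?_
  · rw [Fintype.sum_prod_type, ← hM1]
    refine Finset.sum_congr rfl fun i _ => ?_
    have h : ∀ j, (K j * M i)ᴴ * (K j * M i) = (M i)ᴴ * ((K j)ᴴ * K j) * M i := fun j => by
      rw [conjTranspose_mul]; simp only [mul_assoc]
    simp only [h]
    rw [← Finset.sum_mul, ← Finset.mul_sum, hK1, mul_one]
  · rw [Function.comp_apply, h𝓔, h𝓕, Fintype.sum_prod_type, Finset.sum_comm]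
    refine Finset.sum_congr rfl fun j _ => ?_
    rw [Finset.mul_sum, Finset.sum_mul]
    refine Finset.sum_congr rfl fun i _ => ?_
    rw [conjTranspose_mul]
    simp only [mul_assoc]

end Setting.IsLogicalChannel

theorem rot_mem_adjoin (g : G m) (α : ℝ) :
    rot (S.T H g) α ∈ Algebra.adjoin ℂ (Set.range (S.T H)) :=
  Subalgebra.sub_mem _ (Subalgebra.smul_mem _ (one_mem _) _)
    (Subalgebra.smul_mem _ (Algebra.subset_adjoin (Set.mem_range_self g)) _)

theorem isLogicalChannel_randomRot (g : G m) {σ : ℝ} (hσ : |σ| ≤ 1) (α : ℝ) :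
    S.IsLogicalChannel H (randomRot (S.T H g) σ α) := by
  have hσ' := abs_le.1 hσ
  -- the Kraus operators are the two rotations with the square roots of their probabilities
  let p : Bool → ℝ := fun b => if b then (1 + σ) / 2 else (1 - σ) / 2
  let θ : Bool → ℝ := fun b => if b then α else -α
  have hp : ∀ b, ((√(p b) : ℝ) : ℂ) * ((√(p b) : ℝ) : ℂ) = p b := fun b => by
    rw [← Complex.ofReal_mul, Real.mul_self_sqrt]
    cases b
    · change 0 ≤ (1 - σ) / 2; linarith
    · change 0 ≤ (1 + σ) / 2; linarith
  have hstar : ∀ b, (((√(p b) : ℝ) : ℂ) • rot (S.T H g) (θ b))ᴴ =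
      ((√(p b) : ℝ) : ℂ) • rot (S.T H g) (-θ b) := fun b => by
    rw [conjTranspose_smul, rot_conjTranspose (S.T_conjTranspose H g), Complex.star_def,
      Complex.conj_ofReal]
  refine isLogicalChannel_of_kraus (K := fun b => ((√(p b) : ℝ) : ℂ) • rot (S.T H g) (θ b))
    (fun b => Subalgebra.smul_mem _ (rot_mem_adjoin g _) _) ?_ fun ρ => ?_
  · simp only [hstar, smul_mul_smul_comm, hp, rot_neg_mul_rot (S.T_mul_self H g),
      Fintype.sum_bool, p]
    rw [← add_smul]
    norm_num
    rw [show (1 + (σ : ℂ)) / 2 + (1 - σ) / 2 = 1 by ring, one_smul]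
  · simp only [hstar, smul_mul_assoc, mul_smul_comm, smul_smul, hp, Fintype.sum_bool, p, θ,
      randomRot]
    simp

open scoped ComplexOrder in
theorem norm_ev_le_one (hΦ : star Φ ⬝ᵥ Φ = 1) {X : Op Λ} (hX : X ∈ unitaryGroup (Λ → Fin 2) ℂ) :
    ‖ev Φ X‖ ≤ 1 := by
  rw [ev_eq_trace]
  refine traceBound_of_posSemidef (posSemidef_vecMulVec_self_star Φ) ?_ X hX
  rw [trace_vecMulVec, dotProduct_comm, hΦ]

theorem IsResource.star_dotProduct_self {χ : G m → ZMod 2} {Δ : ℕ} {d : ℝ}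
    (hR : IsResource S H Φ χ Δ d) : star Φ ⬝ᵥ Φ = 1 := by
  obtain ⟨Φ₀, W, ⟨h0, -⟩, hW, -, -, rfl, -⟩ := hR.exists_stabilizer
  have h := ev_conj Φ₀ W 1
  rwa [mul_one, ← star_eq_conjTranspose, mem_unitaryGroup_iff'.1 hW, ev, ev, one_mulVec,
    one_mulVec, h0] at h

namespace RotStep

/-- The group element of the step does not commute with all others. -/
def Noncentral (S : Setting m Λ) (x : RotStep m Λ) : Prop := ∃ g', S.κ x.elt g' = 1

open Classical in
/-- The bias of the random rotation about `T(g)` that stands for a step: the order parameter, or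
`1` if `T(g)` is central, in which case the rotation has no effect on the logical observables and
need not be implemented. -/
noncomputable def bias (S : Setting m Λ) (Φ : Vec Λ) (x : RotStep m Λ) : ℝ :=
  if x.Noncentral S then (ev Φ (x.R S)).re else 1

/-- The random rotations of several steps, including those about central elements. -/
noncomputable def biasedChannels (S : Setting m Λ) (H : Submodule (ZMod 2) (G m)) (Φ : Vec Λ)
    (ℓ : List (RotStep m Λ)) : Op Λ → Op Λ :=
  ℓ.foldr (fun x 𝓔 => randomRot (S.T H x.elt) (x.bias S Φ) x.angle ∘ 𝓔) id

theorem abs_bias_le_one (hΦ : star Φ ⬝ᵥ Φ = 1) (x : RotStep m Λ) : |x.bias S Φ| ≤ 1 := by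
  unfold bias
  split_ifs
  · refine (Complex.abs_re_le_norm _).trans (norm_ev_le_one hΦ ?_)
    rw [mem_unitaryGroup_iff, star_eq_conjTranspose, R_conjTranspose, R_mul_self]
  · simp

theorem isLogicalChannel_biasedChannels (hΦ : star Φ ⬝ᵥ Φ = 1) (ℓ : List (RotStep m Λ)) :
    S.IsLogicalChannel H (biasedChannels S H Φ ℓ) := by
  induction ℓ with
  | nil => exact .id
  | cons x ℓ ih => exact (isLogicalChannel_randomRot x.elt (abs_bias_le_one hΦ x) x.angle).comp ih

theorem randomRot_mem_adjoin {X : Op Λ} (hX : X ∈ Algebra.adjoin ℂ (Set.range (S.T H))) (g : G m)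
    (σ α : ℝ) : randomRot (S.T H g) σ α X ∈ Algebra.adjoin ℂ (Set.range (S.T H)) :=
  Subalgebra.add_mem _
    (Subalgebra.smul_mem _ (mul_mem (mul_mem (rot_mem_adjoin _ _) hX) (rot_mem_adjoin _ _)) _)
    (Subalgebra.smul_mem _ (mul_mem (mul_mem (rot_mem_adjoin _ _) hX) (rot_mem_adjoin _ _)) _)

open Classical in
/-- The rotations about central elements cannot be seen in the logical observables. -/
theorem trace_mul_biasedChannels (hH : S.IsMaximalAbelian H) (ℓ : List (RotStep m Λ)) {X : Op Λ}
    (hX : X ∈ Algebra.adjoin ℂ (Set.range (S.T H))) (ρ : Op Λ) :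
    (X * biasedChannels S H Φ ℓ ρ).trace =
      (X * channels S H Φ (ℓ.filter (Noncentral S)) ρ).trace := by
  induction ℓ generalizing X with
  | nil => rfl
  | cons x ℓ ih =>
    have h1 : biasedChannels S H Φ (x :: ℓ) ρ =
      randomRot (S.T H x.elt) (x.bias S Φ) x.angle (biasedChannels S H Φ ℓ ρ) := rfl
    rw [h1, trace_mul_randomRot, ih (randomRot_mem_adjoin hX _ _ _)]
    by_cases hx : x.Noncentral S
    · have h2 : channels S H Φ (x :: ℓ.filter (Noncentral S)) ρ =
          randomRot (S.T H x.elt) (ev Φ (x.R S)).re x.angle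
            (channels S H Φ (ℓ.filter (Noncentral S)) ρ) := rfl
      rw [List.filter_cons_of_pos (by simpa using hx), h2, trace_mul_randomRot, bias, if_pos hx]
    · have hcomm : Commute X (S.T H x.elt) := by
        have : X ∈ Subalgebra.centralizer ℂ {S.T H x.elt} := by
          refine Algebra.adjoin_le ?_ hX
          rintro _ ⟨g, rfl⟩
          rw [SetLike.mem_coe, Subalgebra.mem_centralizer_iff]
          rintro _ rfl
          have h0 : S.κ x.elt g = 0 := by
            by_contra h
            exact hx ⟨g, (zmod_two_cases _).resolve_left h⟩
          rw [Setting.T_mul_T hH, h0, sgn_zero, one_smul]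
        exact ((Subalgebra.mem_centralizer_iff ℂ).1 this _ rfl).symm
      have h3 : randomRot (S.T H x.elt) (x.bias S Φ) (-x.angle) X = X := by
        rw [bias, if_neg hx, randomRot, ← (Commute.rot_right hcomm _).eq, mul_assoc, neg_neg,
          rot_neg_mul_rot (S.T_mul_self H _), mul_one]
        norm_num
      rw [List.filter_cons_of_neg (by simpa using hx), h3]

end RotStep

/-! ### From words of rotations to measurement steps -/

/-- A word of rotations by small angles is approximated by random rotations, one for each letter,
whose biases multiply the angles up to those of the word. The `k`-th letter from the right is
implemented in the `k`-th round. -/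
theorem exists_steps (hΦ : star Φ ⬝ᵥ Φ = 1) {β : Λ → G m → Pauli} {σ₀ θ : ℝ} (hσ₀ : 0 < σ₀)
    (hσ₁ : σ₀ ≤ 1) (hσ : ∀ k ∈ S.B, ∀ g ∈ S.GG k, σ₀ ≤ ‖S.σ Φ k g (β k g)‖)
    {site : ℕ → G m → Λ} (hsite : ∀ k, ∀ g ∈ S.𝒢, site k g ∈ S.B ∧ g ∈ S.GG (site k g))
    (w : List (G m × ℝ)) (hw : ∀ y ∈ w, y.1 ∈ S.𝒢) (hθ : ∀ y ∈ w, |y.2| ≤ θ) :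
    ∃ ℓ : List (RotStep m Λ),
      (∀ x ∈ ℓ, x.elt ∈ S.𝒢 ∧ x.pauli = β x.site x.elt ∧
        ∃ k, 0 < k ∧ k ≤ w.length ∧ x.site = site k x.elt) ∧
      (ℓ.Pairwise fun x y => ∃ k k', k' < k ∧ k ≤ w.length ∧ x.site = site k x.elt ∧
        y.site = site k' y.elt) ∧
      DiamondBound (RotStep.biasedChannels S H Φ ℓ)
        (fun ρ => (w.map fun y => rot (S.T H y.1) y.2).prod * ρ *
          ((w.map fun y => rot (S.T H y.1) y.2).prod)ᴴ) (w.length * (10 * (θ / σ₀) ^ 2)) := by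
  induction w with
  | nil =>
    refine ⟨[], by simp, by simp, fun k ρ _ _ => ?_⟩
    have h : RotStep.biasedChannels S H Φ [] = fun ρ => ρ := rfl
    simp only [h, List.map_nil, List.prod_nil, conjTranspose_one, one_mul, mul_one, sub_self]
    intro U _
    simp
  | cons y w ih =>
    obtain ⟨ℓ, h1, h2, h3⟩ := ih (fun z hz => hw z (List.mem_cons_of_mem _ hz))
      fun z hz => hθ z (List.mem_cons_of_mem _ hz)
    obtain ⟨g, φ⟩ := y
    have hg : g ∈ S.𝒢 := hw (g, φ) List.mem_cons_self
    set k := w.length + 1 with hk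
    obtain ⟨hB, hGG⟩ := hsite k g hg
    let x₀ : RotStep m Λ := ⟨site k g, g, β (site k g) g, 0⟩
    set σ := x₀.bias S Φ with hσdef
    have hσle : σ₀ ≤ |σ| := by
      rw [hσdef]
      unfold RotStep.bias
      split_ifs
      · refine (hσ _ hB _ hGG).trans (le_of_eq ?_)
        have h : S.σ Φ (site k g) g (β (site k g) g) = ev Φ (x₀.R S) := rfl
        rw [h, ← RotStep.im_ev_R, Complex.norm_real, Real.norm_eq_abs, Complex.ofReal_re]
      · simpa using hσ₁
    have hσ0 : σ ≠ 0 := fun h => by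
      rw [h, abs_zero] at hσle
      exact absurd hσle (not_le.2 hσ₀)
    let x : RotStep m Λ := ⟨site k g, g, β (site k g) g, φ / σ⟩
    refine ⟨x :: ℓ, ?_, ?_, ?_⟩
    · intro z hz
      rcases List.mem_cons.1 hz with rfl | hz
      · exact ⟨hg, rfl, k, by omega, by simp [hk], rfl⟩
      · obtain ⟨ha, hb, k', hc, hd, he⟩ := h1 z hz
        exact ⟨ha, hb, k', hc, hd.trans (by simp), he⟩
    · refine List.pairwise_cons.2 ⟨fun z hz => ?_, h2.imp ?_⟩
      · obtain ⟨-, -, k', -, hd, he⟩ := h1 z hz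
        exact ⟨k, k', by omega, by simp [hk], rfl, he⟩
      · rintro a b ⟨k, k', ha, hb, hc, hd⟩
        exact ⟨k, k', ha, hb.trans (by simp), hc, hd⟩
    · have hstep : DiamondBound (randomRot (S.T H g) σ (φ / σ))
          (fun ρ => rot (S.T H g) φ * ρ * (rot (S.T H g) φ)ᴴ) (10 * (θ / σ₀) ^ 2) := by
        have h := diamondBound_randomRot (S.T_conjTranspose H g) (S.T_mul_self H g)
          (RotStep.abs_bias_le_one (S := S) hΦ x₀) (φ / σ)
        rw [← hσdef, mul_div_cancel₀ _ hσ0] at h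
        intro j ρ hρ htr
        refine (h j ρ hρ htr).mono ?_
        have h4 : |φ / σ| ≤ θ / σ₀ := by
          rw [abs_div]
          exact div_le_div₀ ((abs_nonneg _).trans (hθ _ List.mem_cons_self))
            (hθ (g, φ) List.mem_cons_self) hσ₀ hσle
        have h5 := sq_le_sq.2 (h4.trans (le_abs_self _))
        linarith
      have h6 := h3.comp_conj (RotStep.isLogicalChannel_biasedChannels hΦ ℓ).statePreserving
        (rot_mem_unitaryGroup (S.T_conjTranspose H g) (S.T_mul_self H g) φ) hstep
      have h7 : RotStep.biasedChannels S H Φ (x :: ℓ) =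
        randomRot (S.T H g) σ (φ / σ) ∘ RotStep.biasedChannels S H Φ ℓ := rfl
      rw [h7]
      convert h6 using 1
      · funext ρ
        rw [List.map_cons, List.prod_cons, conjTranspose_mul]
        simp only [mul_assoc]
      · rw [List.length_cons]
        push_cast
        ring

end LogicalChannels

/-! ### Implementation of logical gates -/

section Gates

variable {m : ℕ} {Λ : Type} [Fintype Λ] [DecidableEq Λ] {S : Setting m Λ}
  {H : Submodule (ZMod 2) (G m)} {Φ : Vec Λ}

theorem Setting.LieAlg.conjTranspose_eq {A : Op Λ} (hA : S.LieAlg H A) : Aᴴ = A := by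
  induction hA with
  | gen g _ => exact S.T_conjTranspose H g
  | zero => exact conjTranspose_zero
  | add A A' _ _ ih ih' => rw [conjTranspose_add, ih, ih']
  | smul c A _ ih => rw [conjTranspose_smul, ih, Complex.star_def, Complex.conj_ofReal]
  | bracket A A' _ _ ih ih' =>
    rw [conjTranspose_smul, conjTranspose_sub, conjTranspose_mul, conjTranspose_mul, ih, ih',
      Complex.star_def, Complex.conj_I, neg_smul, ← smul_neg, neg_sub]

theorem Setting.gates_subset_unitaryGroup :
    S.gates H ⊆ (unitaryGroup (Λ → Fin 2) ℂ : Set (Op Λ)) := by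
  rintro _ ⟨A, hA, rfl⟩
  have h : (-(Complex.I • A))ᴴ = -(-(Complex.I • A)) := by
    rw [conjTranspose_neg, conjTranspose_smul, hA.conjTranspose_eq, Complex.star_def,
      Complex.conj_I, neg_smul]
  rw [SetLike.mem_coe, mem_unitaryGroup_iff, star_eq_conjTranspose, ← exp_conjTranspose, h,
    ← Matrix.exp_add_of_commute _ _ (Commute.refl (-(Complex.I • A))).neg_right, add_neg_cancel,
    NormedSpace.exp_zero]

/-- Rotations by arbitrary angles are split into rotations by small angles. -/
theorem exists_small_word (l : List (G m × ℝ)) (hl : ∀ x ∈ l, x.1 ∈ S.𝒢) {p : ℕ} (hp : 0 < p) :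
    ∃ w : List (G m × ℝ), w.length = l.length * p ∧ (∀ y ∈ w, y.1 ∈ S.𝒢) ∧
      (∀ y ∈ w, |y.2| ≤ Real.pi / p) ∧
      (w.map fun y => rot (S.T H y.1) y.2).prod = (l.map fun x => rot (S.T H x.1) x.2).prod := by
  have hp' : (0 : ℝ) < p := by exact_mod_cast hp
  induction l with
  | nil => exact ⟨[], by simp⟩
  | cons x l ih =>
    obtain ⟨w, h1, h2, h3, h4⟩ := ih fun z hz => hl z (List.mem_cons_of_mem _ hz)
    obtain ⟨g, α⟩ := x
    set θ := (α : Real.Angle).toReal with hθ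
    have hrot : rot (S.T H g) α = rot (S.T H g) θ := by
      rw [rot, rot, hθ, Real.Angle.cos_toReal, Real.Angle.sin_toReal, Real.Angle.cos_coe,
        Real.Angle.sin_coe]
    refine ⟨List.replicate p (g, θ / p) ++ w, ?_, ?_, ?_, ?_⟩
    · rw [List.length_append, List.length_replicate, h1, List.length_cons]
      ring
    · intro y hy
      rcases List.mem_append.1 hy with hy | hy
      · rw [List.eq_of_mem_replicate hy]
        exact hl (g, α) List.mem_cons_self
      · exact h2 y hy
    · intro y hy
      rcases List.mem_append.1 hy with hy | hy
      · rw [List.eq_of_mem_replicate hy, abs_div, Nat.abs_cast]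
        exact div_le_div_of_nonneg_right (Real.Angle.abs_toReal_le_pi _) hp'.le
      · exact h3 y hy
    · rw [List.map_append, List.prod_append, h4, List.map_replicate, List.prod_replicate,
        rot_pow (S.T_mul_self H g), mul_div_cancel₀ _ hp'.ne', List.map_cons, List.prod_cons, hrot]

/-- Words of rotations by small angles are implemented approximately. The first of the rounds is
left out, which keeps the others away from the left boundary. -/
theorem exists_implements {χ : G m → ZMod 2} {Δ : ℕ} {d : ℝ} (hR : IsResource S H Φ χ Δ d)
    {β : Λ → G m → Pauli} (hβ : OrderParametersNonzero S Φ β) {σ₀ θ : ℝ} (hσ₀ : 0 < σ₀)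
    (hσ₁ : σ₀ ≤ 1) (hσ : ∀ k ∈ S.B, ∀ g ∈ S.GG k, σ₀ ≤ ‖S.σ Φ k g (β k g)‖) {n : ℕ}
    (hN : HasRounds S Δ d (n + 1)) {w : List (G m × ℝ)} (hn : w.length ≤ n)
    (hw : ∀ y ∈ w, y.1 ∈ S.𝒢) (hθ : ∀ y ∈ w, |y.2| ≤ θ) :
    ∃ 𝓔 : Op Λ → Op Λ, S.IsLogicalChannel H 𝓔 ∧
      DiamondBound 𝓔 (fun ρ => (w.map fun y => rot (S.T H y.1) y.2).prod * ρ *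
          ((w.map fun y => rot (S.T H y.1) y.2).prod)ᴴ) (w.length * (10 * (θ / σ₀) ^ 2)) ∧
      Implements S H Φ 𝓔 := by
  classical
  obtain ⟨site, hsite, hsep⟩ := hN
  let site' : ℕ → G m → Λ := fun k => site ⟨min k n, by omega⟩
  have hsep' : ∀ k k', k' < k → k ≤ n → ∀ g ∈ S.𝒢, ∀ g' ∈ S.𝒢,
      S.pos (site' k' g) 0 + (2 * Δ + d) ≤ S.pos (site' k g') 0 := fun k k' h h' =>
    hsep _ _ (by rw [Fin.mk_lt_mk]; omega)
  have hΦ := hR.star_dotProduct_self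
  obtain ⟨ℓ, h1, h2, h3⟩ := exists_steps (H := H) hΦ hσ₀ hσ₁ hσ (site := site')
    (fun k => hsite _) w hw hθ
  refine ⟨_, RotStep.isLogicalChannel_biasedChannels hΦ ℓ, h3,
    implements_of_channels hR (ℓ := ℓ.filter (RotStep.Noncentral S)) ?_
      fun X hX => RotStep.trace_mul_biasedChannels hR.maximal ℓ hX _⟩
  have hmem : ∀ x ∈ ℓ.filter (RotStep.Noncentral S), x ∈ ℓ ∧ x.Noncentral S := fun x hx => by
    simpa using List.mem_filter.1 hx
  have hB : ∀ x ∈ ℓ, x.site ∈ S.B ∧ x.elt ∈ S.GG x.site := fun x hx => by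
    obtain ⟨hg, -, k, -, -, he⟩ := h1 x hx
    rw [he]
    exact hsite _ _ hg
  refine ⟨fun x hx => (hB x (hmem x hx).1).1, fun x hx => ?_, fun x hx => (hmem x hx).2,
    List.Pairwise.filter _ ?_, fun x hx i hi => ?_⟩
  · obtain ⟨ha, hb⟩ := hB x (hmem x hx).1
    rw [(h1 x (hmem x hx).1).2.1]
    exact (hβ _ ha _ hb).1
  · refine List.Pairwise.imp_of_mem ?_ h2
    rintro x y hx hy ⟨k, k', ha, hb, hc, hd⟩
    rw [hc, hd]
    exact hsep' k k' ha (hb.trans hn) _ (h1 y hy).1 _ (h1 x hx).1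
  · obtain ⟨hg, -, k, hk, hk', he⟩ := h1 x (hmem x hx).1
    have ha := hsep' k 0 hk (hk'.trans hn) _ hg _ hg
    have hb := S.left_lt_bulk i hi _ (hsite ⟨min 0 n, by omega⟩ _ hg).1
    change S.pos i 0 < S.pos (site' 0 x.elt) 0 at hb
    rw [he]
    linarith

/-- Approximate implementation of logical gates. The number of rounds is that of the letters of a
word of rotations that approximates the gate, each split into `p` rotations by small angles. -/
theorem exists_rounds (m : ℕ) {ε σ₀ : ℝ} (hε : 0 < ε) (hσ₀ : 0 < σ₀) : ∃ N : ℕ,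
    ∀ (Λ : Type) [Fintype Λ] [DecidableEq Λ] (S : Setting m Λ) (H : Submodule (ZMod 2) (G m))
      (Φ : Vec Λ) (χ : G m → ZMod 2) (β : Λ → G m → Pauli) (Δ : ℕ) (d : ℝ),
      IsResource S H Φ χ Δ d → OrderParametersNonzero S Φ β →
      (∀ k ∈ S.B, ∀ g ∈ S.GG k, σ₀ ≤ ‖S.σ Φ k g (β k g)‖) → HasRounds S Δ d N →
      ∀ V ∈ S.gates H, ∃ 𝓔 : Op Λ → Op Λ, S.IsLogicalChannel H 𝓔 ∧
        DiamondDistLE 𝓔 (fun ρ => V * ρ * Vᴴ) ε ∧ Implements S H Φ 𝓔 := by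
  obtain ⟨n, hn⟩ := exists_gate_word m (η := ε / 4) (by positivity)
  set σ₁ := min σ₀ 1 with hσ₁
  have hσ₁0 : 0 < σ₁ := lt_min hσ₀ one_pos
  obtain ⟨p, hp⟩ := exists_nat_gt (20 * n * Real.pi ^ 2 / (σ₁ ^ 2 * ε))
  have hp0 : (0 : ℝ) < p := lt_of_le_of_lt (by positivity) hp
  refine ⟨n * p + 1, fun Λ _ _ S H Φ χ β Δ d hR hβ hσ hN V hV => ?_⟩
  obtain ⟨l, hln, hl𝒢, c, P, hP, hc, hcη⟩ := hn Λ S H hR.maximal V hV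
  obtain ⟨w, hwl, hw𝒢, hwθ, hwprod⟩ := exists_small_word (H := H) l hl𝒢 (p := p)
    (by exact_mod_cast hp0)
  have hlen : w.length ≤ n * p := hwl ▸ Nat.mul_le_mul_right p hln
  obtain ⟨𝓔, h1, h2, h3⟩ := exists_implements hR hβ hσ₁0 (min_le_right _ _)
    (fun k hk g hg => (min_le_left _ _).trans (hσ k hk g hg)) hN hlen hw𝒢 hwθ
  refine ⟨𝓔, h1, DiamondBound.diamondDistLE ?_, h3⟩
  rw [← hwprod] at hc
  set W := (w.map fun y => rot (S.T H y.1) y.2).prod with hW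
  have hWu : W ∈ unitaryGroup (Λ → Fin 2) ℂ := by
    refine Submonoid.list_prod_mem _ fun y hy => ?_
    obtain ⟨x, -, rfl⟩ := List.mem_map.1 hy
    exact rot_mem_unitaryGroup (S.T_conjTranspose H _) (S.T_mul_self H _) _
  have h4 : W - V = ∑ z, (-c z) • P z := by
    simp only [neg_smul, Finset.sum_neg_distrib, ← hc, neg_sub]
  have h5 := h2.trans (diamondBound_conj hWu (Setting.gates_subset_unitaryGroup hV) hP h4)
  simp only [norm_neg] at h5
  intro k ρ hρ htr
  refine (h5 k ρ hρ htr).mono ?_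
  have h6 : (w.length : ℝ) * (10 * (Real.pi / p / σ₁) ^ 2) ≤ ε / 2 := by
    have h7 : (w.length : ℝ) ≤ n * p := by exact_mod_cast hlen
    calc (w.length : ℝ) * (10 * (Real.pi / p / σ₁) ^ 2)
        ≤ n * p * (10 * (Real.pi / p / σ₁) ^ 2) :=
          mul_le_mul_of_nonneg_right h7 (by positivity)
      _ = 20 * n * Real.pi ^ 2 / (σ₁ ^ 2 * ε) / p * (ε / 2) := by
          field_simp
          ring
      _ ≤ 1 * (ε / 2) := by
          refine mul_le_mul_of_nonneg_right ?_ (by positivity)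
          rw [div_le_one hp0]
          exact hp.le
      _ = ε / 2 := one_mul _
  linarith

end Gates

end MBQC

theorem theorem2 (m : ℕ) :
    (∀ (Λ : Type) [Fintype Λ] [DecidableEq Λ] (S : MBQC.Setting m Λ)
        (H : Submodule (ZMod 2) (MBQC.G m)) (Φ : MBQC.Vec Λ) (χ : MBQC.G m → ZMod 2)
        (β : Λ → MBQC.G m → MBQC.Pauli) (Δ : ℕ) (d : ℝ),
        MBQC.IsResource S H Φ χ Δ d → MBQC.OrderParametersNonzero S Φ β →
        MBQC.InitAndReadout S H Φ χ) ∧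
    (∀ ε : ℝ, 0 < ε → ∀ σ₀ : ℝ, 0 < σ₀ → ∃ N : ℕ,
      ∀ (Λ : Type) [Fintype Λ] [DecidableEq Λ] (S : MBQC.Setting m Λ)
        (H : Submodule (ZMod 2) (MBQC.G m)) (Φ : MBQC.Vec Λ) (χ : MBQC.G m → ZMod 2)
        (β : Λ → MBQC.G m → MBQC.Pauli) (Δ : ℕ) (d : ℝ),
        MBQC.IsResource S H Φ χ Δ d → MBQC.OrderParametersNonzero S Φ β →
        (∀ k ∈ S.B, ∀ g ∈ S.GG k, σ₀ ≤ ‖S.σ Φ k g (β k g)‖) →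
        MBQC.HasRounds S Δ d N →
        ∀ V ∈ S.gates H, ∃ 𝓔 : MBQC.Op Λ → MBQC.Op Λ,
          S.IsLogicalChannel H 𝓔 ∧
          MBQC.DiamondDistLE 𝓔 (fun ρ => V * ρ * V.conjTranspose) ε ∧
          MBQC.Implements S H Φ 𝓔) :=
  ⟨fun _ _ _ _ _ _ _ _ _ _ hR _ => MBQC.initAndReadout hR,
    fun _ hε _ hσ₀ => MBQC.exists_rounds m hε hσ₀⟩
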